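/- Let $G$ be a compact Lie group acting smoothly from the left on a smooth manifold $M$, let $\pi : M \to X = M/G$ be the projection onto the orbit space, let $s,t : G\times M\to M$, $s(g,p)=p$, $t(g,p)=gp$, be source and target of the action groupoid $G\ltimes M$, and let $\Lambda_0=\{(g,p)\in G\times M \mid gp=p\}$ with inclusion $\iota:\Lambda_0\hookrightarrow G\times M$. All functions are real valued. *Hochschild sheaf complex.* For $V\subset M$ open and $G$-invariant let $\mathcal A(V/G)=\mathcal C^\infty(G\times V)$ (the sections of the convolution sheaf of $G\ltimes M$), with the $\mathcal C^\infty(V)$-bimodule structure $(f\cdot a\cdot f')(g,v)=f(gv)\,a(g,v)\,f'(v)$. Put $C_k(V)=C_k(\mathcal C^\infty(V),\mathcal A(V/G))=\mathcal A(V/G)\,\hat\otimes\,\mathcal C^\infty(V)^{\hat\otimes k}$, where $\hat\otimes$ is the completed projective bornological tensor product for the von Neumann bornologies of the Fréchet spaces of smooth functions, with the Hochschild boundary $$b(a\otimes f_1\otimes\cdots\otimes f_k)=a f_1\otimes f_2\otimes\cdots\otimes f_k+\sum_{i=1}^{k-1}(-1)^i a\otimes f_1\otimes\cdots\otimes f_if_{i+1}\otimes\cdots\otimes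 f_k+(-1)^k f_k a\otimes f_1\otimes\cdots\otimes f_{k-1}.$$ Let $\hat{\mathscr C}_\bullet(\mathcal C^\infty_M,\mathcal A)$ be the complex of sheaves on $X$ obtained by sheafifying $V/G\mapsto C_\bullet(V)$. *Relative forms.* For $W\subset G\times M$ open let $\Omega^k(W)$ be the smooth sections over $W$ of $s^*\bigwedge^kT^*M$, let $d$ be the differential in the direction of $M$, and let $\mathcal J(W)$ be the ideal of smooth functions on $W$ that vanish on $W\cap\Lambda_0$. The sheaf of relative $k$-forms on the loop space is $$\Omega^k_{\mathrm r,\Lambda_0}=\iota^{-1}\bigl(\Omega^k/(\mathcal J\,\Omega^k+d\mathcal J\wedge\Omega^{k-1})\bigr);$$ write $[\omega]_{\Lambda_0}$ for the class of $\omega\in\Omega^k(W)$ over $W\cap\Lambda_0$. A section of $\Omega^k_{\mathrm r,\Lambda_0}$ over an open $Y\subset\Lambda_0$ is *horizontal* if it equals $[\omega]_{\Lambda_0}$ for some open $W\subset G\times M$ with $W\cap\Lambda_0=Y$ and some $\omega\in\Omega^k(W)$ with $\omega_{(g,p)}\in\bigwedge^k\bigl(T_pM/T_p(Gp)\bigr)^*$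 for all $(g,p)\in Y$. **Proposition.** 1. For all $k\ge0$ and all $G$-invariant open $V\subset M$ there is a unique bounded linear map $\Psi_{k,V}:C_k(V)\to\Omega^k(G\times V)$ with $$\Psi_{k,V}(f_0\otimes f_1\otimes\cdots\otimes f_k)=f_0\,d(s^*f_1)\wedge\cdots\wedge d(s^*f_k),$$ and it is linear over $\mathcal C^\infty(V/G)=\mathcal C^\infty(V)^G$. 2. The maps $\Phi_{k,V/G}:c\mapsto[\Psi_{k,V}(c)]_{\Lambda_0}$ into the sections of $\Omega^k_{\mathrm r,\Lambda_0}$ over $\Lambda_0\cap(G\times V)$ are the components of a morphism (necessarily unique) of complexes of sheaves on $X$ $$\Phi_\bullet:\hat{\mathscr C}_\bullet(\mathcal C^\infty_M,\mathcal A)\to\pi_*(s|_{\Lambda_0})_*\,\Omega^\bullet_{\mathrm r,\Lambda_0},$$ where the target carries the zero differential. 3. For every $k\ge 0$ and every open $U\subset X$, $\Phi_k$ maps each cycle $c\in\Gamma(U,\hat{\mathscr C}_k(\mathcal C^\infty_M,\mathcal A))$ to a horizontal relative form over $\{(g,p)\in\Lambda_0\mid\pi(p)\in U\}$. -/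

import Mathlib

set_option linter.unusedSectionVars false

open Set Filter Topology CategoryTheory TopologicalSpace Opposite
open scoped Manifold ContDiff

namespace LoopForms

universe u

noncomputable section

section CompletedTensor

/-- Summable real functions on `X` with bounded support, i.e. absolutely convergent series of
point masses supported in a bounded subset of `X`. -/
def BddL1 (X : Type u) [Bornology X] : Submodule ℝ (X → ℝ) where
  carrier := {c | Summable c ∧ Bornology.IsBounded (Function.support c)}
  zero_mem' := ⟨summable_zero, by simp⟩
  add_mem' := fun {a b} ha hb =>
    ⟨ha.1.add hb.1, (ha.2.union hb.2).subset (Function.support_add a b)⟩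
  smul_mem' := fun r c hc =>
    ⟨hc.1.mul_left r, hc.2.subset (Function.support_const_smul_subset r c)⟩

variable {X Y Z : Type u} [Bornology X] [Bornology Y] [Bornology Z]

open Classical in
/-- The point mass at `x`. -/
def pointMass (x : X) : BddL1 X :=
  ⟨Pi.single x 1, (hasSum_pi_single x (1 : ℝ)).summable,
    (Bornology.isBounded_singleton (x := x)).subset (Pi.support_single_subset)⟩

/-- A map is bounded if it maps bounded sets to bounded sets. -/
def BddMap (φ : X → Y) : Prop :=
  ∀ S : Set X, Bornology.IsBounded S → Bornology.IsBounded (φ '' S)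

lemma BddMap.comp {φ : X → Y} {ψ : Y → Z} (hψ : BddMap ψ) (hφ : BddMap φ) :
    BddMap (ψ ∘ φ) := fun S hS => by
  rw [image_comp]; exact hψ _ (hφ _ hS)

lemma summable_graph {X Y : Type u} (φ : X → Y) {c : X → ℝ} (hc : Summable c) :
    Summable (fun p : Y × X => (φ ⁻¹' {p.1}).indicator c p.2) := by
  have hi : Function.Injective (fun x : X => (φ x, x)) := fun a b h => (Prod.ext_iff.1 h).2
  rw [← hi.summable_iff]
  · refine hc.congr fun x => ?_
    simp [Function.comp]
  · rintro ⟨y, x⟩ h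
    refine indicator_of_notMem (fun hx => h ⟨x, ?_⟩) _
    simp only [mem_preimage, mem_singleton_iff] at hx
    simp [hx]

/-- Push-forward of summable functions along a bounded map: the linear extension of
`pointMass x ↦ pointMass (φ x)`. -/
def push (φ : X → Y) (hφ : BddMap φ) : BddL1 X →ₗ[ℝ] BddL1 Y where
  toFun c := ⟨fun y => ∑' x, (φ ⁻¹' {y}).indicator c.1 x,
    (summable_graph φ c.2.1).prod, by
      refine (hφ _ c.2.2).subset fun y hy => ?_
      by_contra h
      refine hy ?_
      have : ∀ x, (φ ⁻¹' {y}).indicator c.1 x = 0 := fun x => by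
        by_contra hx
        have h1 := mem_of_indicator_ne_zero hx
        have h2 : c.1 x ≠ 0 := by rwa [indicator_of_mem h1] at hx
        exact h ⟨x, h2, h1⟩
      simp [this]⟩
  map_add' a b := by
    ext y
    simp only [Submodule.coe_add, Set.indicator_add', Pi.add_apply]
    exact (a.2.1.indicator _).tsum_add (b.2.1.indicator _)
  map_smul' r a := by
    ext y
    simp only [Submodule.coe_smul, RingHom.id_apply, Pi.smul_apply, smul_eq_mul, ← tsum_mul_left]
    refine tsum_congr fun x => ?_
    by_cases h : x ∈ φ ⁻¹' {y} <;> simp [h]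

lemma push_apply (φ : X → Y) (hφ : BddMap φ) (c : BddL1 X) (y : Y) :
    (push φ hφ c).1 y = ∑' x, (φ ⁻¹' {y}).indicator c.1 x := rfl

lemma push_pointMass (φ : X → Y) (hφ : BddMap φ) (x : X) :
    push φ hφ (pointMass x) = pointMass (φ x) := by
  classical
  ext y
  rw [push_apply, tsum_eq_single x]
  · by_cases h : φ x = y
    · subst h; simp [pointMass]
    · simp [pointMass, h, Ne.symm h]
  · intro x' hx'
    simp [pointMass, Set.indicator, hx']

lemma push_id (c : BddL1 X) (h : BddMap (id : X → X)) : push id h c = c := by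
  ext y
  rw [push_apply, tsum_eq_single y]
  · simp
  · intro x hx
    simp [Set.indicator, hx]

lemma push_push (φ : X → Y) (hφ : BddMap φ) (ψ : Y → Z) (hψ : BddMap ψ) (c : BddL1 X) :
    push ψ hψ (push φ hφ c) = push (ψ ∘ φ) (hψ.comp hφ) c := by
  ext z
  let F : Y → X → ℝ := fun y x =>
    (ψ ⁻¹' {z}).indicator (fun y' => (φ ⁻¹' {y'}).indicator c.1 x) y
  have h1 : ∀ y, (ψ ⁻¹' {z}).indicator (push φ hφ c).1 y = ∑' x, F y x := fun y => by
    by_cases h : y ∈ ψ ⁻¹' {z}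
    · simp only [F, Set.indicator_of_mem h, push_apply]
    · simp only [F, Set.indicator_of_notMem h, tsum_zero]
  have hs : Summable (Function.uncurry F) := by
    refine ((summable_graph φ c.2.1).indicator (Prod.fst ⁻¹' (ψ ⁻¹' {z}))).congr fun p => ?_
    by_cases h : p.1 ∈ ψ ⁻¹' {z}
    · rw [Set.indicator_of_mem (by exact h)]
      simp only [F, Function.uncurry_def, Set.indicator_of_mem h]
    · rw [Set.indicator_of_notMem (by exact h)]
      simp only [F, Function.uncurry_def, Set.indicator_of_notMem h]
  have h2 : ∀ x, ∑' y, F y x = ((ψ ∘ φ) ⁻¹' {z}).indicator c.1 x := fun x => by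
    rw [tsum_eq_single (φ x)]
    · by_cases h : ψ (φ x) = z <;> simp [F, Set.indicator, h]
    · intro y hy
      simp [F, Set.indicator, Ne.symm hy]
  calc (push ψ hψ (push φ hφ c)).1 z = ∑' y, ∑' x, F y x := tsum_congr h1
    _ = ∑' x, ∑' y, F y x := hs.tsum_comm.symm
    _ = (push (ψ ∘ φ) (hψ.comp hφ) c).1 z := tsum_congr h2

lemma tsum_abs_push_le (φ : X → Y) (hφ : BddMap φ) (c : BddL1 X) :
    ∑' y, |(push φ hφ c).1 y| ≤ ∑' x, |c.1 x| := by
  have hg := summable_graph φ c.2.1.abs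
  have hab : ∀ y x, |(φ ⁻¹' {y}).indicator c.1 x| = (φ ⁻¹' {y}).indicator (fun x => |c.1 x|) x :=
    fun y x => by by_cases h : x ∈ φ ⁻¹' {y} <;> simp [h]
  have h1 : ∀ y, |(push φ hφ c).1 y| ≤ ∑' x, (φ ⁻¹' {y}).indicator (fun x => |c.1 x|) x := by
    intro y
    rw [push_apply]
    have hs : Summable fun x => ‖(φ ⁻¹' {y}).indicator c.1 x‖ := (c.2.1.indicator _).norm
    have h := norm_tsum_le_tsum_norm hs
    simp only [Real.norm_eq_abs, hab] at h
    exact h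
  have h2 : ∑' y, ∑' x, (φ ⁻¹' {y}).indicator (fun x => |c.1 x|) x = ∑' x, |c.1 x| := by
    have hg' : Summable (Function.uncurry fun (y : Y) (x : X) =>
      (φ ⁻¹' {y}).indicator (fun x => |c.1 x|) x) := hg
    rw [← hg'.tsum_comm]
    refine tsum_congr fun x => ?_
    rw [tsum_eq_single (φ x)]
    · simp
    · intro y hy
      simp [Set.indicator, Ne.symm hy]
  rw [← h2]
  exact (push φ hφ c).2.1.abs.tsum_le_tsum h1 hg.prod

/-- Bornologically closed subspaces: closed under `ℓ¹`-convergence of sequences whose members are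
supported in one bounded set. -/
def IsBornClosed (W : Submodule ℝ (BddL1 X)) : Prop :=
  ∀ S : Set X, Bornology.IsBounded S → ∀ (v : ℕ → BddL1 X) (c : BddL1 X),
    (∀ j, v j ∈ W ∧ Function.support (v j).1 ⊆ S) → Function.support c.1 ⊆ S →
    Tendsto (fun j => ∑' x, |(v j).1 x - c.1 x|) atTop (𝓝 0) → c ∈ W

/-- The smallest bornologically closed subspace containing `R`. -/
def bornClosure (R : Set (BddL1 X)) : Submodule ℝ (BddL1 X) :=
  sInf {W | R ⊆ W ∧ IsBornClosed W}

lemma subset_bornClosure (R : Set (BddL1 X)) : R ⊆ bornClosure R := fun r hr => by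
  simp only [bornClosure, SetLike.mem_coe, Submodule.mem_sInf]
  exact fun W hW => hW.1 hr

lemma isBornClosed_bornClosure (R : Set (BddL1 X)) : IsBornClosed (bornClosure R) := by
  intro S hS v c hv hc ht
  simp only [bornClosure, Submodule.mem_sInf] at hv ⊢
  exact fun W hW => hW.2 S hS v c (fun j => ⟨(hv j).1 W hW, (hv j).2⟩) hc ht

lemma support_push_subset (φ : X → Y) (hφ : BddMap φ) (c : BddL1 X) {S : Set X}
    (h : Function.support c.1 ⊆ S) : Function.support (push φ hφ c).1 ⊆ φ '' S := by
  intro y hy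
  by_contra h'
  refine hy ?_
  rw [push_apply]
  have : ∀ x, (φ ⁻¹' {y}).indicator c.1 x = 0 := fun x => by
    by_contra hx
    have h1 := mem_of_indicator_ne_zero hx
    have h2 : c.1 x ≠ 0 := by rwa [indicator_of_mem h1] at hx
    exact h' ⟨x, h h2, h1⟩
  simp [this]

lemma IsBornClosed.comap (φ : X → Y) (hφ : BddMap φ) {W : Submodule ℝ (BddL1 Y)}
    (hW : IsBornClosed W) : IsBornClosed (W.comap (push φ hφ)) := by
  intro S hS v c hv hc ht
  refine hW (φ '' S) (hφ S hS) (fun j => push φ hφ (v j)) (push φ hφ c)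
    (fun j => ⟨(hv j).1, support_push_subset φ hφ _ (hv j).2⟩) (support_push_subset φ hφ _ hc) ?_
  refine squeeze_zero (fun j => tsum_nonneg fun _ => abs_nonneg _) (fun j => ?_) ht
  have h := tsum_abs_push_le φ hφ (v j - c)
  rw [map_sub] at h
  simpa using h

lemma bornClosure_le_comap (φ : X → Y) (hφ : BddMap φ) {R : Set (BddL1 X)}
    {R' : Set (BddL1 Y)} (h : ∀ r ∈ R, push φ hφ r ∈ bornClosure R') :
    bornClosure R ≤ (bornClosure R').comap (push φ hφ) :=
  sInf_le ⟨h, (isBornClosed_bornClosure R').comap φ hφ⟩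

variable (A B : Type u) [AddCommGroup A] [Module ℝ A] [AddCommGroup B] [Module ℝ B]
  [Bornology A] [Bornology B] (k : ℕ)

/-- The relations expressing multilinearity of `(a, f) ↦ a ⊗ f₀ ⊗ ⋯ ⊗ fₖ₋₁`. -/
def multilinearRelations : Set (BddL1 (A × (Fin k → B))) :=
  {r | (∃ a a' f, r = pointMass (a + a', f) - pointMass (a, f) - pointMass (a', f)) ∨
    (∃ (s : ℝ) (a : A) (f : Fin k → B), r = pointMass (s • a, f) - s • pointMass (a, f)) ∨
    (∃ a f i b b', r = pointMass (a, Function.update f i (b + b'))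
      - pointMass (a, Function.update f i b) - pointMass (a, Function.update f i b')) ∨
    (∃ (a : A) (f : Fin k → B) (i : Fin k) (s : ℝ) (b : B), r =
      pointMass (a, Function.update f i (s • b)) - s • pointMass (a, Function.update f i b))}

/-- The completed projective bornological tensor product `A ⊗̂ B ⊗̂ ⋯ ⊗̂ B` with `k` factors `B`:
the quotient of the free complete bornological space on `A × B^k` (bounded maps from `A × B^k` to a
complete bornological space extend uniquely to bounded linear maps from `BddL1 (A × B^k)`) by the
bornological closure of the multilinear relations. Hence bounded linear maps from it to a complete
bornological space are the same as bounded multilinear maps from `A × B^k`. -/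
abbrev CompletedTensor : Type u :=
  BddL1 (A × (Fin k → B)) ⧸ bornClosure (multilinearRelations A B k)

variable {A B k}

/-- The pure tensor `a ⊗ f₀ ⊗ ⋯ ⊗ fₖ₋₁`. -/
def pureTensor (x : A × (Fin k → B)) : CompletedTensor A B k := Submodule.Quotient.mk (pointMass x)

/-- The bornology of the completed tensor product: a set is bounded if its members are represented
by functions with a common bounded support and uniformly bounded `ℓ¹`-norms. -/
def IsBddTensor (S : Set (CompletedTensor A B k)) : Prop :=
  ∃ (D : Set (A × (Fin k → B))) (C : ℝ), Bornology.IsBounded D ∧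
    ∀ s ∈ S, ∃ c : BddL1 (A × (Fin k → B)), Submodule.Quotient.mk c = s ∧
      Function.support c.1 ⊆ D ∧ ∑' x, |c.1 x| ≤ C

section Map

variable {A' B' : Type u} [AddCommGroup A'] [Module ℝ A'] [AddCommGroup B'] [Module ℝ B']
  [Bornology A'] [Bornology B'] {l : ℕ}

/-- A map on tuples which is bounded and becomes multilinear after passing to pure tensors. -/
structure IsTensorMap (φ : A × (Fin k → B) → A' × (Fin l → B')) : Prop where
  bdd : BddMap φ
  add_left : ∀ a a' f,
    pureTensor (φ (a + a', f)) = pureTensor (φ (a, f)) + pureTensor (φ (a', f))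
  smul_left : ∀ (s : ℝ) a f, pureTensor (φ (s • a, f)) = s • pureTensor (φ (a, f))
  add_right : ∀ a f i b b', pureTensor (φ (a, Function.update f i (b + b'))) =
    pureTensor (φ (a, Function.update f i b)) + pureTensor (φ (a, Function.update f i b'))
  smul_right : ∀ a f i (s : ℝ) b, pureTensor (φ (a, Function.update f i (s • b))) =
    s • pureTensor (φ (a, Function.update f i b))

/-- The linear map of completed tensor products induced by a map on tuples. -/
def tensorMap (φ : A × (Fin k → B) → A' × (Fin l → B')) (hφ : IsTensorMap φ) :
    CompletedTensor A B k →ₗ[ℝ] CompletedTensor A' B' l :=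
  Submodule.mapQ _ _ (push φ hφ.bdd) (bornClosure_le_comap φ hφ.bdd (by
    rintro r (⟨a, a', f, rfl⟩ | ⟨s, a, f, rfl⟩ | ⟨a, f, i, b, b', rfl⟩ | ⟨a, f, i, s, b, rfl⟩)
    · simp only [map_sub, push_pointMass, ← Submodule.Quotient.mk_eq_zero,
        Submodule.Quotient.mk_sub]
      rw [sub_sub, sub_eq_zero]
      exact hφ.add_left a a' f
    · simp only [map_sub, map_smul, push_pointMass, ← Submodule.Quotient.mk_eq_zero,
        Submodule.Quotient.mk_sub, Submodule.Quotient.mk_smul, sub_eq_zero]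
      exact hφ.smul_left s a f
    · simp only [map_sub, push_pointMass, ← Submodule.Quotient.mk_eq_zero,
        Submodule.Quotient.mk_sub]
      rw [sub_sub, sub_eq_zero]
      exact hφ.add_right a f i b b'
    · simp only [map_sub, map_smul, push_pointMass, ← Submodule.Quotient.mk_eq_zero,
        Submodule.Quotient.mk_sub, Submodule.Quotient.mk_smul, sub_eq_zero]
      exact hφ.smul_right a f i s b))

lemma tensorMap_mk (φ : A × (Fin k → B) → A' × (Fin l → B')) (hφ : IsTensorMap φ)
    (c : BddL1 (A × (Fin k → B))) :
    tensorMap φ hφ (Submodule.Quotient.mk c) = Submodule.Quotient.mk (push φ hφ.bdd c) := rfl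

lemma tensorMap_pureTensor (φ : A × (Fin k → B) → A' × (Fin l → B')) (hφ : IsTensorMap φ)
    (x : A × (Fin k → B)) : tensorMap φ hφ (pureTensor x) = pureTensor (φ x) := by
  rw [pureTensor, tensorMap_mk, push_pointMass]; rfl

lemma tensorMap_tensorMap {A'' B'' : Type u} [AddCommGroup A''] [Module ℝ A''] [AddCommGroup B'']
    [Module ℝ B''] [Bornology A''] [Bornology B''] {p : ℕ}
    (φ : A × (Fin k → B) → A' × (Fin l → B')) (hφ : IsTensorMap φ)
    (ψ : A' × (Fin l → B') → A'' × (Fin p → B'')) (hψ : IsTensorMap ψ)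
    (χ : A × (Fin k → B) → A'' × (Fin p → B'')) (hχ : IsTensorMap χ) (h : ψ ∘ φ = χ)
    (t : CompletedTensor A B k) : tensorMap ψ hψ (tensorMap φ hφ t) = tensorMap χ hχ t := by
  subst h
  obtain ⟨c, rfl⟩ := Submodule.Quotient.mk_surjective _ t
  simp only [tensorMap_mk, push_push]

lemma tensorMap_id (φ : A × (Fin k → B) → A × (Fin k → B)) (hφ : IsTensorMap φ) (h : φ = id)
    (t : CompletedTensor A B k) : tensorMap φ hφ t = t := by
  subst h
  obtain ⟨c, rfl⟩ := Submodule.Quotient.mk_surjective _ t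
  simp only [tensorMap_mk, push_id]

end Map

end CompletedTensor

section Relations

variable {A B : Type u} [AddCommGroup A] [Module ℝ A] [AddCommGroup B] [Module ℝ B]
  [Bornology A] [Bornology B] {k : ℕ}

lemma pureTensor_add_left (a a' : A) (f : Fin k → B) :
    pureTensor (a + a', f) = pureTensor (a, f) + pureTensor (a', f) := by
  rw [← sub_eq_zero, ← sub_sub]
  exact (Submodule.Quotient.mk_eq_zero _).2 (subset_bornClosure _ (Or.inl ⟨a, a', f, rfl⟩))

lemma pureTensor_smul_left (s : ℝ) (a : A) (f : Fin k → B) :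
    pureTensor (s • a, f) = s • pureTensor (a, f) := by
  rw [← sub_eq_zero]
  exact (Submodule.Quotient.mk_eq_zero _).2
    (subset_bornClosure _ (Or.inr (Or.inl ⟨s, a, f, rfl⟩)))

lemma pureTensor_add_right (a : A) (f : Fin k → B) (i : Fin k) (b b' : B) :
    pureTensor (a, Function.update f i (b + b')) =
      pureTensor (a, Function.update f i b) + pureTensor (a, Function.update f i b') := by
  rw [← sub_eq_zero, ← sub_sub]
  exact (Submodule.Quotient.mk_eq_zero _).2
    (subset_bornClosure _ (Or.inr (Or.inr (Or.inl ⟨a, f, i, b, b', rfl⟩))))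

lemma pureTensor_smul_right (a : A) (f : Fin k → B) (i : Fin k) (s : ℝ) (b : B) :
    pureTensor (a, Function.update f i (s • b)) =
      s • pureTensor (a, Function.update f i b) := by
  rw [← sub_eq_zero]
  exact (Submodule.Quotient.mk_eq_zero _).2
    (subset_bornClosure _ (Or.inr (Or.inr (Or.inr ⟨a, f, i, s, b, rfl⟩))))

end Relations

section BddMaps

variable {X Y Z : Type u} [Bornology X] [Bornology Y] [Bornology Z]

lemma BddMap.const (y : Y) : BddMap (fun _ : X => y) := fun S _ =>
  (Bornology.isBounded_singleton (x := y)).subset (by rintro _ ⟨x, -, rfl⟩; rfl)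

lemma BddMap.prodMk {φ : X → Y} {ψ : X → Z} (hφ : BddMap φ) (hψ : BddMap ψ) :
    BddMap (fun x => (φ x, ψ x)) := fun S hS => by
  refine Bornology.isBounded_image_fst_and_snd.1 ⟨?_, ?_⟩
  · rw [image_image]; exact hφ S hS
  · rw [image_image]; exact hψ S hS

lemma BddMap.pi {l : ℕ} {φ : Fin l → X → Y} (h : ∀ j, BddMap (φ j)) :
    BddMap (fun x j => φ j x) := fun S hS => by
  refine Bornology.forall_isBounded_image_eval_iff.1 fun j => ?_
  rw [image_image]
  exact h j S hS

lemma bddMap_fst : BddMap (Prod.fst : X × Y → X) := fun _ hS => hS.image_fst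

lemma bddMap_snd_eval {k : ℕ} (i : Fin k) : BddMap (fun x : X × (Fin k → Y) => x.2 i) :=
  fun S hS => by
  have := hS.image_snd.image_eval i
  rwa [image_image] at this

/-- A bornological algebra has bounded multiplication. -/
class BddMul (A : Type u) [Mul A] [Bornology A] : Prop where
  bdd : BddMap (fun p : A × A => p.1 * p.2)

lemma BddMap.mul {A : Type u} [Mul A] [Bornology A] [BddMul A] {φ ψ : X → A}
    (hφ : BddMap φ) (hψ : BddMap ψ) : BddMap (fun x => φ x * ψ x) :=
  BddMul.bdd.comp (hφ.prodMk hψ)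

end BddMaps

section Hochschild

variable {A B : Type u} [CommRing A] [Algebra ℝ A] [CommRing B] [Algebra ℝ B]
  [Bornology A] [Bornology B]

lemma BddMap.prod {X : Type u} [Bornology X] [BddMul A] {ι : Type*} (I : Finset ι)
    {φ : ι → X → A} (h : ∀ i, BddMap (φ i)) : BddMap (fun x => ∏ i ∈ I, φ i x) := by
  classical
  induction I using Finset.induction_on with
  | empty => simpa using BddMap.const (1 : A)
  | insert i I hi ih =>
    simp only [Finset.prod_insert hi]
    exact (h i).mul ih

/-- Two homomorphisms `s, t : B → A` turn `A` into a `B`-bimodule `b · a · b' = t(b) a s(b')`.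
`coeffPart` tells how a tensor factor `b` is absorbed in `A`: through the right action `s` for
`inr false`, through the left action `t` for `inr true`, and not at all for `inl j`. -/
def coeffPart (s t : B →ₐ[ℝ] A) {l : ℕ} : Fin l ⊕ Bool → B → A
  | .inl _, _ => 1
  | .inr false, b => s b
  | .inr true, b => t b

/-- The map on tuples `(a, f)` which multiplies `a` with `s (f i)` if `σ i = inr false` and with
`t (f i)` if `σ i = inr true`, and which collects in the `j`-th slot the product of all `f i` with
`σ i = inl j`. -/
def regroup (s t : B →ₐ[ℝ] A) {k l : ℕ} (σ : Fin k → Fin l ⊕ Bool) (x : A × (Fin k → B)) :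
    A × (Fin l → B) :=
  (x.1 * ∏ i, coeffPart s t (σ i) (x.2 i), fun j => ∏ i, if σ i = .inl j then x.2 i else 1)

variable (s t : B →ₐ[ℝ] A)

lemma regroup_regroup {k l p : ℕ} (σ : Fin k → Fin l ⊕ Bool) (τ : Fin l → Fin p ⊕ Bool)
    (x : A × (Fin k → B)) :
    regroup s t τ (regroup s t σ x) = regroup s t (fun i => Sum.elim τ Sum.inr (σ i)) x := by
  refine Prod.ext ?_ (funext fun q => ?_)
  · simp only [regroup]
    have h : ∀ j : Fin l, coeffPart s t (τ j) (∏ i, if σ i = .inl j then x.2 i else 1) =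
        ∏ i, if σ i = .inl j then coeffPart s t (τ j) (x.2 i) else 1 := by
      intro j
      rcases τ j with q | (_ | _)
      · simp [coeffPart]
      · simp only [coeffPart, map_prod]
        exact Finset.prod_congr rfl fun i _ => by split_ifs <;> simp
      · simp only [coeffPart, map_prod]
        exact Finset.prod_congr rfl fun i _ => by split_ifs <;> simp
    simp only [h]
    rw [Finset.prod_comm, mul_assoc, ← Finset.prod_mul_distrib]
    congr 1
    refine Finset.prod_congr rfl fun i _ => ?_
    generalize σ i = r
    rcases r with j | e
    · simp [coeffPart]
    · cases e <;> simp [coeffPart]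
  · simp only [regroup]
    have h : ∀ j : Fin l, (if τ j = .inl q then ∏ i, (if σ i = .inl j then x.2 i else 1) else 1) =
        ∏ i, if σ i = .inl j then (if τ j = .inl q then x.2 i else 1) else 1 := by
      intro j
      split_ifs <;> simp
    simp only [h]
    rw [Finset.prod_comm]
    refine Finset.prod_congr rfl fun i _ => ?_
    obtain ⟨j, hσ⟩ | ⟨e, hσ⟩ : (∃ j, σ i = .inl j) ∨ ∃ e, σ i = .inr e := by
      rcases σ i with j | e
      · exact Or.inl ⟨j, rfl⟩
      · exact Or.inr ⟨e, rfl⟩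
    · simp [hσ]
    · simp [hσ]

lemma regroup_update_inr {k l : ℕ} (σ : Fin k → Fin l ⊕ Bool) (i : Fin k)
    (hi : ∀ j, σ i ≠ .inl j) (a : A) (f : Fin k → B) (b : B) :
    regroup s t σ (a, Function.update f i b) =
      (a * (∏ i' ∈ Finset.univ.erase i, coeffPart s t (σ i') (f i')) * coeffPart s t (σ i) b,
        (regroup s t σ (a, f)).2) := by
  refine Prod.ext ?_ (funext fun j => ?_)
  · simp only [regroup]
    rw [← Finset.mul_prod_erase _ _ (Finset.mem_univ i), Function.update_self,
      mul_comm (coeffPart s t (σ i) b), mul_assoc]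
    congr 2
    refine Finset.prod_congr rfl fun i' hi' => ?_
    rw [Function.update_of_ne (Finset.ne_of_mem_erase hi')]
  · simp only [regroup]
    refine Finset.prod_congr rfl fun i' _ => ?_
    by_cases h : i' = i
    · subst h; simp [hi j]
    · rw [Function.update_of_ne h]

lemma regroup_update_inl {k l : ℕ} (σ : Fin k → Fin l ⊕ Bool) (i : Fin k) (j : Fin l)
    (hi : σ i = .inl j) (a : A) (f : Fin k → B) (b : B) :
    regroup s t σ (a, Function.update f i b) =
      ((regroup s t σ (a, f)).1, Function.update (regroup s t σ (a, f)).2 j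
        ((∏ i' ∈ Finset.univ.erase i, if σ i' = .inl j then f i' else 1) * b)) := by
  refine Prod.ext ?_ (funext fun j' => ?_)
  · simp only [regroup]
    congr 1
    refine Finset.prod_congr rfl fun i' _ => ?_
    by_cases h : i' = i
    · subst h; simp [hi, coeffPart]
    · rw [Function.update_of_ne h]
  · by_cases hj : j' = j
    · subst hj
      simp only [regroup, Function.update_self]
      rw [← Finset.mul_prod_erase _ _ (Finset.mem_univ i), if_pos hi, Function.update_self,
        mul_comm b]
      congr 1
      refine Finset.prod_congr rfl fun i' hi' => ?_
      rw [Function.update_of_ne (Finset.ne_of_mem_erase hi')]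
    · simp only [regroup]
      rw [Function.update_of_ne hj]
      refine Finset.prod_congr rfl fun i' _ => ?_
      by_cases h : i' = i
      · subst h; simp [hi, Ne.symm hj]
      · rw [Function.update_of_ne h]

lemma isTensorMap_regroup [BddMul A] [BddMul B] (hs : BddMap s) (ht : BddMap t) {k l : ℕ}
    (σ : Fin k → Fin l ⊕ Bool) : IsTensorMap (regroup s t σ) where
  bdd := by
    refine BddMap.prodMk (bddMap_fst.mul (BddMap.prod _ fun i => ?_))
      (BddMap.pi fun j => BddMap.prod _ fun i => ?_)
    · rcases σ i with q | (_ | _)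
      · exact BddMap.const _
      · exact hs.comp (bddMap_snd_eval i)
      · exact ht.comp (bddMap_snd_eval i)
    · split_ifs
      · exact bddMap_snd_eval i
      · exact BddMap.const _
  add_left a a' f := by
    simp only [regroup, add_mul, pureTensor_add_left]
  smul_left r a f := by
    simp only [regroup, smul_mul_assoc, pureTensor_smul_left]
  add_right a f i b b' := by
    rcases hσ : σ i with j | e
    · simp only [regroup_update_inl s t σ i j hσ, mul_add, pureTensor_add_right]
    · have hne : ∀ j, σ i ≠ .inl j := fun j => by simp [hσ]
      have hadd : coeffPart s t (σ i) (b + b') =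
          coeffPart s t (σ i) b + coeffPart s t (σ i) b' := by
        rw [hσ]; cases e <;> simp [coeffPart]
      simp only [regroup_update_inr s t σ i hne, hadd, mul_add, pureTensor_add_left]
  smul_right a f i r b := by
    rcases hσ : σ i with j | e
    · simp only [regroup_update_inl s t σ i j hσ, mul_smul_comm, pureTensor_smul_right]
    · have hne : ∀ j, σ i ≠ .inl j := fun j => by simp [hσ]
      have hsm : coeffPart s t (σ i) (r • b) = r • coeffPart s t (σ i) b := by
        rw [hσ]; cases e <;> simp [coeffPart]
      simp only [regroup_update_inr s t σ i hne, hsm, mul_smul_comm, pureTensor_smul_left]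

/-- The regrouping of the `i`-th face map of the Hochschild complex, applied to
`a ⊗ f₀ ⊗ ⋯ ⊗ fₖ`: for `i = 0` the factor `f₀` acts on `a` from the right, for `i = k + 1` the
factor `fₖ` acts on `a` from the left, and for `0 < i < k + 1` the factors `fᵢ₋₁` and `fᵢ` are
multiplied. -/
def faceIndex (k : ℕ) (i : Fin (k + 2)) (j : Fin (k + 1)) : Fin k ⊕ Bool :=
  if h : (j : ℕ) < i ∧ (j : ℕ) < k then .inl ⟨j, h.2⟩
  else if (j : ℕ) < i then .inr true
  else if h0 : (j : ℕ) = 0 then .inr false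
  else .inl ⟨j - 1, by omega⟩

lemma faceIndex_comp (k : ℕ) (i : Fin (k + 2)) (j : Fin (k + 3)) (h : (j : ℕ) ≤ i)
    (q : Fin (k + 2)) :
    Sum.elim (faceIndex k i) Sum.inr (faceIndex (k + 1) j q) =
      Sum.elim (faceIndex k ⟨j, by omega⟩) Sum.inr (faceIndex (k + 1) i.succ q) := by
  obtain ⟨i, hi⟩ := i
  obtain ⟨j, hj⟩ := j
  obtain ⟨q, hq⟩ := q
  simp only [faceIndex, Fin.succ_mk] at h ⊢
  split_ifs <;> simp [faceIndex] <;> grind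

variable [BddMul A] [BddMul B] (hs : BddMap s) (ht : BddMap t)

/-- The `i`-th face map. -/
def faceMap (k : ℕ) (i : Fin (k + 2)) :
    CompletedTensor A B (k + 1) →ₗ[ℝ] CompletedTensor A B k :=
  tensorMap (regroup s t (faceIndex k i)) (isTensorMap_regroup s t hs ht _)

/-- The Hochschild boundary
`b(a ⊗ f₁ ⊗ ⋯ ⊗ fₖ₊₁) = a f₁ ⊗ f₂ ⊗ ⋯ + ∑ᵢ (-1)ⁱ a ⊗ ⋯ ⊗ fᵢ fᵢ₊₁ ⊗ ⋯ + (-1)ᵏ⁺¹ fₖ₊₁ a ⊗ f₁ ⊗ ⋯ ⊗ fₖ`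
of the algebra `B` with coefficients in the bimodule `A`. -/
def hochschildB (k : ℕ) : CompletedTensor A B (k + 1) →ₗ[ℝ] CompletedTensor A B k :=
  ∑ i : Fin (k + 2), (-1 : ℝ) ^ (i : ℕ) • faceMap s t hs ht k i

lemma faceMap_faceMap (k : ℕ) (i : Fin (k + 2)) (j : Fin (k + 3)) (h : (j : ℕ) ≤ i) :
    faceMap s t hs ht k i ∘ₗ faceMap s t hs ht (k + 1) j =
      faceMap s t hs ht k ⟨j, by omega⟩ ∘ₗ faceMap s t hs ht (k + 1) i.succ := by
  refine LinearMap.ext fun c => ?_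
  simp only [LinearMap.comp_apply, faceMap]
  have h1 : regroup s t (faceIndex k i) ∘ regroup s t (faceIndex (k + 1) j) =
      regroup s t (faceIndex k ⟨j, by omega⟩) ∘ regroup s t (faceIndex (k + 1) i.succ) := by
    funext x
    simp only [Function.comp_apply, regroup_regroup, faceIndex_comp k i j h]
  have h2 : regroup s t (faceIndex k ⟨j, by omega⟩) ∘ regroup s t (faceIndex (k + 1) i.succ) =
      regroup s t (fun q => Sum.elim (faceIndex k ⟨j, by omega⟩) Sum.inr
        (faceIndex (k + 1) i.succ q)) := funext fun x => regroup_regroup s t _ _ x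
  rw [tensorMap_tensorMap _ _ _ _ _ (isTensorMap_regroup s t hs ht _) (h1.trans h2),
    tensorMap_tensorMap _ _ _ _ _ (isTensorMap_regroup s t hs ht _) h2]

lemma hochschildB_comp (k : ℕ) :
    hochschildB s t hs ht k ∘ₗ hochschildB s t hs ht (k + 1) = 0 := by
  have hexp : hochschildB s t hs ht k ∘ₗ hochschildB s t hs ht (k + 1) =
      ∑ i : Fin (k + 2), ∑ j : Fin (k + 3), ((-1 : ℝ) ^ (i : ℕ) * (-1 : ℝ) ^ (j : ℕ)) •
        (faceMap s t hs ht k i ∘ₗ faceMap s t hs ht (k + 1) j) := by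
    refine LinearMap.ext fun c => ?_
    simp only [hochschildB, LinearMap.comp_apply, LinearMap.sum_apply, LinearMap.smul_apply,
      map_sum, map_smul, smul_smul, Finset.smul_sum]
    exact Finset.sum_comm.trans (Finset.sum_congr rfl fun i _ => Finset.sum_congr rfl fun j _ => by
      rw [mul_comm])
  rw [hexp]
  simp only [← Finset.sum_product']
  let S : Finset (Fin (k + 2) × Fin (k + 3)) := {ij | (ij.2 : ℕ) ≤ (ij.1 : ℕ)}
  have hS : ∀ ij, ij ∈ S ↔ (ij.2 : ℕ) ≤ (ij.1 : ℕ) := fun ij => by simp [S]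
  rw [Finset.univ_product_univ, ← Finset.sum_add_sum_compl S, ← eq_neg_iff_add_eq_zero,
    ← Finset.sum_neg_distrib]
  refine Finset.sum_bij (fun ij hij => (⟨ij.2, by have := (hS ij).1 hij; omega⟩, ij.1.succ))
    ?_ ?_ ?_ ?_
  · intro ij hij
    have := (hS ij).1 hij
    simp only [Finset.mem_compl, hS, Fin.val_succ]
    omega
  · rintro ⟨i, j⟩ hij ⟨i', j'⟩ hij' h
    rw [Prod.mk.injEq] at h
    exact Prod.ext (Fin.succ_injective _ h.2) (Fin.ext (Fin.mk.inj_iff.1 h.1))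
  · rintro ⟨i', j'⟩ hij'
    simp only [Finset.mem_compl, hS, not_le] at hij'
    refine ⟨(⟨j' - 1, by omega⟩, ⟨i', by omega⟩), (hS _).2 (by simp only; omega), ?_⟩
    refine Prod.ext (Fin.ext rfl) (Fin.ext ?_)
    simp only [Fin.val_succ]
    omega
  · rintro ⟨i, j⟩ hij
    have hij' : (j : ℕ) ≤ i := (hS _).1 hij
    simp only
    rw [faceMap_faceMap s t hs ht k i j hij']
    refine LinearMap.ext fun c => ?_
    simp only [LinearMap.smul_apply, LinearMap.neg_apply, Fin.val_succ, pow_succ]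
    rw [← neg_smul]
    congr 1
    ring

end Hochschild

section SmoothFunctions

variable {E : Type*} [NormedAddCommGroup E] [NormedSpace ℝ E] {H : Type*} [TopologicalSpace H]
  (I : ModelWithCorners ℝ E H) {N : Type*} [TopologicalSpace N] [ChartedSpace H N]

/-- A set of real functions on a manifold whose derivatives of every order are, in charts, locally
uniformly bounded (equivalently, uniformly bounded on every compact set). -/
def LocallyBddDeriv (S : Set (N → ℝ)) : Prop :=
  ∀ (x : N) (r : ℕ), ∃ C : ℝ, ∀ᶠ y in 𝓝 (extChartAt I x x), ∀ f ∈ S,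
    ‖iteratedFDeriv ℝ r (f ∘ (extChartAt I x).symm) y‖ ≤ C

variable {I}

lemma LocallyBddDeriv.mono {S T : Set (N → ℝ)} (hT : LocallyBddDeriv I T) (h : S ⊆ T) :
    LocallyBddDeriv I S := fun x r => by
  obtain ⟨C, hC⟩ := hT x r
  exact ⟨C, hC.mono fun y hy f hf => hy f (h hf)⟩

lemma LocallyBddDeriv.union {S T : Set (N → ℝ)} (hS : LocallyBddDeriv I S)
    (hT : LocallyBddDeriv I T) : LocallyBddDeriv I (S ∪ T) := fun x r => by
  obtain ⟨C, hC⟩ := hS x r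
  obtain ⟨D, hD⟩ := hT x r
  refine ⟨max C D, (hC.and hD).mono ?_⟩
  rintro y ⟨h1, h2⟩ f (hf | hf)
  · exact (h1 f hf).trans (le_max_left _ _)
  · exact (h2 f hf).trans (le_max_right _ _)

variable [I.Boundaryless]

lemma eventually_contDiffAt [IsManifold I ∞ N] (x : N) :
    ∀ᶠ y in 𝓝 (extChartAt I x x), ∀ f : N → ℝ, ContMDiff I 𝓘(ℝ) ∞ f →
      ContDiffAt ℝ ∞ (f ∘ (extChartAt I x).symm) y := by
  filter_upwards [extChartAt_target_mem_nhds (I := I) x] with y hy f hf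
  have h1 : ContMDiffOn 𝓘(ℝ, E) I ∞ (extChartAt I x).symm (extChartAt I x).target :=
    contMDiffOn_extChartAt_symm x
  have h2 : ContMDiffOn 𝓘(ℝ, E) 𝓘(ℝ) ∞ (f ∘ (extChartAt I x).symm) (extChartAt I x).target :=
    hf.comp_contMDiffOn h1
  exact (h2.contDiffOn).contDiffAt ((isOpen_extChartAt_target x).mem_nhds hy)

lemma locallyBddDeriv_singleton [IsManifold I ∞ N] {f : N → ℝ} (hf : ContMDiff I 𝓘(ℝ) ∞ f) :
    LocallyBddDeriv I {f} := fun x r => by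
  have h := (eventually_contDiffAt (I := I) x).self_of_nhds f hf
  have hc : ContinuousAt (iteratedFDeriv ℝ r (f ∘ (extChartAt I x).symm)) (extChartAt I x x) :=
    (h.iteratedFDeriv_right (m := 0) (i := r) (by exact_mod_cast le_top)).continuousAt
  refine ⟨‖iteratedFDeriv ℝ r (f ∘ (extChartAt I x).symm) (extChartAt I x x)‖ + 1, ?_⟩
  filter_upwards [hc.norm.eventually (eventually_le_nhds (lt_add_one _))] with y hy g hg
  rw [hg]
  exact hy

lemma LocallyBddDeriv.mul [IsManifold I ∞ N] {S T : Set (N → ℝ)} (hS : LocallyBddDeriv I S)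
    (hT : LocallyBddDeriv I T) (hS' : ∀ f ∈ S, ContMDiff I 𝓘(ℝ) ∞ f)
    (hT' : ∀ f ∈ T, ContMDiff I 𝓘(ℝ) ∞ f) :
    LocallyBddDeriv I {h | ∃ f ∈ S, ∃ g ∈ T, h = f * g} := fun x r => by
  choose C hC using hS x
  choose D hD using hT x
  refine ⟨∑ i ∈ Finset.range (r + 1), (r.choose i : ℝ) * |C i| * |D (r - i)|, ?_⟩
  have hC' : ∀ᶠ y in 𝓝 (extChartAt I x x), ∀ i ∈ Finset.range (r + 1), ∀ f ∈ S,
      ‖iteratedFDeriv ℝ i (f ∘ (extChartAt I x).symm) y‖ ≤ C i :=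
    (Filter.eventually_all_finset _).2 fun i _ => hC i
  have hD' : ∀ᶠ y in 𝓝 (extChartAt I x x), ∀ i ∈ Finset.range (r + 1), ∀ f ∈ T,
      ‖iteratedFDeriv ℝ (r - i) (f ∘ (extChartAt I x).symm) y‖ ≤ D (r - i) :=
    (Filter.eventually_all_finset _).2 fun i _ => hD (r - i)
  have hev := eventually_eventually_nhds.2 (eventually_contDiffAt (I := I) x)
  filter_upwards [hC', hD', hev] with y h1 h2 h3
  rintro _ ⟨f, hf, g, hg, rfl⟩
  obtain ⟨U, hU, hUo, hyU⟩ := mem_nhds_iff.1 h3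
  have hfU : ContDiffOn ℝ ∞ (f ∘ (extChartAt I x).symm) U :=
    fun z hz => (hU hz f (hS' f hf)).contDiffWithinAt
  have hgU : ContDiffOn ℝ ∞ (g ∘ (extChartAt I x).symm) U :=
    fun z hz => (hU hz g (hT' g hg)).contDiffWithinAt
  have hm := norm_iteratedFDerivWithin_mul_le hfU hgU hUo.uniqueDiffOn hyU (n := r)
    (by exact_mod_cast le_top)
  simp only [iteratedFDerivWithin_of_isOpen _ hUo hyU] at hm
  refine (le_of_eq ?_).trans (hm.trans (Finset.sum_le_sum fun i hi => ?_))
  · rfl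
  · exact mul_le_mul (mul_le_mul_of_nonneg_left ((h1 i hi f hf).trans (le_abs_self _))
      (Nat.cast_nonneg _)) ((h2 i hi g hg).trans (le_abs_self _)) (norm_nonneg _)
      (mul_nonneg (Nat.cast_nonneg _) (abs_nonneg _))

variable {E' : Type*} [NormedAddCommGroup E'] [NormedSpace ℝ E'] {H' : Type*} [TopologicalSpace H']
  {I' : ModelWithCorners ℝ E' H'} {N' : Type*} [TopologicalSpace N'] [ChartedSpace H' N']
  [I'.Boundaryless]

lemma LocallyBddDeriv.comp [IsManifold I ∞ N] [IsManifold I' ∞ N'] {S : Set (N' → ℝ)}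
    (hS : LocallyBddDeriv I' S) (hS' : ∀ f ∈ S, ContMDiff I' 𝓘(ℝ) ∞ f) {φ : N → N'}
    (hφ : ContMDiff I I' ∞ φ) : LocallyBddDeriv I ((fun f => f ∘ φ) '' S) := fun x r => by
  choose C hC using hS (φ x)
  set h : E → E' := extChartAt I' (φ x) ∘ φ ∘ (extChartAt I x).symm with hh
  have hx : h (extChartAt I x x) = extChartAt I' (φ x) (φ x) := by simp [hh]
  have hcd : ContDiffAt ℝ ∞ h (extChartAt I x x) := by
    have := (contMDiffAt_iff.1 (hφ x)).2
    rw [I.range_eq_univ, contDiffWithinAt_univ] at this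
    exact this
  have hev1 : ∀ᶠ y in 𝓝 (extChartAt I x x), ContDiffAt ℝ r h y :=
    (hcd.of_le (by exact_mod_cast le_top : (r : ℕ∞ω) ≤ ∞)).eventually (by simp)
  have hcont : ContinuousAt h (extChartAt I x x) := hcd.continuousAt
  have hbd : ∀ i, ∃ D : ℝ, ∀ᶠ y in 𝓝 (extChartAt I x x), ‖iteratedFDeriv ℝ i h y‖ ≤ D := fun i => by
    have hc : ContinuousAt (iteratedFDeriv ℝ i h) (extChartAt I x x) :=
      (hcd.iteratedFDeriv_right (m := 0) (i := i) (by exact_mod_cast le_top)).continuousAt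
    exact ⟨_, hc.norm.eventually (eventually_le_nhds (lt_add_one _))⟩
  choose D hD using hbd
  set C' : ℝ := ∑ i ∈ Finset.range (r + 1), |C i| with hC'def
  set D' : ℝ := 1 + ∑ i ∈ Finset.range (r + 1), |D i| with hD'def
  refine ⟨r.factorial * C' * D' ^ r, ?_⟩
  have e1 : ∀ᶠ y in 𝓝 (extChartAt I x x), ∀ i ∈ Finset.range (r + 1), ∀ f ∈ S,
      ‖iteratedFDeriv ℝ i (f ∘ (extChartAt I' (φ x)).symm) (h y)‖ ≤ C i :=
    (Filter.eventually_all_finset _).2 fun i _ => hcont.eventually (by rw [hx]; exact hC i)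
  have e2 : ∀ᶠ y in 𝓝 (extChartAt I x x), ∀ i ∈ Finset.range (r + 1),
      ‖iteratedFDeriv ℝ i h y‖ ≤ D i := (Filter.eventually_all_finset _).2 fun i _ => hD i
  have e3 : ∀ᶠ z in 𝓝 (h (extChartAt I x x)), ∀ f : N' → ℝ, ContMDiff I' 𝓘(ℝ) ∞ f →
      ContDiffAt ℝ ∞ (f ∘ (extChartAt I' (φ x)).symm) z := by
    rw [hx]; exact eventually_contDiffAt (I := I') (φ x)
  obtain ⟨T, hT, hTo, hxT⟩ := mem_nhds_iff.1 e3
  have e4 : ∀ᶠ y in 𝓝 (extChartAt I x x),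
      (extChartAt I' (φ x)).symm (h y) = φ ((extChartAt I x).symm y) := by
    have hc2 : ContinuousAt (φ ∘ (extChartAt I x).symm) (extChartAt I x x) :=
      hφ.continuous.continuousAt.comp (continuousAt_extChartAt_symm x)
    have hsrc : (extChartAt I' (φ x)).source ∈
        𝓝 ((φ ∘ (extChartAt I x).symm) (extChartAt I x x)) := by
      simpa using extChartAt_source_mem_nhds (I := I') (φ x)
    filter_upwards [hc2 hsrc] with y hy
    exact (extChartAt I' (φ x)).left_inv hy
  have e5 : ∀ᶠ y in 𝓝 (extChartAt I x x), h y ∈ T := hcont.eventually (hTo.mem_nhds hxT)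
  filter_upwards [e1, e2, eventually_eventually_nhds.2 (hev1.and (e4.and e5))] with y h1 h2 h3
  rintro _ ⟨f, hf, rfl⟩
  obtain ⟨U, hU, hUo, hyU⟩ := mem_nhds_iff.1 h3
  have heq : ((fun f => f ∘ φ) f ∘ (extChartAt I x).symm) =ᶠ[𝓝 y]
      ((f ∘ (extChartAt I' (φ x)).symm) ∘ h) := by
    filter_upwards [hUo.mem_nhds hyU] with z hz
    simp only [Function.comp_apply]
    rw [(hU hz).2.1]
  rw [(heq.iteratedFDeriv ℝ r).self_of_nhds, ← iteratedFDerivWithin_of_isOpen _ hUo hyU]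
  refine norm_iteratedFDerivWithin_comp_le (t := T) (N := r)
    (fun z hz => ((hT hz f (hS' f hf)).of_le (by exact_mod_cast le_top)).contDiffWithinAt)
    (fun z hz => (hU hz).1.contDiffWithinAt) le_rfl hTo.uniqueDiffOn hUo.uniqueDiffOn
    (fun z hz => (hU hz).2.2) hyU (fun i hi => ?_) (fun i hi1 hi => ?_)
  · have hi' : i ∈ Finset.range (r + 1) := Finset.mem_range.2 (by omega)
    rw [iteratedFDerivWithin_of_isOpen _ hTo (hU hyU).2.2]
    exact (h1 i hi' f hf).trans ((le_abs_self _).trans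
      (Finset.single_le_sum (f := fun i => |C i|) (fun _ _ => abs_nonneg _) hi'))
  · have hi' : i ∈ Finset.range (r + 1) := Finset.mem_range.2 (by omega)
    rw [iteratedFDerivWithin_of_isOpen _ hUo hyU]
    have hD1 : 1 ≤ D' := le_add_of_nonneg_right (Finset.sum_nonneg fun _ _ => abs_nonneg _)
    have hDi : D i ≤ D' := (le_abs_self _).trans ((Finset.single_le_sum (f := fun i => |D i|)
      (fun _ _ => abs_nonneg _) hi').trans (le_add_of_nonneg_left zero_le_one))
    exact (h2 i hi').trans (hDi.trans (le_self_pow₀ hD1 (by omega)))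

end SmoothFunctions

section TensorFunctoriality

variable {A B A' B' : Type u} [CommRing A] [Algebra ℝ A] [CommRing B] [Algebra ℝ B]
  [Bornology A] [Bornology B] [CommRing A'] [Algebra ℝ A'] [CommRing B'] [Algebra ℝ B']
  [Bornology A'] [Bornology B']

lemma isTensorMap_map (α : A →ₐ[ℝ] A') (β : B →ₐ[ℝ] B') (hα : BddMap α) (hβ : BddMap β)
    (k : ℕ) : IsTensorMap (fun x : A × (Fin k → B) => (α x.1, fun i => β (x.2 i))) where
  bdd := (hα.comp bddMap_fst).prodMk (BddMap.pi fun i => hβ.comp (bddMap_snd_eval i))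
  add_left a a' f := by simp only [map_add, pureTensor_add_left]
  smul_left r a f := by simp only [map_smul, pureTensor_smul_left]
  add_right a f i b b' := by
    simp only [Function.apply_update (fun _ => β), map_add, pureTensor_add_right]
  smul_right a f i r b := by
    simp only [Function.apply_update (fun _ => β), map_smul, pureTensor_smul_right]

lemma tensorMap_map_map {A'' B'' : Type u} [CommRing A''] [Algebra ℝ A''] [CommRing B'']
    [Algebra ℝ B''] [Bornology A''] [Bornology B''] (α : A →ₐ[ℝ] A') (β : B →ₐ[ℝ] B')
    (hα : BddMap α) (hβ : BddMap β) (α' : A' →ₐ[ℝ] A'') (β' : B' →ₐ[ℝ] B'')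
    (hα' : BddMap α') (hβ' : BddMap β') (α'' : A →ₐ[ℝ] A'') (β'' : B →ₐ[ℝ] B'')
    (hα'' : BddMap α'') (hβ'' : BddMap β'') (h : ∀ a, α' (α a) = α'' a)
    (h' : ∀ b, β' (β b) = β'' b) (k : ℕ) (c : CompletedTensor A B k) :
    tensorMap _ (isTensorMap_map α' β' hα' hβ' k) (tensorMap _ (isTensorMap_map α β hα hβ k) c) =
      tensorMap _ (isTensorMap_map α'' β'' hα'' hβ'' k) c :=
  tensorMap_tensorMap _ (isTensorMap_map α β hα hβ k) _ (isTensorMap_map α' β' hα' hβ' k) _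
    (isTensorMap_map α'' β'' hα'' hβ'' k)
    (funext fun x => Prod.ext (h x.1) (funext fun i => h' (x.2 i))) c

lemma tensorMap_map_id (α : A →ₐ[ℝ] A) (β : B →ₐ[ℝ] B) (hα : BddMap α) (hβ : BddMap β)
    (h : ∀ a, α a = a) (h' : ∀ b, β b = b) (k : ℕ) (c : CompletedTensor A B k) :
    tensorMap _ (isTensorMap_map α β hα hβ k) c = c :=
  tensorMap_id _ _ (funext fun x => Prod.ext (h x.1) (funext fun i => h' (x.2 i))) c

lemma regroup_map {s t : B →ₐ[ℝ] A} {s' t' : B' →ₐ[ℝ] A'} (α : A →ₐ[ℝ] A') (β : B →ₐ[ℝ] B')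
    (hs : ∀ b, α (s b) = s' (β b)) (ht : ∀ b, α (t b) = t' (β b)) {k l : ℕ}
    (σ : Fin k → Fin l ⊕ Bool) (x : A × (Fin k → B)) :
    regroup s' t' σ (α x.1, fun i => β (x.2 i)) =
      (α (regroup s t σ x).1, fun j => β ((regroup s t σ x).2 j)) := by
  refine Prod.ext ?_ (funext fun j => ?_)
  · simp only [regroup, map_mul, map_prod]
    congr 1
    refine Finset.prod_congr rfl fun i _ => ?_
    rcases σ i with j | (_ | _) <;> simp [coeffPart, hs, ht]
  · simp only [regroup, map_prod]
    exact Finset.prod_congr rfl fun i _ => by split_ifs <;> simp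

lemma hochschildB_map [BddMul A] [BddMul B] [BddMul A'] [BddMul B'] {s t : B →ₐ[ℝ] A}
    {s' t' : B' →ₐ[ℝ] A'} (α : A →ₐ[ℝ] A') (β : B →ₐ[ℝ] B') (hα : BddMap α) (hβ : BddMap β)
    (hs : ∀ b, α (s b) = s' (β b)) (ht : ∀ b, α (t b) = t' (β b))
    (bs : BddMap s) (bt : BddMap t) (bs' : BddMap s') (bt' : BddMap t') (k : ℕ)
    (c : CompletedTensor A B (k + 1)) :
    hochschildB s' t' bs' bt' k (tensorMap _ (isTensorMap_map α β hα hβ (k + 1)) c) =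
      tensorMap _ (isTensorMap_map α β hα hβ k) (hochschildB s t bs bt k c) := by
  simp only [hochschildB, LinearMap.sum_apply, LinearMap.smul_apply, map_sum, map_smul]
  refine Finset.sum_congr rfl fun i _ => ?_
  congr 1
  have key : (regroup s' t' (faceIndex k i)) ∘
      (fun x : A × (Fin (k + 1) → B) => (α x.1, fun i => β (x.2 i))) =
      (fun x : A × (Fin k → B) => (α x.1, fun i => β (x.2 i))) ∘
        regroup s t (faceIndex k i) :=
    funext fun x => regroup_map α β hs ht _ x
  have hχ : IsTensorMap ((regroup s' t' (faceIndex k i)) ∘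
      (fun x : A × (Fin (k + 1) → B) => (α x.1, fun i => β (x.2 i)))) := by
    refine ⟨(isTensorMap_regroup s' t' bs' bt' _).bdd.comp
      (isTensorMap_map α β hα hβ (k + 1)).bdd, ?_, ?_, ?_, ?_⟩
    · intro a a' f
      simp only [Function.comp_apply, map_add, (isTensorMap_regroup s' t' bs' bt' _).add_left]
    · intro r a f
      simp only [Function.comp_apply, map_smul, (isTensorMap_regroup s' t' bs' bt' _).smul_left]
    · intro a f i b b'
      simp only [Function.comp_apply, Function.apply_update (fun _ => β), map_add,
        (isTensorMap_regroup s' t' bs' bt' _).add_right]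
    · intro a f i r b
      simp only [Function.comp_apply, Function.apply_update (fun _ => β), map_smul,
        (isTensorMap_regroup s' t' bs' bt' _).smul_right]
  rw [faceMap, tensorMap_tensorMap _ _ _ _ _ hχ rfl, faceMap,
    tensorMap_tensorMap _ _ _ _ _ hχ key.symm]

lemma isTensorMap_mul [BddMul A] (a₀ : A) (k : ℕ) :
    IsTensorMap (fun x : A × (Fin k → B) => (a₀ * x.1, x.2)) where
  bdd := ((BddMap.const a₀).mul bddMap_fst).prodMk fun _ hS => hS.image_snd
  add_left a a' f := by simp only [mul_add, pureTensor_add_left]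
  smul_left r a f := by simp only [mul_smul_comm, pureTensor_smul_left]
  add_right a f i b b' := by simp only [pureTensor_add_right]
  smul_right a f i r b := by simp only [pureTensor_smul_right]

end TensorFunctoriality

section SmoothAlgebras

variable {E : Type*} [NormedAddCommGroup E] [NormedSpace ℝ E] {H : Type*} [TopologicalSpace H]
  {I : ModelWithCorners ℝ E H} {N : Type u} [TopologicalSpace N] [ChartedSpace H N]
  [I.Boundaryless] [IsManifold I ∞ N]

/-- The (von Neumann) bornology of the Fréchet algebra of smooth functions: a set is bounded if all
derivatives are uniformly bounded on compact sets. -/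
instance smoothBornology : Bornology C^∞⟮I, N; 𝓘(ℝ), ℝ⟯ :=
  Bornology.ofBounded
    {S | LocallyBddDeriv I ((fun (f : C^∞⟮I, N; 𝓘(ℝ), ℝ⟯) (x : N) => f x) '' S)}
    (fun _ _ => ⟨0, by simp⟩)
    (fun _ hS _ hT => hS.mono (image_mono hT))
    (fun _ hS _ hT => by rw [Set.mem_ofPred_eq, image_union]; exact hS.union hT)
    (fun f => by
      rw [Set.mem_ofPred_eq, image_singleton]
      exact locallyBddDeriv_singleton f.contMDiff)

lemma isBounded_smooth_iff {S : Set C^∞⟮I, N; 𝓘(ℝ), ℝ⟯} : Bornology.IsBounded S ↔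
    LocallyBddDeriv I ((fun (f : C^∞⟮I, N; 𝓘(ℝ), ℝ⟯) (x : N) => f x) '' S) :=
  Bornology.isBounded_ofBounded_iff _

instance : BddMul C^∞⟮I, N; 𝓘(ℝ), ℝ⟯ where
  bdd S hS := by
    have h1 := isBounded_smooth_iff.1 hS.image_fst
    have h2 := isBounded_smooth_iff.1 hS.image_snd
    refine isBounded_smooth_iff.2 ((h1.mul h2 ?_ ?_).mono ?_)
    · rintro _ ⟨f, -, rfl⟩; exact f.contMDiff
    · rintro _ ⟨f, -, rfl⟩; exact f.contMDiff
    · rintro _ ⟨_, ⟨p, hp, rfl⟩, rfl⟩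
      exact ⟨_, mem_image_of_mem _ (mem_image_of_mem _ hp), _,
        mem_image_of_mem _ (mem_image_of_mem _ hp), rfl⟩

variable {E' : Type*} [NormedAddCommGroup E'] [NormedSpace ℝ E'] {H' : Type*} [TopologicalSpace H']
  {I' : ModelWithCorners ℝ E' H'} {N' : Type u} [TopologicalSpace N'] [ChartedSpace H' N']
  [I'.Boundaryless] [IsManifold I' ∞ N']

/-- Pull-back of smooth functions along a smooth map. -/
def pull (φ : C^∞⟮I, N; I', N'⟯) : C^∞⟮I', N'; 𝓘(ℝ), ℝ⟯ →ₐ[ℝ] C^∞⟮I, N; 𝓘(ℝ), ℝ⟯ where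
  toFun f := f.comp φ
  map_one' := rfl
  map_mul' _ _ := rfl
  map_zero' := rfl
  map_add' _ _ := rfl
  commutes' _ := rfl

@[simp] lemma pull_apply (φ : C^∞⟮I, N; I', N'⟯) (f : C^∞⟮I', N'; 𝓘(ℝ), ℝ⟯) (x : N) :
    pull φ f x = f (φ x) := rfl

lemma bddMap_pull (φ : C^∞⟮I, N; I', N'⟯) : BddMap (pull φ) := fun S hS => by
  refine isBounded_smooth_iff.2 (((isBounded_smooth_iff.1 hS).comp ?_ φ.contMDiff).mono ?_)
  · rintro _ ⟨f, -, rfl⟩; exact f.contMDiff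
  · rintro _ ⟨_, ⟨f, hf, rfl⟩, rfl⟩
    exact ⟨_, mem_image_of_mem _ hf, rfl⟩

/-- The inclusion of open subsets as a smooth map. -/
def inclMap {U V : Opens N} (h : U ≤ V) : C^∞⟮I, U; I, V⟯ := ⟨Opens.inclusion h, contMDiff_inclusion h⟩

end SmoothAlgebras

section Action

variable (n m : ℕ) (G M : Type) [TopologicalSpace G] [ChartedSpace (EuclideanSpace ℝ (Fin n)) G]
  [Group G] [LieGroup (𝓡 n) ∞ G] [TopologicalSpace M] [ChartedSpace (EuclideanSpace ℝ (Fin m)) M]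
  [IsManifold (𝓡 m) ∞ M] [MulAction G M] [ContMDiffSMul (𝓡 n) (𝓡 m) ∞ G M]

/-- The orbit space `M / G` with the quotient topology. -/
abbrev orbitSpace : TopCat.{0} := TopCat.of (MulAction.orbitRel.Quotient G M)

/-- The canonical projection `M → M / G`. -/
def orbitProj : C(M, orbitSpace G M) :=
  ⟨fun p => (Quotient.mk _ p : MulAction.orbitRel.Quotient G M), continuous_quotient_mk'⟩

variable {G M}

lemma orbitProj_smul (g : G) (p : M) : orbitProj G M (g • p) = orbitProj G M p :=
  Quotient.sound ⟨g, rfl⟩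

/-- The `G`-invariant open subset `V ⊆ M` with `V / G = U`. -/
def baseOpens (U : Opens (orbitSpace G M)) : Opens M := U.comap (orbitProj G M)

/-- The open set `G × V ⊆ G × M` of arrows over `U = V / G`. -/
def arrowOpens (U : Opens (orbitSpace G M)) : Opens (G × M) :=
  U.comap ((orbitProj G M).comp ⟨Prod.snd, continuous_snd⟩)

lemma mem_baseOpens {U : Opens (orbitSpace G M)} {p : M} :
    p ∈ baseOpens U ↔ orbitProj G M p ∈ U := Iff.rfl

lemma mem_arrowOpens {U : Opens (orbitSpace G M)} {x : G × M} :
    x ∈ arrowOpens U ↔ orbitProj G M x.2 ∈ U := Iff.rfl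

lemma baseOpens_mono {U V : Opens (orbitSpace G M)} (h : U ≤ V) : baseOpens U ≤ baseOpens V :=
  fun _ hp => h hp

lemma arrowOpens_mono {U V : Opens (orbitSpace G M)} (h : U ≤ V) : arrowOpens U ≤ arrowOpens V :=
  fun _ hp => h hp

/-- The algebra `C^∞(V)`, for `V / G = U`. -/
abbrev BaseAlg (U : Opens (orbitSpace G M)) : Type := C^∞⟮𝓡 m, baseOpens U; 𝓘(ℝ), ℝ⟯

/-- The sections over `U = V / G` of the convolution sheaf: since `G` is compact, the smooth
functions on `G × V` with longitudinally compact support are all smooth functions on `G × V`.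
(Only the `C^∞(V)`-bimodule structure is used below; the pointwise product of this type serves to
write it down.) -/
abbrev ConvAlg (U : Opens (orbitSpace G M)) : Type :=
  C^∞⟮(𝓡 n).prod (𝓡 m), arrowOpens U; 𝓘(ℝ), ℝ⟯

/-- The source map `G × V → V`, `(g, v) ↦ v`. -/
def srcMap (U : Opens (orbitSpace G M)) :
    C^∞⟮(𝓡 n).prod (𝓡 m), arrowOpens U; 𝓡 m, baseOpens U⟯ :=
  ⟨fun x => ⟨x.1.2, x.2⟩, (ContMDiff.subtypeVal_comp_iff _ _).1
    (contMDiff_snd.comp contMDiff_subtype_val)⟩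

/-- The target map `G × V → V`, `(g, v) ↦ g v`. -/
def tgtMap (U : Opens (orbitSpace G M)) :
    C^∞⟮(𝓡 n).prod (𝓡 m), arrowOpens U; 𝓡 m, baseOpens U⟯ :=
  ⟨fun x => ⟨x.1.1 • x.1.2, by
      rw [mem_baseOpens, orbitProj_smul]; exact x.2⟩, (ContMDiff.subtypeVal_comp_iff _ _).1
    ((ContMDiffSMul.contMDiff_smul (I := 𝓡 n) (I' := 𝓡 m) (n := ∞)).comp contMDiff_subtype_val)⟩

/-- The `k`-chains over `U = V / G`: `A(V / G) ⊗̂ C^∞(V) ⊗̂ ⋯ ⊗̂ C^∞(V)`. -/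
abbrev Chains (k : ℕ) (U : Opens (orbitSpace G M)) : Type :=
  CompletedTensor (ConvAlg n m U) (BaseAlg m U) k

/-- The Hochschild boundary of `C^∞(V)` with values in the twisted bimodule `A(V / G)`, on which
`C^∞(V)` acts by `(f · a · f')(g, v) = f(g v) a(g, v) f'(v)`. -/
def chainBoundary (k : ℕ) (U : Opens (orbitSpace G M)) : Chains n m (k + 1) U →ₗ[ℝ] Chains n m k U :=
  hochschildB (pull (srcMap n m U)) (pull (tgtMap n m U)) (bddMap_pull _) (bddMap_pull _) k

/-- Restriction of chains. -/
def chainRes (k : ℕ) {U V : Opens (orbitSpace G M)} (h : U ≤ V) : Chains n m k V →ₗ[ℝ] Chains n m k U :=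
  tensorMap _ (isTensorMap_map (pull (inclMap (I := (𝓡 n).prod (𝓡 m)) (arrowOpens_mono h)))
    (pull (inclMap (I := 𝓡 m) (baseOpens_mono h))) (bddMap_pull _) (bddMap_pull _) k)

lemma chainRes_self (k : ℕ) (U : Opens (orbitSpace G M)) (h : U ≤ U) (c : Chains n m k U) :
    chainRes n m k h c = c :=
  tensorMap_map_id _ _ (bddMap_pull _) (bddMap_pull _) (fun _ => rfl) (fun _ => rfl) k c

lemma chainRes_chainRes (k : ℕ) {U V W : Opens (orbitSpace G M)} (h : U ≤ V) (h' : V ≤ W)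
    (c : Chains n m k W) :
    chainRes n m k h (chainRes n m k h' c) = chainRes n m k (h.trans h') c :=
  tensorMap_map_map _ _ (bddMap_pull _) (bddMap_pull _) _ _ (bddMap_pull _) (bddMap_pull _) _ _
    (bddMap_pull _) (bddMap_pull _) (fun _ => rfl) (fun _ => rfl) k c

lemma chainBoundary_chainRes (k : ℕ) {U V : Opens (orbitSpace G M)} (h : U ≤ V)
    (c : Chains n m (k + 1) V) :
    chainBoundary n m k U (chainRes n m (k + 1) h c) =
      chainRes n m k h (chainBoundary n m k V c) :=
  hochschildB_map (pull (inclMap (I := (𝓡 n).prod (𝓡 m)) (arrowOpens_mono h)))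
    (pull (inclMap (I := 𝓡 m) (baseOpens_mono h))) (bddMap_pull _) (bddMap_pull _)
    (s := pull (srcMap n m V)) (t := pull (tgtMap n m V))
    (s' := pull (srcMap n m U)) (t' := pull (tgtMap n m U))
    (fun _ => rfl) (fun _ => rfl) (bddMap_pull _) (bddMap_pull _) (bddMap_pull _)
    (bddMap_pull _) k c

variable (G M)

/-- The presheaf of `k`-chains on the orbit space. -/
def chainPresheaf (k : ℕ) : (Opens (orbitSpace G M))ᵒᵖ ⥤ ModuleCat.{0} ℝ where
  obj U := ModuleCat.of ℝ (Chains n m k U.unop)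
  map h := ModuleCat.ofHom (chainRes n m k h.unop.le)
  map_id U := by
    refine ModuleCat.hom_ext (LinearMap.ext fun c => ?_)
    exact chainRes_self n m k _ le_rfl c
  map_comp f g := by
    refine ModuleCat.hom_ext (LinearMap.ext fun c => ?_)
    exact (chainRes_chainRes n m k g.unop.le f.unop.le c).symm

/-- The Hochschild boundary as a morphism of presheaves. -/
def presheafBoundary (k : ℕ) : chainPresheaf n m G M (k + 1) ⟶ chainPresheaf n m G M k where
  app U := ModuleCat.ofHom (chainBoundary n m k U.unop)
  naturality U V h := by
    refine ModuleCat.hom_ext (LinearMap.ext fun c => ?_)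
    exact chainBoundary_chainRes n m k h.unop.le c

lemma presheafBoundary_comp (k : ℕ) :
    presheafBoundary n m G M (k + 1) ≫ presheafBoundary n m G M k = 0 := by
  refine NatTrans.ext (funext fun U => ModuleCat.hom_ext (LinearMap.ext fun c => ?_))
  exact LinearMap.congr_fun (hochschildB_comp _ _ _ _ k) c

/-- The Hochschild presheaf complex on the orbit space. -/
def chainPresheafComplex : ChainComplex ((Opens (orbitSpace G M))ᵒᵖ ⥤ ModuleCat.{0} ℝ) ℕ :=
  ChainComplex.of (chainPresheaf n m G M) (presheafBoundary n m G M) (presheafBoundary_comp n m G M)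

/-- The category of sheaves of real vector spaces. -/
abbrev RSheaf (T : TopCat.{0}) := Sheaf (Opens.grothendieckTopology T) (ModuleCat.{0} ℝ)

/-- The twisted Hochschild sheaf complex: the sheafification of the Hochschild presheaf complex. -/
def chainSheafComplex : ChainComplex (RSheaf (orbitSpace G M)) ℕ :=
  ((presheafToSheaf (Opens.grothendieckTopology (orbitSpace G M))
    (ModuleCat.{0} ℝ)).mapHomologicalComplex _).obj (chainPresheafComplex n m G M)

variable {G M}

/-- The section of the Hochschild sheaf complex defined by a chain. -/
def chainSection (k : ℕ) (U : Opens (orbitSpace G M)) (c : Chains n m k U) :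
    ((chainSheafComplex n m G M).X k).obj.obj (op U) :=
  (toSheafify (Opens.grothendieckTopology (orbitSpace G M)) (chainPresheaf n m G M k)).app (op U) c

end Action

section Forms

/-- The exterior product of a covector with an alternating form. -/
def covectorWedge {V : Type*} [AddCommGroup V] [Module ℝ V] {k : ℕ} (θ : V →ₗ[ℝ] ℝ)
    (η : V [⋀^Fin k]→ₗ[ℝ] ℝ) : V [⋀^Fin (k + 1)]→ₗ[ℝ] ℝ :=
  AlternatingMap.alternatizeUncurryFin (θ.smulRight η)

/-- The exterior product `θ₀ ∧ ⋯ ∧ θₖ₋₁` of covectors: `(v₀, …, vₖ₋₁) ↦ det (θⱼ vᵢ)`. -/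
def wedgeCovectors {V : Type*} [AddCommGroup V] [Module ℝ V] {k : ℕ} (θ : Fin k → V →ₗ[ℝ] ℝ) :
    V [⋀^Fin k]→ₗ[ℝ] ℝ :=
  Matrix.detRowAlternating.compLinearMap (LinearMap.pi θ)

lemma wedgeCovectors_apply {V : Type*} [AddCommGroup V] [Module ℝ V] {k : ℕ}
    (θ : Fin k → V →ₗ[ℝ] ℝ) (v : Fin k → V) :
    wedgeCovectors θ v = (Matrix.of fun i j => θ j (v i)).det := rfl

variable (n m : ℕ) {G M : Type} [TopologicalSpace G] [ChartedSpace (EuclideanSpace ℝ (Fin n)) G]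
  [TopologicalSpace M] [ChartedSpace (EuclideanSpace ℝ (Fin m)) M] [IsManifold (𝓡 m) ∞ M]

/-- Families of alternating forms on the tangent spaces of `M`, parametrised by `W ⊆ G × M`. -/
def FormFamily (W : Opens (G × M)) (k : ℕ) : Type :=
  ∀ x : W, TangentSpace (𝓡 m) x.1.2 [⋀^Fin k]→ₗ[ℝ] ℝ

instance (W : Opens (G × M)) (k : ℕ) : AddCommGroup (FormFamily m W k) :=
  Pi.addCommGroup (f := fun x : W => TangentSpace (𝓡 m) x.1.2 [⋀^Fin k]→ₗ[ℝ] ℝ)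

instance (W : Opens (G × M)) (k : ℕ) : Module ℝ (FormFamily m W k) :=
  Pi.module _ (fun x : W => TangentSpace (𝓡 m) x.1.2 [⋀^Fin k]→ₗ[ℝ] ℝ) ℝ

variable {m} in
/-- The coefficient of a family of forms with respect to constant vectors `v` in the
trivialization of `TM` centred at `x₀`. -/
def formCoeff {W : Opens (G × M)} {k : ℕ} (τ : FormFamily m W k) (x₀ : W)
    (v : Fin k → EuclideanSpace ℝ (Fin m)) (x : W) : ℝ :=
  τ x fun i => (trivializationAt (EuclideanSpace ℝ (Fin m)) (TangentSpace (𝓡 m) : M → Type _)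
    x₀.1.2).symm x.1.2 (v i)

/-- Relative `k`-forms on an open subset `W` of `G × M`, i.e. smooth sections over `W` of the bundle
of alternating `k`-forms on the fibres of the pull-back of `TM` along the projection `G × M → M`. -/
def RelForm (W : Opens (G × M)) (k : ℕ) : Submodule ℝ (FormFamily m W k) where
  carrier := {τ | ∀ x₀ v, ContMDiffAt ((𝓡 n).prod (𝓡 m)) 𝓘(ℝ) ∞ (formCoeff τ x₀ v) x₀}
  zero_mem' _ _ := contMDiffAt_const (c := (0 : ℝ))
  add_mem' h h' x₀ v := (h x₀ v).add (h' x₀ v)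
  smul_mem' _ _ h x₀ v := contMDiffAt_const.mul (h x₀ v)

/-- A set of relative forms is bounded if all derivatives of the coefficients are locally uniformly
bounded. -/
def IsBddForms {W : Opens (G × M)} {k : ℕ} (S : Set (RelForm n m W k)) : Prop :=
  ∀ (x₀ : W) (v : Fin k → EuclideanSpace ℝ (Fin m)) (r : ℕ), ∃ C : ℝ,
    ∀ᶠ y in 𝓝 (extChartAt ((𝓡 n).prod (𝓡 m)) x₀ x₀), ∀ τ ∈ S,
      ‖iteratedFDeriv ℝ r
        (formCoeff τ.1 x₀ v ∘ (extChartAt ((𝓡 n).prod (𝓡 m)) x₀).symm) y‖ ≤ C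

/-- Smooth functions on an open subset of `G × M`. -/
abbrev SmoothFun (W : Opens (G × M)) : Type := C^∞⟮(𝓡 n).prod (𝓡 m), W; 𝓘(ℝ), ℝ⟯

variable {n} in
/-- The relative differential of a function at `x = (g, p)`: the differential at `p` of
`q ↦ f (g, q)`. -/
def dRel {W : Opens (G × M)} (f : SmoothFun n m W) (x : W) : TangentSpace (𝓡 m) x.1.2 →ₗ[ℝ] ℝ :=
  (mfderiv (𝓡 m) 𝓘(ℝ) (fun q : M => Function.extend Subtype.val f 0 (x.1.1, q)) x.1.2 :
    TangentSpace (𝓡 m) x.1.2 →L[ℝ] ℝ).toLinearMap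

/-- Restriction of smooth functions. -/
def funRes {W W' : Opens (G × M)} (h : W ≤ W') (f : SmoothFun n m W') : SmoothFun n m W :=
  f.comp (inclMap h)

lemma dRel_funRes {W W' : Opens (G × M)} (h : W ≤ W') (f : SmoothFun n m W') (x : W) :
    dRel m (funRes n m h f) x = dRel m f ⟨x.1, h x.2⟩ := by
  have key : (fun q : M => Function.extend Subtype.val (funRes n m h f) 0 (x.1.1, q)) =ᶠ[𝓝 x.1.2]
      fun q : M => Function.extend Subtype.val f 0 (x.1.1, q) := by
    have hc : ContinuousAt (fun q : M => (x.1.1, q)) x.1.2 := by fun_prop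
    filter_upwards [hc (W.isOpen.mem_nhds x.2)] with q hq
    have e1 := Subtype.val_injective.extend_apply (funRes n m h f) 0 ⟨(x.1.1, q), hq⟩
    have e2 := Subtype.val_injective.extend_apply f 0 ⟨(x.1.1, q), h hq⟩
    exact e1.trans e2.symm
  exact congrArg (fun L : EuclideanSpace ℝ (Fin m) →L[ℝ] ℝ => L.toLinearMap) key.mfderiv_eq

/-- Restriction of relative forms. -/
def formRes (k : ℕ) {W W' : Opens (G × M)} (h : W ≤ W') : RelForm n m W' k →ₗ[ℝ] RelForm n m W k where
  toFun τ := ⟨fun x => τ.1 ⟨x.1, h x.2⟩, fun x₀ v =>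
    (τ.2 ⟨x₀.1, h x₀.2⟩ v).comp x₀ (contMDiff_inclusion h x₀)⟩
  map_add' _ _ := rfl
  map_smul' _ _ := rfl

variable [Group G] [MulAction G M]

variable (G M) in
/-- The loop space `{(g, p) | g p = p}`. -/
abbrev loopSpace : TopCat.{0} := TopCat.of {x : G × M // x.1 • x.2 = x.2}

variable (G M) in
/-- The inclusion of the loop space into `G × M`. -/
def loopIncl : loopSpace G M ⟶ TopCat.of (G × M) :=
  TopCat.ofHom ⟨Subtype.val, continuous_subtype_val⟩

/-- The vanishing ideal of the loop space. -/
def vanishingIdeal (W : Opens (G × M)) : Set (SmoothFun n m W) :=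
  {f | ∀ x : W, x.1.1 • x.1.2 = x.1.2 → f x = 0}

/-- The relative `k`-forms `f τ` with `f` in the vanishing ideal. -/
def idealMultiples (W : Opens (G × M)) (k : ℕ) : Set (RelForm n m W k) :=
  {η | ∃ f ∈ vanishingIdeal n m W, ∃ τ : RelForm n m W k, ∀ x, η.1 x = f x • τ.1 x}

/-- The relative `k`-forms `d_rel f ∧ τ` with `f` in the vanishing ideal. -/
def idealDifferentials (W : Opens (G × M)) : (k : ℕ) → Set (RelForm n m W k)
  | 0 => ∅
  | k + 1 => {η | ∃ f ∈ vanishingIdeal n m W, ∃ τ : RelForm n m W k,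
      ∀ x, η.1 x = covectorWedge (dRel m f x) (τ.1 x)}

/-- The subspace `J Ω^k + d_rel J ∧ Ω^(k-1)` of the relative `k`-forms on `W`. -/
def relIdeal (W : Opens (G × M)) (k : ℕ) : Submodule ℝ (RelForm n m W k) :=
  Submodule.span ℝ (idealMultiples n m W k ∪ idealDifferentials n m W k)

lemma formRes_mem_relIdeal (k : ℕ) {W W' : Opens (G × M)} (h : W ≤ W') :
    relIdeal n m W' k ≤ (relIdeal n m W k).comap (formRes n m k h) := by
  refine Submodule.span_le.2 ?_
  rintro η (⟨f, hf, τ, hη⟩ | hη)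
  · exact Submodule.subset_span (Or.inl ⟨funRes n m h f, fun x hx => hf ⟨x.1, h x.2⟩ hx,
      formRes n m k h τ, fun x => hη ⟨x.1, h x.2⟩⟩)
  · refine Submodule.subset_span (Or.inr ?_)
    cases k with
    | zero => exact hη.elim
    | succ k =>
      obtain ⟨f, hf, τ, hη⟩ := hη
      refine ⟨funRes n m h f, fun x hx => hf ⟨x.1, h x.2⟩ hx, formRes n m k h τ, fun x => ?_⟩
      rw [dRel_funRes]
      exact hη ⟨x.1, h x.2⟩

/-- The quotient `Ω^k / (J Ω^k + d_rel J ∧ Ω^(k-1))` over `W`. -/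
abbrev RelQuotient (W : Opens (G × M)) (k : ℕ) : Type := RelForm n m W k ⧸ relIdeal n m W k

/-- Restriction in the quotient. -/
def quotRes (k : ℕ) {W W' : Opens (G × M)} (h : W ≤ W') :
    RelQuotient n m W' k →ₗ[ℝ] RelQuotient n m W k :=
  Submodule.mapQ _ _ (formRes n m k h) (formRes_mem_relIdeal n m k h)

variable (G M)

/-- The presheaf `Ω^k / (J Ω^k + d_rel J ∧ Ω^(k-1))` on `G × M`. -/
def relPresheaf (k : ℕ) : (Opens (TopCat.of (G × M)))ᵒᵖ ⥤ ModuleCat.{0} ℝ where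
  obj W := ModuleCat.of ℝ (RelQuotient n m (G := G) (M := M) W.unop k)
  map h := ModuleCat.ofHom (quotRes n m (G := G) (M := M) k h.unop.le)
  map_id W := by
    refine ModuleCat.hom_ext (LinearMap.ext fun c => ?_)
    obtain ⟨τ, rfl⟩ := Submodule.Quotient.mk_surjective _ c
    rfl
  map_comp f g := by
    refine ModuleCat.hom_ext (LinearMap.ext fun c => ?_)
    obtain ⟨τ, rfl⟩ := Submodule.Quotient.mk_surjective _ c
    rfl

/-- The quotient sheaf on `G × M`. -/
def quotientSheaf (k : ℕ) : RSheaf (TopCat.of (G × M)) :=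
  (presheafToSheaf (Opens.grothendieckTopology (TopCat.of (G × M)))
    (ModuleCat.{0} ℝ)).obj (relPresheaf n m G M k)

/-- The sheaf of relative `k`-forms on the loop space: the inverse image of the quotient sheaf. -/
def loopForms (k : ℕ) : RSheaf (loopSpace G M) :=
  (TopCat.Sheaf.pullback (ModuleCat.{0} ℝ) (loopIncl G M)).obj (quotientSheaf n m G M k)

variable {G M}

/-- The class on `W ∩ Λ₀` of a relative form on `W`. -/
def formClass (k : ℕ) (W : Opens (G × M)) (τ : RelForm n m W k) :
    (loopForms n m G M k).obj.obj (op ((Opens.map (loopIncl G M)).obj W)) :=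
  ((TopCat.Sheaf.pullbackPushforwardAdjunction (ModuleCat.{0} ℝ) (loopIncl G M)).unit.app
      (quotientSheaf n m G M k)).hom.app (op W)
    ((toSheafify (Opens.grothendieckTopology (TopCat.of (G × M))) (relPresheaf n m G M k)).app (op W)
      (Submodule.Quotient.mk τ))

/-- The tangent space at `p` of the orbit through `p`. -/
def orbitTangent (p : M) : Set (TangentSpace (𝓡 m) p) :=
  Set.range (mfderiv (𝓡 n) (𝓡 m) (fun g : G => g • p) (1 : G))

/-- A section over `Y ⊆ Λ₀` is a horizontal relative form if it is the class of a relative form `τ`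
on some open `W ⊆ G × M` with `W ∩ Λ₀ = Y` such that `τ` at `(g, p)` is an alternating form on the
normal space `T_p M / T_p O_p`, for all `(g, p) ∈ Y`. -/
def IsHorizontal (k : ℕ) {Y : Opens (loopSpace G M)} (σ : (loopForms n m G M k).obj.obj (op Y)) :
    Prop :=
  ∃ (W : Opens (G × M)) (hW : (Opens.map (loopIncl G M)).obj W = Y) (τ : RelForm n m W k),
    (loopForms n m G M k).obj.map (homOfLE hW.ge).op (formClass n m k W τ) = σ ∧
    ∀ x : W, x.1.1 • x.1.2 = x.1.2 → ∀ v : Fin k → TangentSpace (𝓡 m) x.1.2,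
      (∃ i, v i ∈ orbitTangent n m (G := G) x.1.2) → τ.1 x v = 0

end Forms

section Comparison

variable (n m : ℕ) (G M : Type) [TopologicalSpace G] [ChartedSpace (EuclideanSpace ℝ (Fin n)) G]
  [Group G] [LieGroup (𝓡 n) ∞ G] [TopologicalSpace M] [ChartedSpace (EuclideanSpace ℝ (Fin m)) M]
  [IsManifold (𝓡 m) ∞ M] [MulAction G M] [ContMDiffSMul (𝓡 n) (𝓡 m) ∞ G M]

/-- The composition `Λ₀ → M → M / G` of the source map with the canonical projection. -/
def loopProj : loopSpace G M ⟶ orbitSpace G M :=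
  TopCat.ofHom ((orbitProj G M).comp ⟨fun x => x.1.2, by fun_prop⟩)

/-- The push-forward of the sheaf of relative `k`-forms to the orbit space. -/
def pushedForms (k : ℕ) : RSheaf (orbitSpace G M) :=
  (TopCat.Sheaf.pushforward (ModuleCat.{0} ℝ) (loopProj G M)).obj (loopForms n m G M k)

/-- The sheaf complex of relative forms, pushed forward to the orbit space, with zero
differential. -/
def formComplex : ChainComplex (RSheaf (orbitSpace G M)) ℕ where
  X k := pushedForms n m G M k
  d _ _ := 0

variable {G M}

/-- The section over `U = V / G` of the push-forward defined by a relative form on `G × V`. -/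
def pushedClass (k : ℕ) (U : Opens (orbitSpace G M)) (τ : RelForm n m (arrowOpens U) k) :
    ((formComplex n m G M).X k).obj.obj (op U) :=
  formClass n m k (arrowOpens U) τ

/-- Sections of the push-forward which are horizontal as sections over `Λ₀ ∩ (G × V)`. -/
def IsHorizontalSection (k : ℕ) (U : Opens (orbitSpace G M))
    (σ : ((formComplex n m G M).X k).obj.obj (op U)) : Prop :=
  IsHorizontal n m k (Y := (Opens.map (loopProj G M)).obj U) σ

/-- The bounded linear extension of `f₀ ⊗ f₁ ⊗ ⋯ ⊗ fₖ ↦ f₀ d(s^* f₁) ∧ ⋯ ∧ d(s^* fₖ)`. -/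
structure IsFormMap (k : ℕ) (U : Opens (orbitSpace G M))
    (Ψ : Chains n m k U →ₗ[ℝ] RelForm n m (arrowOpens U) k) : Prop where
  bounded : ∀ S : Set (Chains n m k U), IsBddTensor S → IsBddForms n m (Ψ '' S)
  pure : ∀ (f₀ : ConvAlg n m U) (f : Fin k → BaseAlg m U) (x : arrowOpens U),
    (Ψ (pureTensor (f₀, f))).1 x =
      f₀ x • wedgeCovectors fun i => dRel m (pull (srcMap n m U) (f i)) x

/-- The smooth functions on the orbit space `U = V / G`: the `G`-invariant smooth functions
on `V`. -/
def InvariantFun (U : Opens (orbitSpace G M)) : Set (BaseAlg m U) :=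
  {φ | pull (srcMap n m U) φ = pull (tgtMap n m U) φ}

/-- The action of functions on chains: multiplication of the factor in `A(V / G)` with `s^* φ`
(which is `t^* φ` for invariant `φ`). -/
def chainSmul (k : ℕ) (U : Opens (orbitSpace G M)) (φ : BaseAlg m U) :
    Chains n m k U →ₗ[ℝ] Chains n m k U :=
  tensorMap _ (isTensorMap_mul (pull (srcMap n m U) φ) k)

end Comparison

end

end LoopForms

set_option linter.unusedSectionVars false

open Set Filter Topology CategoryTheory TopologicalSpace Opposite
open scoped Manifold ContDiff

namespace LoopForms

universe u

noncomputable section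

/-! ### Bounded functionals on the completed tensor product -/

section BoundedFunctionals

/-! Everything is read off from scalar functionals on chains. Bounded functionals on the factors
define a bounded product functional on the completed tensor product (`prodFunctional`): summation
against a function that is bounded on bounded sets has a bornologically closed kernel, so it
descends as soon as it kills the multilinear relations. Conversely, finite combinations of point
masses approximate every element in the ℓ¹-norm inside one bounded support, so a bounded functional
is determined by its values on pure tensors (`IsBddFunctional.ext`). Identities between forms of
chains are therefore checked pointwise, on pure tensors.

The form of a chain at x = (g, p) is the antisymmetrisation in v of the functional f₀(x) ∏ dfⱼ(vⱼ)
(`derivFunctional`). Its coefficients in a chart are ℓ¹-combinations of functions whose derivatives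
are uniformly bounded, which may be differentiated term by term (`contDiffOn_tsum_smul`); this gives
both smoothness and boundedness of Ψ. Uniqueness is the density of pure tensors.

For the chain map property let gp = p. Then s^*f and t^*f have the same value at x, so evaluation at
x respects both actions along the character f ↦ f(p), and each f ↦ df(vⱼ) is a derivation along that
character. The terms of the Hochschild boundary then telescope to zero
(`prodFunctional_hochschildB`). Thus Ψ(bc) vanishes at every point of the loop space, and in a
coordinate frame its coefficients lie in the vanishing ideal, so its class is zero
(`formClass_eq_zero_of_vanishing`).

For horizontality one factor is altered so that the telescoping leaves a known error. Using a second
derivative along vᵢ, vᵢ₊₁ in one slot leaves the symmetrised product of first derivatives; on a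
cycle this makes `derivFunctional` change sign when adjacent vectors are exchanged
(`derivFunctional_swap`). Replacing the evaluation of f₀ by the derivative along h ↦ (hg, p), which
kills s^*f and sends t^*f to df in an orbit direction, shows vanishing when the last vector is
tangent to the orbit (`derivFunctional_orbit_last`). Exchanges carry an orbit vector from any slot
to the last.

A section of the sheafification is only locally a chain, but the form at a point depends only on the
section near the orbit of that point (`formMap_eq_of_chainSection_eq`). The local forms therefore
glue to one honest form representing the image of the section. -/

/-- A real function is bounded on bounded sets. -/
def BddReal {X : Type u} [Bornology X] (φ : X → ℝ) : Prop :=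
  ∀ S : Set X, Bornology.IsBounded S → ∃ C : ℝ, ∀ x ∈ S, |φ x| ≤ C

lemma BddReal.mul {X : Type u} [Bornology X] {φ ψ : X → ℝ} (hφ : BddReal φ) (hψ : BddReal ψ) :
    BddReal fun x => φ x * ψ x := fun S hS => by
  obtain ⟨C, hC⟩ := hφ S hS
  obtain ⟨D, hD⟩ := hψ S hS
  refine ⟨C * D, fun x hx => ?_⟩
  rw [abs_mul]
  exact mul_le_mul (hC x hx) (hD x hx) (abs_nonneg _) ((abs_nonneg _).trans (hC x hx))

lemma BddReal.prod {X : Type u} [Bornology X] {ι : Type*} (I : Finset ι) {φ : ι → X → ℝ}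
    (h : ∀ i, BddReal (φ i)) : BddReal fun x => ∏ i ∈ I, φ i x := by
  classical
  induction I using Finset.induction_on with
  | empty => exact fun _ _ => ⟨1, by simp⟩
  | insert i I hi ih =>
    simp only [Finset.prod_insert hi]
    exact (h i).mul ih

lemma BddReal.comp {X Y : Type u} [Bornology X] [Bornology Y] {φ : Y → ℝ} (hφ : BddReal φ)
    {ψ : X → Y} (hψ : BddMap ψ) : BddReal fun x => φ (ψ x) := fun S hS => by
  obtain ⟨C, hC⟩ := hφ _ (hψ S hS)
  exact ⟨C, fun x hx => hC _ (mem_image_of_mem _ hx)⟩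

variable {X : Type u} [Bornology X]

lemma abs_mul_le_of_support {c φ : X → ℝ} {D : Set X} {C : ℝ} (hc : Function.support c ⊆ D)
    (hC : ∀ x ∈ D, |φ x| ≤ C) (x : X) : |c x * φ x| ≤ |c x| * C := by
  by_cases h : c x = 0
  · simp [h]
  · rw [abs_mul]
    exact mul_le_mul_of_nonneg_left (hC x (hc h)) (abs_nonneg _)

lemma summable_mul_of_bddReal {φ : X → ℝ} (hφ : BddReal φ) (c : BddL1 X) :
    Summable fun x => c.1 x * φ x := by
  obtain ⟨C, hC⟩ := hφ _ c.2.2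
  exact Summable.of_norm_bounded (c.2.1.abs.mul_right C)
    fun x => abs_mul_le_of_support Subset.rfl hC x

/-- The linear functional on `BddL1 X` extending a function which is bounded on bounded sets. -/
def sumAgainst (φ : X → ℝ) (hφ : BddReal φ) : BddL1 X →ₗ[ℝ] ℝ where
  toFun c := ∑' x, c.1 x * φ x
  map_add' a b := by
    simp only [Submodule.coe_add, Pi.add_apply, add_mul]
    exact (summable_mul_of_bddReal hφ a).tsum_add (summable_mul_of_bddReal hφ b)
  map_smul' r a := by
    simp only [Submodule.coe_smul, Pi.smul_apply, smul_eq_mul, RingHom.id_apply, mul_assoc,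
      tsum_mul_left]

lemma sumAgainst_apply (φ : X → ℝ) (hφ : BddReal φ) (c : BddL1 X) :
    sumAgainst φ hφ c = ∑' x, c.1 x * φ x := rfl

lemma sumAgainst_pointMass (φ : X → ℝ) (hφ : BddReal φ) (x : X) :
    sumAgainst φ hφ (pointMass x) = φ x := by
  classical
  rw [sumAgainst_apply, tsum_eq_single x]
  · simp [pointMass]
  · intro y hy
    simp [pointMass, hy]

lemma abs_sumAgainst_le {φ : X → ℝ} (hφ : BddReal φ) (c : BddL1 X) {D : Set X} {C : ℝ}
    (hc : Function.support c.1 ⊆ D) (hC : ∀ x ∈ D, |φ x| ≤ C) :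
    |sumAgainst φ hφ c| ≤ (∑' x, |c.1 x|) * C := by
  have h1 : Summable fun x => ‖c.1 x * φ x‖ := (summable_mul_of_bddReal hφ c).norm
  refine (norm_tsum_le_tsum_norm h1).trans ?_
  rw [← tsum_mul_right]
  exact h1.tsum_le_tsum (fun x => abs_mul_le_of_support hc hC x) (c.2.1.abs.mul_right C)

/-- On functions supported in one bounded set the functional is Lipschitz for the ℓ¹-norm, with the
bound of `φ` on that set as constant. This is what lets functionals descend to the completed tensor
product. -/
lemma isBornClosed_ker_sumAgainst (φ : X → ℝ) (hφ : BddReal φ) :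
    IsBornClosed (LinearMap.ker (sumAgainst φ hφ)) := by
  intro S hS v c hv hc ht
  obtain ⟨C, hC⟩ := hφ S hS
  have h1 : ∀ j, |sumAgainst φ hφ c| ≤ (∑' x, |(v j).1 x - c.1 x|) * C := fun j => by
    have h2 : sumAgainst φ hφ c = - sumAgainst φ hφ (v j - c) := by
      rw [map_sub, LinearMap.mem_ker.1 (hv j).1]; ring
    rw [h2, abs_neg]
    exact abs_sumAgainst_le hφ (v j - c)
      ((Function.support_sub _ _).trans (union_subset (hv j).2 hc)) hC
  have h3 : |sumAgainst φ hφ c| ≤ 0 := by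
    have h4 := ht.mul_const C
    rw [zero_mul] at h4
    exact ge_of_tendsto' h4 h1
  exact abs_eq_zero.1 (le_antisymm h3 (abs_nonneg _))

variable {A B : Type u} [AddCommGroup A] [Module ℝ A] [AddCommGroup B] [Module ℝ B]
  [Bornology A] [Bornology B] {k : ℕ}

lemma bddReal_prodFunctional {α : A →ₗ[ℝ] ℝ} {β : Fin k → B →ₗ[ℝ] ℝ} (hα : BddReal α)
    (hβ : ∀ j, BddReal (β j)) : BddReal fun x : A × (Fin k → B) => α x.1 * ∏ j, β j (x.2 j) :=
  (hα.comp bddMap_fst).mul (BddReal.prod _ fun j => (hβ j).comp (bddMap_snd_eval j))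

/-- The functional `a ⊗ f₀ ⊗ ⋯ ⊗ fₖ₋₁ ↦ α(a) β₀(f₀) ⋯ βₖ₋₁(fₖ₋₁)` on the completed tensor product
defined by bounded functionals on the factors. -/
def prodFunctional (α : A →ₗ[ℝ] ℝ) (β : Fin k → B →ₗ[ℝ] ℝ) (hα : BddReal α)
    (hβ : ∀ j, BddReal (β j)) : CompletedTensor A B k →ₗ[ℝ] ℝ :=
  Submodule.liftQ _ (sumAgainst _ (bddReal_prodFunctional hα hβ)) <| by
    -- The kernel is one of the closed subspaces whose infimum is the bornological closure, so only
    -- the multilinear relations remain to be checked.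
    refine sInf_le ⟨?_, isBornClosed_ker_sumAgainst _ _⟩
    have hm : ∀ f : Fin k → B, ∏ j, β j (f j) =
      (MultilinearMap.mkPiAlgebra ℝ (Fin k) ℝ).compLinearMap β f := fun f => by simp
    rintro r (⟨a, a', f, rfl⟩ | ⟨s, a, f, rfl⟩ | ⟨a, f, i, b, b', rfl⟩ | ⟨a, f, i, s, b, rfl⟩)
    · simp only [SetLike.mem_coe, LinearMap.mem_ker, map_sub, sumAgainst_pointMass, map_add]
      ring
    · simp only [SetLike.mem_coe, LinearMap.mem_ker, map_sub, map_smul, sumAgainst_pointMass,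
        smul_eq_mul]
      ring
    · simp only [SetLike.mem_coe, LinearMap.mem_ker, map_sub, sumAgainst_pointMass, hm,
        MultilinearMap.map_update_add]
      ring
    · simp only [SetLike.mem_coe, LinearMap.mem_ker, map_sub, map_smul, sumAgainst_pointMass, hm,
        MultilinearMap.map_update_smul, smul_eq_mul]
      ring

lemma prodFunctional_mk {α : A →ₗ[ℝ] ℝ} {β : Fin k → B →ₗ[ℝ] ℝ} (hα : BddReal α)
    (hβ : ∀ j, BddReal (β j)) (c : BddL1 (A × (Fin k → B))) :
    prodFunctional α β hα hβ (Submodule.Quotient.mk c) =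
      ∑' x, c.1 x * (α x.1 * ∏ j, β j (x.2 j)) := rfl

lemma prodFunctional_pureTensor {α : A →ₗ[ℝ] ℝ} {β : Fin k → B →ₗ[ℝ] ℝ} (hα : BddReal α)
    (hβ : ∀ j, BddReal (β j)) (x : A × (Fin k → B)) :
    prodFunctional α β hα hβ (pureTensor x) = α x.1 * ∏ j, β j (x.2 j) :=
  sumAgainst_pointMass _ (bddReal_prodFunctional hα hβ) x

/-- A linear functional on the completed tensor product is bounded if it is bounded on bounded
sets. -/
def IsBddFunctional (l : CompletedTensor A B k →ₗ[ℝ] ℝ) : Prop :=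
  ∀ S, IsBddTensor S → ∃ C : ℝ, ∀ s ∈ S, |l s| ≤ C

lemma isBddFunctional_prodFunctional {α : A →ₗ[ℝ] ℝ} {β : Fin k → B →ₗ[ℝ] ℝ} (hα : BddReal α)
    (hβ : ∀ j, BddReal (β j)) : IsBddFunctional (prodFunctional α β hα hβ) := by
  rintro S ⟨D, C, hD, hS⟩
  obtain ⟨K, hK⟩ := bddReal_prodFunctional hα hβ D hD
  refine ⟨C * |K|, fun s hs => ?_⟩
  obtain ⟨c, rfl, hc, hC⟩ := hS s hs
  exact (abs_sumAgainst_le (bddReal_prodFunctional hα hβ) c hc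
    fun x hx => (hK x hx).trans (le_abs_self K)).trans
      (mul_le_mul_of_nonneg_right hC (abs_nonneg _))

lemma IsBddFunctional.add {l l' : CompletedTensor A B k →ₗ[ℝ] ℝ} (h : IsBddFunctional l)
    (h' : IsBddFunctional l') : IsBddFunctional (l + l') := fun S hS => by
  obtain ⟨C, hC⟩ := h S hS
  obtain ⟨D, hD⟩ := h' S hS
  exact ⟨C + D, fun s hs => (abs_add_le _ _).trans (add_le_add (hC s hs) (hD s hs))⟩

lemma IsBddFunctional.smul {l : CompletedTensor A B k →ₗ[ℝ] ℝ} (h : IsBddFunctional l) (r : ℝ) :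
    IsBddFunctional (r • l) := fun S hS => by
  obtain ⟨C, hC⟩ := h S hS
  refine ⟨|r| * C, fun s hs => ?_⟩
  rw [LinearMap.smul_apply, smul_eq_mul, abs_mul]
  exact mul_le_mul_of_nonneg_left (hC s hs) (abs_nonneg _)

lemma IsBddFunctional.sub {l l' : CompletedTensor A B k →ₗ[ℝ] ℝ} (h : IsBddFunctional l)
    (h' : IsBddFunctional l') : IsBddFunctional (l - l') := by
  rw [sub_eq_add_neg, ← neg_one_smul ℝ l']
  exact h.add (h'.smul _)

lemma IsBddFunctional.sum {ι : Type*} (I : Finset ι) {l : ι → CompletedTensor A B k →ₗ[ℝ] ℝ}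
    (h : ∀ i, IsBddFunctional (l i)) : IsBddFunctional (∑ i ∈ I, l i) := by
  classical
  induction I using Finset.induction_on with
  | empty => exact fun _ _ => ⟨0, by simp⟩
  | insert i I hi ih =>
    rw [Finset.sum_insert hi]
    exact (h i).add ih

variable {A' B' : Type u} [AddCommGroup A'] [Module ℝ A'] [AddCommGroup B'] [Module ℝ B']
  [Bornology A'] [Bornology B'] {p : ℕ}

lemma IsBddTensor.image_tensorMap {S : Set (CompletedTensor A B k)} (hS : IsBddTensor S)
    {φ : A × (Fin k → B) → A' × (Fin p → B')} (hφ : IsTensorMap φ) :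
    IsBddTensor (tensorMap φ hφ '' S) := by
  obtain ⟨D, C, hD, hS⟩ := hS
  refine ⟨φ '' D, C, hφ.bdd D hD, ?_⟩
  rintro _ ⟨s, hs, rfl⟩
  obtain ⟨c, rfl, hc, hC⟩ := hS s hs
  exact ⟨push φ hφ.bdd c, rfl, support_push_subset _ _ _ hc, (tsum_abs_push_le _ _ _).trans hC⟩

lemma IsBddFunctional.comp_tensorMap {l : CompletedTensor A' B' p →ₗ[ℝ] ℝ} (h : IsBddFunctional l)
    {φ : A × (Fin k → B) → A' × (Fin p → B')} (hφ : IsTensorMap φ) :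
    IsBddFunctional (l ∘ₗ tensorMap φ hφ) := fun S hS => by
  obtain ⟨C, hC⟩ := h _ (hS.image_tensorMap hφ)
  exact ⟨C, fun s hs => hC _ (mem_image_of_mem _ hs)⟩

/-- The restriction of a summable function to a subset. -/
def restrictTo (c : BddL1 X) (s : Set X) : BddL1 X :=
  ⟨s.indicator c.1, c.2.1.indicator s, c.2.2.subset (by
    rw [Set.support_indicator]; exact inter_subset_right)⟩

lemma restrictTo_val (c : BddL1 X) (s : Set X) : (restrictTo c s).1 = s.indicator c.1 := rfl

lemma restrictTo_finset (c : BddL1 X) (s : Finset X) :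
    restrictTo c s = ∑ x ∈ s, c.1 x • pointMass x := by
  classical
  refine Subtype.ext (funext fun y => ?_)
  have h : (∑ x ∈ s, c.1 x • pointMass x : BddL1 X).1 y =
      ∑ x ∈ s, c.1 x * (Pi.single x 1 : X → ℝ) y := by
    rw [Submodule.coe_sum, Finset.sum_apply]; rfl
  rw [h]
  simp [restrictTo, Set.indicator, Pi.single_apply]

/-- A bounded functional which vanishes on pure tensors is zero. -/
lemma IsBddFunctional.eq_zero {l : CompletedTensor A B k →ₗ[ℝ] ℝ} (h : IsBddFunctional l)
    (h0 : ∀ x, l (pureTensor x) = 0) : l = 0 := by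
  classical
  refine LinearMap.ext fun t => ?_
  obtain ⟨c, rfl⟩ := Submodule.Quotient.mk_surjective _ t
  -- The ℓ¹ unit ball over the fixed support of `c` is a bounded set of tensors. Rescaling into it
  -- turns the bound `C` into an estimate by `C` times the ℓ¹-norm; norm zero is treated separately.
  obtain ⟨C, hC⟩ := h {s | ∃ c' : BddL1 (A × (Fin k → B)), Submodule.Quotient.mk c' = s ∧
      Function.support c'.1 ⊆ Function.support c.1 ∧ ∑' x, |c'.1 x| ≤ 1}
    ⟨Function.support c.1, 1, c.2.2, fun s hs => hs⟩
  have hbound : ∀ c' : BddL1 (A × (Fin k → B)), Function.support c'.1 ⊆ Function.support c.1 →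
      |l (Submodule.Quotient.mk c')| ≤ (∑' x, |c'.1 x|) * C := by
    intro c' hc'
    set N := ∑' x, |c'.1 x| with hN
    have hN0 : 0 ≤ N := tsum_nonneg fun x => abs_nonneg (c'.1 x)
    rcases hN0.eq_or_lt with h1 | h1
    · have h2 : c' = 0 := by
        refine Subtype.ext (funext fun x => ?_)
        have h3 := c'.2.1.abs.le_tsum x fun _ _ => abs_nonneg _
        rw [← hN, ← h1] at h3
        exact abs_eq_zero.1 (le_antisymm h3 (abs_nonneg _))
      rw [← h1, h2]
      simp
    · have h2 := hC (Submodule.Quotient.mk (N⁻¹ • c')) ⟨_, rfl,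
        (Function.support_const_smul_subset _ _).trans hc', by
          simp only [Submodule.coe_smul, Pi.smul_apply, smul_eq_mul, abs_mul, tsum_mul_left, ← hN]
          rw [abs_of_pos (inv_pos.2 h1), inv_mul_cancel₀ h1.ne']⟩
      rw [Submodule.Quotient.mk_smul, map_smul, smul_eq_mul, abs_mul, abs_of_pos (inv_pos.2 h1),
        inv_mul_le_iff₀ h1] at h2
      exact h2
  -- The part of `c` on a finite set is a combination of point masses and is killed by `l`, so only
  -- the tail contributes, and its ℓ¹-norm tends to zero.
  have hfin : ∀ s : Finset (A × (Fin k → B)),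
      |l (Submodule.Quotient.mk c)| ≤ (∑' x, |c.1 x| - ∑ x ∈ s, |c.1 x|) * C := by
    intro s
    have h1 : l (Submodule.Quotient.mk c) =
        l (Submodule.Quotient.mk (restrictTo c (s : Set _)ᶜ)) := by
      have h2 : c = restrictTo c (s : Set _) + restrictTo c (s : Set _)ᶜ :=
        Subtype.ext (Set.indicator_self_add_compl _ _).symm
      conv_lhs => rw [h2, restrictTo_finset]
      rw [Submodule.Quotient.mk_add, map_add, ← Submodule.mkQ_apply, map_sum, map_sum,
        Finset.sum_eq_zero, zero_add]
      intro x _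
      rw [map_smul, map_smul]
      exact (congrArg _ (h0 x)).trans (smul_zero _)
    rw [h1]
    refine (hbound _ (by rw [restrictTo_val, Set.support_indicator]
                         exact inter_subset_right)).trans (le_of_eq ?_)
    congr 1
    rw [eq_sub_iff_add_eq, ← c.2.1.abs.sum_add_tsum_compl (s := s), add_comm]
    congr 1
    rw [tsum_subtype (↑s)ᶜ (fun x => |c.1 x|)]
    refine tsum_congr fun x => ?_
    by_cases hx : x ∈ (s : Set (A × (Fin k → B)))ᶜ
    · rw [restrictTo_val, indicator_of_mem hx, indicator_of_mem hx]
    · rw [restrictTo_val, indicator_of_notMem hx, indicator_of_notMem hx, abs_zero]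
  have hlim : Tendsto (fun s : Finset (A × (Fin k → B)) =>
      (∑' x, |c.1 x| - ∑ x ∈ s, |c.1 x|) * C) atTop (𝓝 0) := by
    have := (tendsto_const_nhds (x := ∑' x, |c.1 x|)).sub c.2.1.abs.hasSum
    simpa using this.mul_const C
  exact abs_eq_zero.1 (le_antisymm (ge_of_tendsto' hlim hfin) (abs_nonneg _))

lemma IsBddFunctional.ext {l l' : CompletedTensor A B k →ₗ[ℝ] ℝ} (h : IsBddFunctional l)
    (h' : IsBddFunctional l') (h0 : ∀ x, l (pureTensor x) = l' (pureTensor x)) : l = l' :=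
  sub_eq_zero.1 ((h.sub h').eq_zero fun x => by rw [LinearMap.sub_apply, h0, sub_self])

end BoundedFunctionals

/-! ### Product functionals on Hochschild boundaries -/

section Telescope

/-- A derivation splits each product of neighbouring factors into two terms, and consecutive faces
share one of them with opposite signs; only the two ends survive. -/
lemma sum_telescope (k : ℕ) (T : Fin (k + 1) → ℝ) :
    ∑ i : Fin k, (-1 : ℝ) ^ ((i : ℕ) + 1) * (T i.castSucc + T i.succ) =
      (-1) ^ k * T (Fin.last k) - T 0 := by
  induction k with
  | zero => simp [Fin.last]
  | succ k ih =>
    rw [Fin.sum_univ_castSucc]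
    have h := ih fun i => T i.castSucc
    simp only [Fin.val_castSucc, Fin.val_last, Fin.succ_last]
    simp only [Fin.castSucc_zero, ← Fin.succ_castSucc] at h
    rw [h]
    simp only [pow_succ]
    ring

variable {A B : Type u} [CommRing A] [Algebra ℝ A] [CommRing B] [Algebra ℝ B]
  [Bornology A] [Bornology B] [BddMul A] [BddMul B] (s t : B →ₐ[ℝ] A)

lemma regroup_face_zero (k : ℕ) (a : A) (f : Fin (k + 1) → B) :
    regroup s t (faceIndex k 0) (a, f) = (a * s (f 0), fun j => f j.succ) := by
  refine Prod.ext ?_ (funext fun j => ?_)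
  · simp only [regroup]
    rw [Fin.prod_univ_succ, Finset.prod_eq_one]
    · simp [faceIndex, coeffPart]
    · intro i _
      simp [faceIndex, coeffPart]
  · simp only [regroup]
    rw [Finset.prod_eq_single j.succ]
    · simp [faceIndex]
    · intro i _ hi
      rw [if_neg]
      intro h
      refine hi (Fin.ext ?_)
      have h0 : ¬ ((i : ℕ) < ((0 : Fin (k + 2)) : ℕ)) := Nat.not_lt_zero _
      simp only [faceIndex, h0, false_and, dite_false, if_false] at h
      split_ifs at h with h1
      simp only [Sum.inl.injEq, Fin.ext_iff] at h
      rw [Fin.val_succ]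
      omega
    · simp

lemma regroup_face_last (k : ℕ) (a : A) (f : Fin (k + 1) → B) :
    regroup s t (faceIndex k (Fin.last (k + 1))) (a, f) =
      (a * t (f (Fin.last k)), fun j => f j.castSucc) := by
  refine Prod.ext ?_ (funext fun j => ?_)
  · simp only [regroup]
    rw [Fin.prod_univ_castSucc, Finset.prod_eq_one]
    · simp [faceIndex, coeffPart]
    · intro i _
      have h1 : (i : ℕ) < k + 1 := by omega
      simp [faceIndex, coeffPart, h1]
  · simp only [regroup]
    rw [Finset.prod_eq_single j.castSucc]
    · have h1 : (j : ℕ) < k + 1 := by omega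
      simp [faceIndex, h1]
    · intro i _ hi
      rw [if_neg]
      intro h
      refine hi (Fin.ext ?_)
      simp only [faceIndex] at h
      split_ifs at h <;> simp_all [Fin.ext_iff]
      omega
    · simp

/-- Away from slot `i` the factors are listed by skipping position `i`. This indexing makes the
product over `j ≠ i` literally the same in all terms of the telescoping computation. -/
lemma regroup_face_middle (k : ℕ) (i : Fin k) (a : A) (f : Fin (k + 1) → B) :
    regroup s t (faceIndex k i.succ.castSucc) (a, f) =
      (a, fun j => if j = i then f i.castSucc * f i.succ else f (i.castSucc.succAbove j)) := by
  -- Factors up to position `i` keep their place and later ones move one to the left, so positions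
  -- `i` and `i + 1` meet in slot `i`. The subtraction only occurs for `q > i`, where it is not
  -- truncated.
  have hidx : ∀ q : Fin (k + 1), faceIndex k i.succ.castSucc q =
      .inl (if h : (q : ℕ) ≤ i then ⟨q, by omega⟩ else ⟨q - 1, by omega⟩) := by
    intro q
    simp only [faceIndex, Fin.val_castSucc, Fin.val_succ]
    have hi := i.2
    split_ifs <;> first | rfl | omega
  refine Prod.ext ?_ (funext fun j => ?_)
  · simp only [regroup, hidx, coeffPart, Finset.prod_const_one, mul_one]
  · simp only [regroup, hidx, Sum.inl.injEq]
    by_cases hj : j = i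
    · subst hj
      rw [if_pos rfl, ← Finset.prod_subset (s₁ := {j.castSucc, j.succ}) (Finset.subset_univ _)]
      · rw [Finset.prod_pair (Fin.castSucc_lt_succ).ne]
        simp
      · intro q _ hq
        simp only [Finset.mem_insert, Finset.mem_singleton, not_or, Fin.ext_iff, Fin.val_castSucc,
          Fin.val_succ] at hq
        rw [if_neg]
        split_ifs <;> rw [Fin.ext_iff] <;> dsimp only <;> omega
    · have hj' : (j : ℕ) ≠ i := fun h => hj (Fin.ext h)
      have hv : ((i.castSucc.succAbove j : Fin (k + 1)) : ℕ) = if (j : ℕ) < i then (j : ℕ) else j + 1 := by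
        simp only [Fin.succAbove, Fin.lt_def, Fin.val_castSucc]
        split_ifs <;> rfl
      rw [if_neg hj, Finset.prod_eq_single (i.castSucc.succAbove j)]
      · rw [if_pos]
        rw [Fin.ext_iff]
        split_ifs at hv <;> split_ifs <;> dsimp only <;> omega
      · intro q _ hq
        rw [if_neg]
        intro h
        refine hq (Fin.ext ?_)
        rw [Fin.ext_iff] at h
        split_ifs at hv <;> split_ifs at h <;> dsimp only at h <;> omega
      · simp

variable (hs : BddMap s) (ht : BddMap t)

/-- The functional `prodFunctional α β` evaluated on a Hochschild boundary, when `α` and the `βⱼ`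
are derivations along a character `ε` up to the error terms `θ` and `R j`. -/
lemma prodFunctional_hochschildB (k : ℕ) {α : A →ₗ[ℝ] ℝ} {β : Fin k → B →ₗ[ℝ] ℝ}
    (hα : BddReal α) (hβ : ∀ j, BddReal (β j)) (ε : B → ℝ) (θ : A → B → ℝ)
    (R : Fin k → B → B → ℝ) (hαs : ∀ a f, α (a * s f) = ε f * α a)
    (hαt : ∀ a f, α (a * t f) = ε f * α a + θ a f)
    (hR : ∀ j f g, β j (f * g) = ε f * β j g + β j f * ε g + R j f g)
    (a : A) (f : Fin (k + 1) → B) :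
    prodFunctional α β hα hβ (hochschildB s t hs ht k (pureTensor (a, f))) =
      (-1) ^ (k + 1) * (θ a (f (Fin.last k)) * ∏ j, β j (f j.castSucc)) +
      ∑ i : Fin k, (-1 : ℝ) ^ ((i : ℕ) + 1) * (α a * (R i (f i.castSucc) (f i.succ) *
        ∏ j ∈ Finset.univ.erase i, β j (f (i.castSucc.succAbove j)))) := by
  -- In `T i` the factor `f i` is evaluated by `ε` and the others enter the `β j` in order. Up to
  -- sign, face 0 gives `T 0`, face `i + 1` gives `T i + T (i + 1)` plus the error `R i`, and the
  -- last face gives `T k` plus the error `θ`. All the `T` cancel.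
  let T : Fin (k + 1) → ℝ := fun i => α a * (ε (f i) * ∏ j, β j (f (i.succAbove j)))
  have hb : prodFunctional α β hα hβ (hochschildB s t hs ht k (pureTensor (a, f))) =
      ∑ i : Fin (k + 2), (-1 : ℝ) ^ (i : ℕ) * (α (regroup s t (faceIndex k i) (a, f)).1 *
        ∏ j, β j ((regroup s t (faceIndex k i) (a, f)).2 j)) := by
    simp only [hochschildB, LinearMap.sum_apply, LinearMap.smul_apply, map_sum, map_smul, faceMap,
      tensorMap_pureTensor, prodFunctional_pureTensor, smul_eq_mul]
  have hmid : ∀ i : Fin k, α (regroup s t (faceIndex k i.succ.castSucc) (a, f)).1 *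
        ∏ j, β j ((regroup s t (faceIndex k i.succ.castSucc) (a, f)).2 j) =
      (T i.castSucc + T i.succ) + α a * (R i (f i.castSucc) (f i.succ) *
        ∏ j ∈ Finset.univ.erase i, β j (f (i.castSucc.succAbove j))) := by
    intro i
    -- Skipping position `i` and skipping position `i + 1` select the same factor in every slot
    -- except `i`.
    have h1 : ∏ j ∈ Finset.univ.erase i, β j (f (i.succ.succAbove j)) =
        ∏ j ∈ Finset.univ.erase i, β j (f (i.castSucc.succAbove j)) := by
      refine Finset.prod_congr rfl fun j hj => ?_
      have hj' : (j : ℕ) ≠ i := fun h => Finset.ne_of_mem_erase hj (Fin.ext h)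
      congr 2
      simp only [Fin.succAbove, Fin.lt_def, Fin.val_castSucc, Fin.val_succ]
      split_ifs <;> first | rfl | omega
    have h2 : ∏ j ∈ Finset.univ.erase i,
        β j (if j = i then f i.castSucc * f i.succ else f (i.castSucc.succAbove j)) =
        ∏ j ∈ Finset.univ.erase i, β j (f (i.castSucc.succAbove j)) :=
      Finset.prod_congr rfl fun j hj => by rw [if_neg (Finset.ne_of_mem_erase hj)]
    rw [regroup_face_middle]
    simp only [T]
    rw [← Finset.mul_prod_erase _ _ (Finset.mem_univ i), h2,
      ← Finset.mul_prod_erase _ (fun j => β j (f (i.castSucc.succAbove j))) (Finset.mem_univ i),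
      ← Finset.mul_prod_erase _ (fun j => β j (f (i.succ.succAbove j))) (Finset.mem_univ i), h1,
      if_pos rfl, hR, Fin.succAbove_castSucc_self, Fin.succAbove_succ_self]
    ring
  rw [hb, Fin.sum_univ_castSucc, Fin.sum_univ_succ]
  simp only [Fin.castSucc_zero, Fin.val_zero, pow_zero, one_mul, regroup_face_zero, hmid,
    Fin.val_castSucc, Fin.val_succ, Fin.val_last, mul_add (_ ^ _) (_ + _),
    Finset.sum_add_distrib, sum_telescope, regroup_face_last, hαs, hαt]
  simp only [T, Fin.succAbove_zero, Fin.succAbove_last, pow_succ]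
  ring

end Telescope

/-! ### Term-by-term differentiation and uniformly bounded smooth families -/

section SmoothFamilies

/-- Absolutely convergent combinations of functions with uniformly bounded derivatives. -/
lemma contDiffOn_tsum_smul {E : Type u} [NormedAddCommGroup E] [NormedSpace ℝ E] {ι : Type*}
    {c : ι → ℝ} (hc : Summable c) {U : Set E} (hU : IsOpen U) (hU' : IsPreconnected U)
    (hne : U.Nonempty) (n : ℕ) :
    ∀ {F : Type u} [NormedAddCommGroup F] [NormedSpace ℝ F] [CompleteSpace F] {h : ι → E → F}
      (_ : ∀ i, ContDiffOn ℝ n (h i) U) {C : ℕ → ℝ}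
      (_ : ∀ r ≤ n, ∀ i, ∀ y ∈ U, ‖iteratedFDeriv ℝ r (h i) y‖ ≤ C r),
      ContDiffOn ℝ n (fun y => ∑' i, c i • h i y) U ∧
      ∀ r ≤ n, ∀ y ∈ U, ‖iteratedFDeriv ℝ r (fun y => ∑' i, c i • h i y) y‖ ≤
        (∑' i, |c i|) * C r := by
  have hterm : ∀ {F : Type u} [NormedAddCommGroup F] [NormedSpace ℝ F] (i : ι) (v : F) (K : ℝ),
      ‖v‖ ≤ K → ‖c i • v‖ ≤ |c i| * K := fun i v K hv => by
    rw [norm_smul, Real.norm_eq_abs]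
    exact mul_le_mul_of_nonneg_left hv (abs_nonneg _)
  have hzero : ∀ {F : Type u} [NormedAddCommGroup F] [NormedSpace ℝ F] {h : ι → E → F}
      {K : ℝ} (y : E), (∀ i, ‖h i y‖ ≤ K) → ‖∑' i, c i • h i y‖ ≤ (∑' i, |c i|) * K := by
    intro F _ _ h K y hK
    rw [← tsum_mul_right]
    exact tsum_of_norm_bounded (hc.abs.mul_right K).hasSum fun i => hterm i _ _ (hK i)
  -- The induction step passes from `h` to its derivatives, whose values lie in `E →L[ℝ] F`; hence
  -- the target `F` has to vary with `n`.
  induction n with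
  | zero =>
    intro F _ _ _ h hh C hC
    have hC0 : ∀ i, ∀ y ∈ U, ‖h i y‖ ≤ C 0 := fun i y hy => by simpa using hC 0 le_rfl i y hy
    refine ⟨?_, fun r hr y hy => ?_⟩
    · simp only [CharP.cast_eq_zero, contDiffOn_zero] at hh ⊢
      exact continuousOn_tsum (fun i => (hh i).const_smul (c i)) (hc.abs.mul_right (C 0))
        fun i y hy => hterm i _ _ (hC0 i y hy)
    · obtain rfl : r = 0 := by omega
      rw [norm_iteratedFDeriv_zero]
      exact hzero y fun i => hC0 i y hy
  | succ n ih =>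
    intro F _ _ _ h hh C hC
    have hC0 : ∀ i, ∀ y ∈ U, ‖h i y‖ ≤ C 0 := fun i y hy => by simpa using hC 0 (by omega) i y hy
    have hC1 : ∀ i, ∀ y ∈ U, ‖fderiv ℝ (h i) y‖ ≤ C 1 := fun i y hy => by
      simpa using hC 1 (by omega) i y hy
    have hd : ∀ i, ∀ y ∈ U, HasFDerivAt (h i) (fderiv ℝ (h i) y) y := fun i y hy =>
      (((hh i).differentiableOn (by simp)).differentiableAt (hU.mem_nhds hy)).hasFDerivAt
    have hF : ∀ y ∈ U, HasFDerivAt (fun y => ∑' i, c i • h i y)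
        (∑' i, c i • fderiv ℝ (h i) y) y := by
      -- Term-by-term differentiation on a preconnected open set asks for summability of the
      -- functions at a single point only, and for a summable bound on the derivatives.
      obtain ⟨y₀, hy₀⟩ := hne
      intro y hy
      exact hasFDerivAt_tsum_of_isPreconnected (hc.abs.mul_right (C 1)) hU hU'
        (fun i y hy => (hd i y hy).const_smul (c i)) (fun i y hy => hterm i _ _ (hC1 i y hy)) hy₀
        (Summable.of_norm_bounded (hc.abs.mul_right (C 0)) fun i => hterm i _ _ (hC0 i y₀ hy₀)) hy
    have hF' : ∀ y ∈ U, fderiv ℝ (fun y => ∑' i, c i • h i y) y =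
        ∑' i, c i • fderiv ℝ (h i) y := fun y hy => (hF y hy).fderiv
    have hfd : ∀ i, ContDiffOn ℝ n (fderiv ℝ (h i)) U := fun i =>
      ((contDiffOn_succ_iff_fderiv_of_isOpen hU).1 (hh i)).2.2
    -- The bounds are shifted by one because the derivative of order `r` of `fderiv` has the norm of
    -- the derivative of order `r + 1`.
    obtain ⟨h1, h2⟩ := ih (h := fun i => fderiv ℝ (h i)) hfd (C := fun r => C (r + 1))
      (fun r hr i y hy => by
        rw [norm_iteratedFDeriv_fderiv]; exact hC (r + 1) (by omega) i y hy)
    refine ⟨?_, fun r hr y hy => ?_⟩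
    · refine (contDiffOn_succ_iff_fderiv_of_isOpen hU).2 ⟨fun y hy =>
        (hF y hy).differentiableAt.differentiableWithinAt, by simp, h1.congr hF'⟩
    · cases r with
      | zero =>
        rw [norm_iteratedFDeriv_zero]
        exact hzero y fun i => hC0 i y hy
      | succ r =>
        rw [← norm_iteratedFDeriv_fderiv]
        have heq : fderiv ℝ (fun y => ∑' i, c i • h i y) =ᶠ[𝓝 y]
            fun y => ∑' i, c i • fderiv ℝ (h i) y :=
          Filter.eventuallyEq_of_mem (hU.mem_nhds hy) hF'
        rw [(heq.iteratedFDeriv ℝ r).self_of_nhds]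
        exact h2 r (by omega) y hy

variable {E : Type u} [NormedAddCommGroup E] [NormedSpace ℝ E] {ι : Type*}

/-- A family of functions which are smooth near `y₀`, with derivatives of every order uniformly
bounded near `y₀`. -/
structure SmoothFamily (h : ι → E → ℝ) (y₀ : E) : Prop where
  contDiffAt : ∀ᶠ y in 𝓝 y₀, ∀ i, ContDiffAt ℝ ∞ (h i) y
  bounded : ∀ r : ℕ, ∃ C : ℝ, ∀ᶠ y in 𝓝 y₀, ∀ i, ‖iteratedFDeriv ℝ r (h i) y‖ ≤ C

variable {y₀ : E}

lemma SmoothFamily.mul {h h' : ι → E → ℝ} (hh : SmoothFamily h y₀) (hh' : SmoothFamily h' y₀) :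
    SmoothFamily (fun i y => h i y * h' i y) y₀ := by
  refine ⟨?_, fun r => ?_⟩
  · filter_upwards [hh.contDiffAt, hh'.contDiffAt] with y h1 h2 i
    exact (h1 i).mul (h2 i)
  choose C hC using hh.bounded
  choose D hD using hh'.bounded
  refine ⟨∑ j ∈ Finset.range (r + 1), (r.choose j : ℝ) * C j * D (r - j), ?_⟩
  have hC' : ∀ᶠ y in 𝓝 y₀, ∀ j ∈ Finset.range (r + 1), ∀ i, ‖iteratedFDeriv ℝ j (h i) y‖ ≤ C j :=
    (Filter.eventually_all_finset _).2 fun j _ => hC j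
  have hD' : ∀ᶠ y in 𝓝 y₀, ∀ j ∈ Finset.range (r + 1), ∀ i,
      ‖iteratedFDeriv ℝ (r - j) (h' i) y‖ ≤ D (r - j) :=
    (Filter.eventually_all_finset _).2 fun j _ => hD (r - j)
  filter_upwards [hC', hD', eventually_eventually_nhds.2 (hh.contDiffAt.and hh'.contDiffAt)]
    with y h1 h2 h3 i
  obtain ⟨U, hU, hUo, hyU⟩ := mem_nhds_iff.1 h3
  have hm := norm_iteratedFDerivWithin_mul_le (f := h i) (g := h' i) (n := r)
    (fun z hz => ((hU hz).1 i).contDiffWithinAt) (fun z hz => ((hU hz).2 i).contDiffWithinAt)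
    hUo.uniqueDiffOn hyU (N := ∞) (by exact_mod_cast le_top)
  simp only [iteratedFDerivWithin_of_isOpen _ hUo hyU] at hm
  refine hm.trans (Finset.sum_le_sum fun j hj => ?_)
  exact mul_le_mul (mul_le_mul_of_nonneg_left (h1 j hj i) (Nat.cast_nonneg _)) (h2 j hj i)
    (norm_nonneg _) (mul_nonneg (Nat.cast_nonneg _) ((norm_nonneg _).trans (h1 j hj i)))

lemma smoothFamily_const (a : ℝ) : SmoothFamily (fun (_ : ι) (_ : E) => a) y₀ := by
  refine ⟨Eventually.of_forall fun y i => contDiffAt_const, fun r => ⟨|a|, ?_⟩⟩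
  refine Eventually.of_forall fun y i => ?_
  cases r with
  | zero => simp
  | succ r => simp [iteratedFDeriv_const_of_ne (Nat.succ_ne_zero r)]

lemma SmoothFamily.add {h h' : ι → E → ℝ} (hh : SmoothFamily h y₀) (hh' : SmoothFamily h' y₀) :
    SmoothFamily (fun i y => h i y + h' i y) y₀ := by
  refine ⟨?_, fun r => ?_⟩
  · filter_upwards [hh.contDiffAt, hh'.contDiffAt] with y h1 h2 i
    exact (h1 i).add (h2 i)
  obtain ⟨C, hC⟩ := hh.bounded r
  obtain ⟨D, hD⟩ := hh'.bounded r
  refine ⟨C + D, ?_⟩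
  filter_upwards [hC, hD, hh.contDiffAt, hh'.contDiffAt] with y h1 h2 h3 h4 i
  have hadd := iteratedFDeriv_add_apply (i := r) ((h3 i).of_le (by exact_mod_cast le_top))
    ((h4 i).of_le (by exact_mod_cast le_top))
  exact (congrArg norm hadd).le.trans ((norm_add_le _ _).trans (add_le_add (h1 i) (h2 i)))

lemma SmoothFamily.sum {κ : Type*} (I : Finset κ) {h : κ → ι → E → ℝ}
    (hh : ∀ j, SmoothFamily (h j) y₀) : SmoothFamily (fun i y => ∑ j ∈ I, h j i y) y₀ := by
  classical
  induction I using Finset.induction_on with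
  | empty => simpa using smoothFamily_const 0
  | insert j I hj ih =>
    simp only [Finset.sum_insert hj]
    exact (hh j).add ih

lemma SmoothFamily.prod {κ : Type*} (I : Finset κ) {h : κ → ι → E → ℝ}
    (hh : ∀ j, SmoothFamily (h j) y₀) : SmoothFamily (fun i y => ∏ j ∈ I, h j i y) y₀ := by
  classical
  induction I using Finset.induction_on with
  | empty => simpa using smoothFamily_const 1
  | insert j I hj ih =>
    simp only [Finset.prod_insert hj]
    exact (hh j).mul ih

/-- Order `r` of the new family is controlled by order `r + 1` of the old one, so closure under
derivatives relies on `SmoothFamily` bounding every order. -/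
lemma SmoothFamily.fderiv_apply {h : ι → E → ℝ} (hh : SmoothFamily h y₀) (w : E) :
    SmoothFamily (fun i y => fderiv ℝ (h i) y w) y₀ := by
  have h1 : ∀ᶠ y in 𝓝 y₀, ∀ i, ContDiffAt ℝ ∞ (fderiv ℝ (h i)) y := by
    filter_upwards [hh.contDiffAt] with y hy i
    exact (hy i).fderiv_right (by simp)
  refine ⟨?_, fun r => ?_⟩
  · filter_upwards [h1] with y hy i
    exact (hy i).clm_apply contDiffAt_const
  · obtain ⟨C, hC⟩ := hh.bounded (r + 1)
    refine ⟨‖w‖ * C, ?_⟩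
    filter_upwards [h1, hC] with y hy hC i
    refine (norm_iteratedFDeriv_clm_apply_const (hy i) (N := ∞) (n := r)
      (by exact_mod_cast le_top)).trans ?_
    rw [norm_iteratedFDeriv_fderiv]
    exact mul_le_mul_of_nonneg_left (hC i) (norm_nonneg _)

/-- Only the orders up to `n` have to be controlled at once, so a single ball works; it depends on
`n` but not on the coefficients `c`. A ball is preconnected, as term-by-term differentiation
requires. -/
lemma SmoothFamily.tsum_bounded {E : Type} [NormedAddCommGroup E] [NormedSpace ℝ E] {y₀ : E}
    {h : ι → E → ℝ} (hh : SmoothFamily h y₀) (n : ℕ) :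
    ∃ C : ℝ, ∀ᶠ y in 𝓝 y₀, ∀ c : ι → ℝ, Summable c →
      ContDiffAt ℝ n (fun y => ∑' i, c i * h i y) y ∧
      ‖iteratedFDeriv ℝ n (fun y => ∑' i, c i * h i y) y‖ ≤ (∑' i, |c i|) * C := by
  choose C hC using hh.bounded
  refine ⟨C n, ?_⟩
  have hC' : ∀ᶠ y in 𝓝 y₀, ∀ j ∈ Finset.range (n + 1), ∀ i, ‖iteratedFDeriv ℝ j (h i) y‖ ≤ C j :=
    (Filter.eventually_all_finset _).2 fun j _ => hC j
  obtain ⟨ε, hε, hball⟩ := Metric.eventually_nhds_iff_ball.1 (hh.contDiffAt.and hC')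
  filter_upwards [Metric.ball_mem_nhds y₀ hε] with y hy c hc
  obtain ⟨h1, h2⟩ := contDiffOn_tsum_smul hc Metric.isOpen_ball
    (convex_ball y₀ ε).isPreconnected ⟨y, hy⟩ n (h := h) (C := C)
    (fun i z hz => (((hball z hz).1 i).of_le (by exact_mod_cast le_top)).contDiffWithinAt)
    (fun r hr i z hz => (hball z hz).2 r (Finset.mem_range.2 (by omega)) i)
  exact ⟨h1.contDiffAt (Metric.isOpen_ball.mem_nhds hy), h2 n le_rfl y hy⟩

end SmoothFamilies

/-! ### First and second derivatives at a point, and charts of open subsets -/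

section PointDerivations

variable {E : Type*} [NormedAddCommGroup E] [NormedSpace ℝ E] {H : Type*} [TopologicalSpace H]
  {I : ModelWithCorners ℝ E H} {N : Type u} [TopologicalSpace N] [ChartedSpace H N]
  [I.Boundaryless] [IsManifold I ∞ N]

lemma contDiffAt_chart (f : C^∞⟮I, N; 𝓘(ℝ), ℝ⟯) (x : N) :
    ContDiffAt ℝ ∞ (f ∘ (extChartAt I x).symm) (extChartAt I x x) :=
  (eventually_contDiffAt (I := I) x).self_of_nhds f f.contMDiff

lemma differentiableAt_chart (f : C^∞⟮I, N; 𝓘(ℝ), ℝ⟯) (x : N) :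
    DifferentiableAt ℝ (f ∘ (extChartAt I x).symm) (extChartAt I x x) :=
  (contDiffAt_chart f x).differentiableAt (by simp)

lemma differentiableAt_fderiv_chart (f : C^∞⟮I, N; 𝓘(ℝ), ℝ⟯) (x : N) (v : E) :
    DifferentiableAt ℝ (fun y => fderiv ℝ (f ∘ (extChartAt I x).symm) y v) (extChartAt I x x) :=
  (((contDiffAt_chart f x).fderiv_right (m := ∞) (by simp)).differentiableAt
    (by simp)).clm_apply (differentiableAt_const v)

lemma eventually_differentiableAt_chart (x : N) :
    ∀ᶠ y in 𝓝 (extChartAt I x x), ∀ f : C^∞⟮I, N; 𝓘(ℝ), ℝ⟯,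
      DifferentiableAt ℝ (f ∘ (extChartAt I x).symm) y :=
  (eventually_contDiffAt (I := I) x).mono fun _ h f =>
    (h f f.contMDiff).differentiableAt (by simp)

/-- A bounded family of smooth functions is a smooth family in every chart. -/
lemma smoothFamily_chart {ι : Type*} {f : ι → C^∞⟮I, N; 𝓘(ℝ), ℝ⟯}
    (hf : Bornology.IsBounded (range f)) (x : N) :
    SmoothFamily (fun i => f i ∘ (extChartAt I x).symm) (extChartAt I x x) where
  contDiffAt := (eventually_contDiffAt (I := I) x).mono fun _ h i => h (f i) (f i).contMDiff
  bounded r := by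
    obtain ⟨C, hC⟩ := isBounded_smooth_iff.1 hf x r
    exact ⟨C, hC.mono fun y hy i => hy _ (mem_image_of_mem _ (mem_range_self i))⟩

/-- The order-zero bound of the family at the chart centre bounds the functional. As smooth families
are closed under derivatives, this covers evaluation and derivatives at a point alike. -/
lemma bddReal_of_smoothFamily {φ : C^∞⟮I, N; 𝓘(ℝ), ℝ⟯ → ℝ} (x : N)
    (h : ∀ S : Set C^∞⟮I, N; 𝓘(ℝ), ℝ⟯,
      SmoothFamily (fun i : S => i.1 ∘ (extChartAt I x).symm) (extChartAt I x x) →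
      ∃ g : S → E → ℝ, SmoothFamily g (extChartAt I x x) ∧ ∀ i, φ i.1 = g i (extChartAt I x x)) :
    BddReal φ := fun S hS => by
  obtain ⟨g, hg, hφ⟩ := h S (smoothFamily_chart (f := Subtype.val)
    (by rwa [Subtype.range_coe]) x)
  obtain ⟨C, hC⟩ := hg.bounded 0
  refine ⟨C, fun f hf => ?_⟩
  have := hC.self_of_nhds ⟨f, hf⟩
  rw [norm_iteratedFDeriv_zero] at this
  rwa [hφ ⟨f, hf⟩]

/-- Evaluation at a point. -/
def evalAt (x : N) : C^∞⟮I, N; 𝓘(ℝ), ℝ⟯ →ₗ[ℝ] ℝ where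
  toFun f := f x
  map_add' _ _ := rfl
  map_smul' _ _ := rfl

lemma evalAt_apply (x : N) (f : C^∞⟮I, N; 𝓘(ℝ), ℝ⟯) : evalAt x f = f x := rfl

lemma bddReal_evalAt (x : N) : BddReal (evalAt (I := I) x) :=
  bddReal_of_smoothFamily x fun _ h => ⟨_, h, fun i => by simp [evalAt]⟩

/-- The derivative at `x` in the direction `v`, in the chart centred at `x`. -/
def pointDeriv (x : N) (v : E) : C^∞⟮I, N; 𝓘(ℝ), ℝ⟯ →ₗ[ℝ] ℝ where
  toFun f := fderiv ℝ (f ∘ (extChartAt I x).symm) (extChartAt I x x) v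
  map_add' f g := by
    have h : (f + g : C^∞⟮I, N; 𝓘(ℝ), ℝ⟯) ∘ (extChartAt I x).symm =
        f ∘ (extChartAt I x).symm + g ∘ (extChartAt I x).symm := rfl
    rw [h, fderiv_add (differentiableAt_chart f x) (differentiableAt_chart g x)]
    rfl
  map_smul' r f := by
    have h : (r • f : C^∞⟮I, N; 𝓘(ℝ), ℝ⟯) ∘ (extChartAt I x).symm =
        r • f ∘ (extChartAt I x).symm := rfl
    rw [h, fderiv_const_smul (differentiableAt_chart f x)]
    rfl

lemma pointDeriv_apply (x : N) (v : E) (f : C^∞⟮I, N; 𝓘(ℝ), ℝ⟯) :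
    pointDeriv x v f = fderiv ℝ (f ∘ (extChartAt I x).symm) (extChartAt I x x) v := rfl

lemma bddReal_pointDeriv (x : N) (v : E) : BddReal (pointDeriv (I := I) x v) :=
  bddReal_of_smoothFamily x fun _ h => ⟨_, h.fderiv_apply v, fun _ => rfl⟩

/-- Stated at any point `y` of differentiability, not only at the chart centre, because the product
rule for second derivatives differentiates this identity once more. -/
lemma fderiv_chart_mul {f g : C^∞⟮I, N; 𝓘(ℝ), ℝ⟯} {x : N} {y : E}
    (hf : DifferentiableAt ℝ (f ∘ (extChartAt I x).symm) y)
    (hg : DifferentiableAt ℝ (g ∘ (extChartAt I x).symm) y) (v : E) :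
    fderiv ℝ ((f * g : C^∞⟮I, N; 𝓘(ℝ), ℝ⟯) ∘ (extChartAt I x).symm) y v =
      f ((extChartAt I x).symm y) * fderiv ℝ (g ∘ (extChartAt I x).symm) y v +
      fderiv ℝ (f ∘ (extChartAt I x).symm) y v * g ((extChartAt I x).symm y) := by
  have h : (f * g : C^∞⟮I, N; 𝓘(ℝ), ℝ⟯) ∘ (extChartAt I x).symm =
      (f ∘ (extChartAt I x).symm) * (g ∘ (extChartAt I x).symm) := rfl
  rw [h, fderiv_mul hf hg]
  simp [mul_comm]

lemma pointDeriv_mul (x : N) (v : E) (f g : C^∞⟮I, N; 𝓘(ℝ), ℝ⟯) :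
    pointDeriv x v (f * g) = f x * pointDeriv x v g + pointDeriv x v f * g x := by
  rw [pointDeriv_apply, fderiv_chart_mul (differentiableAt_chart f x) (differentiableAt_chart g x)]
  simp [pointDeriv_apply]

/-- The second derivative at `x` in the directions `v` and `w`, in the chart centred at `x`. -/
def secondDeriv (x : N) (v w : E) : C^∞⟮I, N; 𝓘(ℝ), ℝ⟯ →ₗ[ℝ] ℝ where
  toFun f := fderiv ℝ (fun y => fderiv ℝ (f ∘ (extChartAt I x).symm) y w) (extChartAt I x x) v
  map_add' f g := by
    have h : (fun y => fderiv ℝ ((f + g : C^∞⟮I, N; 𝓘(ℝ), ℝ⟯) ∘ (extChartAt I x).symm) y w)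
        =ᶠ[𝓝 (extChartAt I x x)] (fun y => fderiv ℝ (f ∘ (extChartAt I x).symm) y w) +
          fun y => fderiv ℝ (g ∘ (extChartAt I x).symm) y w := by
      filter_upwards [eventually_differentiableAt_chart (I := I) x] with y hy
      exact congrArg (fun L : E →L[ℝ] ℝ => L w) (fderiv_add (hy f) (hy g))
    rw [h.fderiv_eq, fderiv_add (differentiableAt_fderiv_chart f x w)
      (differentiableAt_fderiv_chart g x w)]
    rfl
  map_smul' r f := by
    have h : (fun y => fderiv ℝ ((r • f : C^∞⟮I, N; 𝓘(ℝ), ℝ⟯) ∘ (extChartAt I x).symm) y w)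
        =ᶠ[𝓝 (extChartAt I x x)] r • (fun y => fderiv ℝ (f ∘ (extChartAt I x).symm) y w) := by
      filter_upwards [eventually_differentiableAt_chart (I := I) x] with y hy
      exact congrArg (fun L : E →L[ℝ] ℝ => L w) (fderiv_const_smul (hy f) r)
    rw [h.fderiv_eq, fderiv_const_smul (differentiableAt_fderiv_chart f x w)]
    rfl

lemma secondDeriv_apply (x : N) (v w : E) (f : C^∞⟮I, N; 𝓘(ℝ), ℝ⟯) :
    secondDeriv x v w f =
      fderiv ℝ (fun y => fderiv ℝ (f ∘ (extChartAt I x).symm) y w) (extChartAt I x x) v := rfl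

lemma bddReal_secondDeriv (x : N) (v w : E) : BddReal (secondDeriv (I := I) x v w) :=
  bddReal_of_smoothFamily x fun _ h => ⟨_, (h.fderiv_apply w).fderiv_apply v, fun _ => rfl⟩

/-- The defect from being a derivation is the symmetrised product of first derivatives. It is this
term that detects the exchange of two adjacent vectors in a cycle. -/
lemma secondDeriv_mul (x : N) (v w : E) (f g : C^∞⟮I, N; 𝓘(ℝ), ℝ⟯) :
    secondDeriv x v w (f * g) = f x * secondDeriv x v w g + secondDeriv x v w f * g x +
      (pointDeriv x v f * pointDeriv x w g + pointDeriv x w f * pointDeriv x v g) := by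
  have h : (fun y => fderiv ℝ ((f * g : C^∞⟮I, N; 𝓘(ℝ), ℝ⟯) ∘ (extChartAt I x).symm) y w)
      =ᶠ[𝓝 (extChartAt I x x)]
        (f ∘ (extChartAt I x).symm) * (fun y => fderiv ℝ (g ∘ (extChartAt I x).symm) y w) +
        (fun y => fderiv ℝ (f ∘ (extChartAt I x).symm) y w) * (g ∘ (extChartAt I x).symm) := by
    filter_upwards [eventually_differentiableAt_chart (I := I) x] with y hy
    exact fderiv_chart_mul (hy f) (hy g) w
  rw [secondDeriv_apply, h.fderiv_eq, fderiv_add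
    ((differentiableAt_chart f x).mul (differentiableAt_fderiv_chart g x w))
    ((differentiableAt_fderiv_chart f x w).mul (differentiableAt_chart g x)),
    fderiv_mul (differentiableAt_chart f x) (differentiableAt_fderiv_chart g x w),
    fderiv_mul (differentiableAt_fderiv_chart f x w) (differentiableAt_chart g x)]
  simp [pointDeriv_apply, secondDeriv_apply]
  ring

lemma pointDeriv_eq_mfderiv (x : N) (v : E) (f : C^∞⟮I, N; 𝓘(ℝ), ℝ⟯) :
    pointDeriv x v f = (mfderiv I 𝓘(ℝ) f x : E →L[ℝ] ℝ) v := by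
  have h : MDifferentiableAt I 𝓘(ℝ) f x := f.contMDiff.mdifferentiableAt (by simp)
  obtain ⟨L, hL⟩ : ∃ L : E →L[ℝ] ℝ, L = mfderiv I 𝓘(ℝ) f x := ⟨_, rfl⟩
  have h' : HasFDerivWithinAt (f ∘ (extChartAt I x).symm) L (range I) (extChartAt I x x) := by
    rw [hL]
    exact h.hasMFDerivAt.2
  rw [I.range_eq_univ, hasFDerivWithinAt_univ] at h'
  rw [pointDeriv_apply, h'.fderiv, hL]
  rfl

lemma opens_extChartAt_apply {W : Opens N} (x₀ x : W) :
    extChartAt I x₀ x = extChartAt I x₀.1 x.1 := rfl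

lemma mem_extChartAt_source_of_opens {W : Opens N} {x₀ x : W}
    (hx : x ∈ (extChartAt I x₀).source) : x.1 ∈ (extChartAt I x₀.1).source := by
  rw [extChartAt_source] at hx ⊢
  simpa [Opens.chartAt_eq] using hx

lemma opens_extChartAt_symm_val {W : Opens N} (x₀ : W) {y : E}
    (hy : y ∈ (extChartAt I x₀).target) :
    (((extChartAt I x₀).symm y : W) : N) = (extChartAt I x₀.1).symm y := by
  have h1 := (extChartAt I x₀).map_target hy
  have h2 := (extChartAt I x₀).right_inv hy
  rw [opens_extChartAt_apply] at h2
  have h3 := (extChartAt I x₀.1).left_inv (mem_extChartAt_source_of_opens h1)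
  rw [h2] at h3
  exact h3.symm

/-- `dRel` is defined through extension by zero. Since the subset is open, the extension agrees
locally with the function itself, and charts of the subset are restrictions of ambient charts. -/
lemma extend_eventuallyEq_chart {W : Opens N} (f : W → ℝ) (x₀ : W) {y : E}
    (hy : y ∈ (extChartAt I x₀).target) :
    f ∘ (extChartAt I x₀).symm =ᶠ[𝓝 y]
      Function.extend Subtype.val f 0 ∘ (extChartAt I x₀.1).symm := by
  filter_upwards [(isOpen_extChartAt_target (I := I) x₀).mem_nhds hy] with z hz
  simp only [Function.comp_apply]
  rw [← opens_extChartAt_symm_val x₀ hz, Subtype.val_injective.extend_apply]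

lemma contMDiffAt_extend {W : Opens N} (f : C^∞⟮I, W; 𝓘(ℝ), ℝ⟯) (x : W) :
    ContMDiffAt I 𝓘(ℝ) ∞ (Function.extend Subtype.val f 0) x.1 := by
  rw [← contMDiffAt_subtype_iff]
  refine f.contMDiff.contMDiffAt.congr_of_eventuallyEq (Eventually.of_forall fun y => ?_)
  exact Subtype.val_injective.extend_apply _ _ _

end PointDerivations

/-! ### The relative differential in charts -/

section RelativeDifferential

variable {n m : ℕ} {G M : Type} [TopologicalSpace G] [ChartedSpace (EuclideanSpace ℝ (Fin n)) G]
  [TopologicalSpace M] [ChartedSpace (EuclideanSpace ℝ (Fin m)) M] [IsManifold (𝓡 n) ∞ G]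
  [IsManifold (𝓡 m) ∞ M]

lemma contMDiffAt_slice {W : Opens (G × M)} (f : SmoothFun n m W) (x : W) :
    ContMDiffAt (𝓡 m) 𝓘(ℝ) ∞ (fun q : M => Function.extend Subtype.val f 0 (x.1.1, q)) x.1.2 :=
  (contMDiffAt_extend f x).comp x.1.2 (contMDiffAt_const.prodMk contMDiffAt_id)

/-- The relative differential in the chart centred at `x₀`. -/
lemma dRel_trivialization {W : Opens (G × M)} (f : SmoothFun n m W) (x₀ x : W)
    (hx : x ∈ (extChartAt ((𝓡 n).prod (𝓡 m)) x₀).source) (v : EuclideanSpace ℝ (Fin m)) :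
    dRel m f x ((trivializationAt (EuclideanSpace ℝ (Fin m)) (TangentSpace (𝓡 m) : M → Type _)
      x₀.1.2).symm x.1.2 v) =
    fderiv ℝ (f ∘ (extChartAt ((𝓡 n).prod (𝓡 m)) x₀).symm)
      (extChartAt ((𝓡 n).prod (𝓡 m)) x₀ x) (0, v) := by
  have hx1 := mem_extChartAt_source_of_opens hx
  rw [extChartAt_prod] at hx1
  set φ := extChartAt (𝓡 m) x₀.1.2 with hφ
  set p := x.1.2 with hp
  have hxp : p ∈ φ.source := hx1.2
  have hxp' : p ∈ (chartAt (EuclideanSpace ℝ (Fin m)) x₀.1.2).source := by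
    rwa [hφ, extChartAt_source] at hxp
  set F : M → ℝ := fun q => Function.extend Subtype.val f 0 (x.1.1, q) with hF
  have hFd : HasMFDerivAt (𝓡 m) 𝓘(ℝ) F (φ.symm (φ p)) (mfderiv (𝓡 m) 𝓘(ℝ) F p) := by
    rw [φ.left_inv hxp]
    exact ((contMDiffAt_slice f x).mdifferentiableAt (by simp)).hasMFDerivAt
  have hφd : HasMFDerivAt 𝓘(ℝ, EuclideanSpace ℝ (Fin m)) (𝓡 m) φ.symm (φ p)
      (mfderiv 𝓘(ℝ, EuclideanSpace ℝ (Fin m)) (𝓡 m) φ.symm (φ p)) := by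
    refine MDifferentiableAt.hasMFDerivAt ?_
    have := mdifferentiableWithinAt_extChartAt_symm (I := 𝓡 m) (x := x₀.1.2) (φ.map_source hxp)
    rwa [(𝓡 m).range_eq_univ, mdifferentiableWithinAt_univ] at this
  obtain ⟨L₁, hL₁⟩ : ∃ L : EuclideanSpace ℝ (Fin m) →L[ℝ] ℝ, L = mfderiv (𝓡 m) 𝓘(ℝ) F p :=
    ⟨_, rfl⟩
  obtain ⟨L₂, hL₂⟩ : ∃ L : EuclideanSpace ℝ (Fin m) →L[ℝ] EuclideanSpace ℝ (Fin m),
    L = mfderiv 𝓘(ℝ, EuclideanSpace ℝ (Fin m)) (𝓡 m) φ.symm (φ p) := ⟨_, rfl⟩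
  have hcomp : HasFDerivAt (F ∘ φ.symm) (L₁.comp L₂) (φ p) := by
    rw [hL₁, hL₂]
    exact (hFd.comp (φ p) hφd).hasFDerivAt
  -- The tangent bundle is trivialized by the derivative of the chart, so the inverse trivialization
  -- is the derivative of the inverse chart.
  have hsymm : (trivializationAt (EuclideanSpace ℝ (Fin m)) (TangentSpace (𝓡 m) : M → Type _)
      x₀.1.2).symm p v = (mfderiv 𝓘(ℝ, EuclideanSpace ℝ (Fin m)) (𝓡 m) φ.symm (φ p) :
          EuclideanSpace ℝ (Fin m) →L[ℝ] EuclideanSpace ℝ (Fin m)) v := by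
    have := TangentBundle.symmL_trivializationAt (I := 𝓡 m) (𝕜 := ℝ) hxp'
    rw [(𝓡 m).range_eq_univ, mfderivWithin_univ] at this
    rw [← Bundle.Trivialization.symmL_apply (R := ℝ) _ hxp', this]
    rfl
  have hy := (extChartAt ((𝓡 n).prod (𝓡 m)) x₀).map_source hx
  -- In the product chart the slice through `x` along `M` is obtained by freezing the group
  -- coordinate, so its derivative is the derivative in a direction `(0, v)`.
  have hslice : F ∘ φ.symm =ᶠ[𝓝 (φ p)] fun z => (f ∘ (extChartAt ((𝓡 n).prod (𝓡 m)) x₀).symm)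
      ((extChartAt (𝓡 n) x₀.1.1 x.1.1, z)) := by
    have hc : ContinuousAt (fun z : EuclideanSpace ℝ (Fin m) =>
        (extChartAt (𝓡 n) x₀.1.1 x.1.1, z)) (φ p) :=
      continuousAt_const.prodMk continuousAt_id
    have := extend_eventuallyEq_chart f x₀ hy
    filter_upwards [hc.eventually this] with z hz
    rw [hz]
    simp only [Function.comp_apply, hF, extChartAt_prod]
    congr 1
    exact Prod.ext ((extChartAt (𝓡 n) x₀.1.1).left_inv hx1.1).symm rfl
  have hfd : DifferentiableAt ℝ (f ∘ (extChartAt ((𝓡 n).prod (𝓡 m)) x₀).symm)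
      (extChartAt ((𝓡 n).prod (𝓡 m)) x₀ x) := by
    have h1 : ContMDiffOn 𝓘(ℝ, _) ((𝓡 n).prod (𝓡 m)) ∞ (extChartAt ((𝓡 n).prod (𝓡 m)) x₀).symm
      (extChartAt ((𝓡 n).prod (𝓡 m)) x₀).target := contMDiffOn_extChartAt_symm x₀
    exact (((f.contMDiff.comp_contMDiffOn h1).contDiffOn).contDiffAt
      ((isOpen_extChartAt_target x₀).mem_nhds hy)).differentiableAt (by simp)
  have hchain : HasFDerivAt (fun z => (f ∘ (extChartAt ((𝓡 n).prod (𝓡 m)) x₀).symm)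
      ((extChartAt (𝓡 n) x₀.1.1 x.1.1, z))) ((fderiv ℝ (f ∘ (extChartAt ((𝓡 n).prod (𝓡 m)) x₀).symm)
      (extChartAt ((𝓡 n).prod (𝓡 m)) x₀ x)).comp (ContinuousLinearMap.inr ℝ _ _)) (φ p) :=
    HasFDerivAt.comp (φ p) (f := fun z => (extChartAt (𝓡 n) x₀.1.1 x.1.1, z)) hfd.hasFDerivAt
      (hasFDerivAt_prodMk_right _ _)
  have huniq := hcomp.unique (hchain.congr_of_eventuallyEq hslice)
  rw [hsymm]
  rw [hL₁, hL₂] at huniq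
  exact congrArg (fun L : EuclideanSpace ℝ (Fin m) →L[ℝ] ℝ => L v) huniq

/-- Every tangent vector corresponds to a vector of the model space in a given trivialization. -/
lemma exists_trivialization_symm (p : M) (v : TangentSpace (𝓡 m) p) :
    ∃ w : EuclideanSpace ℝ (Fin m), (trivializationAt (EuclideanSpace ℝ (Fin m))
      (TangentSpace (𝓡 m) : M → Type _) p).symm p w = v := by
  have hb : p ∈ (trivializationAt (EuclideanSpace ℝ (Fin m)) (TangentSpace (𝓡 m) : M → Type _)
    p).baseSet := FiberBundle.mem_baseSet_trivializationAt' p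
  refine ⟨(trivializationAt (EuclideanSpace ℝ (Fin m)) (TangentSpace (𝓡 m) : M → Type _)
      p).continuousLinearMapAt ℝ p v, ?_⟩
  have h := Bundle.Trivialization.symmL_continuousLinearMapAt (R := ℝ) _ hb v
  rwa [Bundle.Trivialization.symmL_apply _ hb] at h

/-- In the chart at `x` itself the tangent vector becomes a direction `(0, w)`. Linearity in the
function, the Leibniz rule and boundedness are thereby inherited from `pointDeriv`. -/
lemma exists_dRel_eq_pointDeriv {W : Opens (G × M)} (x : W) (v : TangentSpace (𝓡 m) x.1.2) :
    ∃ w, ∀ f : SmoothFun n m W, dRel m f x v = pointDeriv x w f := by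
  obtain ⟨w, rfl⟩ := exists_trivialization_symm x.1.2 v
  exact ⟨(0, w), fun f => dRel_trivialization f x x (mem_extChartAt_source x) w⟩

end RelativeDifferential

/-! ### The map Ψ from chains to relative forms -/

section FormMap

variable {n m : ℕ} {G M : Type} [TopologicalSpace G] [ChartedSpace (EuclideanSpace ℝ (Fin n)) G]
  [Group G] [LieGroup (𝓡 n) ∞ G] [TopologicalSpace M] [ChartedSpace (EuclideanSpace ℝ (Fin m)) M]
  [IsManifold (𝓡 m) ∞ M] [MulAction G M] [ContMDiffSMul (𝓡 n) (𝓡 m) ∞ G M]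
  {k : ℕ} {U : Opens (orbitSpace G M)}

/-- The differential at `x` of functions pulled back along the source map, as a bilinear map in the
tangent vector and the function. -/
def srcDeriv (x : arrowOpens U) : TangentSpace (𝓡 m) x.1.2 →ₗ[ℝ] BaseAlg m U →ₗ[ℝ] ℝ :=
  LinearMap.mk₂ ℝ (fun v f => dRel m (pull (srcMap n m U) f) x v)
    (fun v w f => map_add _ v w) (fun r v f => map_smul _ r v)
    (fun v f g => by
      obtain ⟨w, hw⟩ := exists_dRel_eq_pointDeriv (n := n) x v
      simp only [hw, map_add])
    (fun r v f => by
      obtain ⟨w, hw⟩ := exists_dRel_eq_pointDeriv (n := n) x v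
      simp only [hw, map_smul])

lemma srcDeriv_apply (x : arrowOpens U) (v : TangentSpace (𝓡 m) x.1.2) (f : BaseAlg m U) :
    srcDeriv (n := n) x v f = dRel m (pull (srcMap n m U) f) x v := rfl

lemma exists_srcDeriv_eq (x : arrowOpens U) (v : TangentSpace (𝓡 m) x.1.2) :
    ∃ w, ∀ f : BaseAlg m U, srcDeriv (n := n) x v f = pointDeriv x w (pull (srcMap n m U) f) := by
  obtain ⟨w, hw⟩ := exists_dRel_eq_pointDeriv (n := n) x v
  exact ⟨w, fun f => hw _⟩

lemma bddReal_srcDeriv (x : arrowOpens U) (v : TangentSpace (𝓡 m) x.1.2) :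
    BddReal (srcDeriv (n := n) x v) := by
  obtain ⟨w, hw⟩ := exists_srcDeriv_eq (n := n) x v
  have := (bddReal_pointDeriv x w).comp (bddMap_pull (srcMap n m U))
  simpa only [← hw] using this

/-- The functional `f₀ ⊗ f₁ ⊗ ⋯ ⊗ fₖ ↦ f₀(x) df₁(v₁) ⋯ dfₖ(vₖ)`. -/
def derivFunctional (x : arrowOpens U) (v : Fin k → TangentSpace (𝓡 m) x.1.2) :
    Chains n m k U →ₗ[ℝ] ℝ :=
  prodFunctional (evalAt x) (fun j => srcDeriv (n := n) x (v j)) (bddReal_evalAt x)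
    fun j => bddReal_srcDeriv x (v j)

lemma derivFunctional_pureTensor (x : arrowOpens U) (v : Fin k → TangentSpace (𝓡 m) x.1.2)
    (s : ConvAlg n m U × (Fin k → BaseAlg m U)) :
    derivFunctional x v (pureTensor s) = s.1 x * ∏ j, srcDeriv (n := n) x (v j) (s.2 j) :=
  prodFunctional_pureTensor _ _ s

lemma isBddFunctional_derivFunctional (x : arrowOpens U)
    (v : Fin k → TangentSpace (𝓡 m) x.1.2) :
    IsBddFunctional (derivFunctional (n := n) x v) :=
  isBddFunctional_prodFunctional _ _

lemma prod_srcDeriv (x : arrowOpens U) (f : Fin k → BaseAlg m U)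
    (v : Fin k → TangentSpace (𝓡 m) x.1.2) : ∏ j, srcDeriv (n := n) x (v j) (f j) =
      (MultilinearMap.mkPiAlgebra ℝ (Fin k) ℝ).compLinearMap
        (fun j => (srcDeriv (n := n) x).flip (f j)) v := by
  simp

/-- The functionals `derivFunctional x v` of a chain, as a multilinear map in `v`. -/
def derivMultilinear (x : arrowOpens U) (c : Chains n m k U) :
    MultilinearMap ℝ (fun _ : Fin k => TangentSpace (𝓡 m) x.1.2) ℝ :=
  MultilinearMap.mk' (fun v => derivFunctional x v c)
    (fun v i a b => by
      -- Additivity in a vector is clear on pure tensors and extends to every chain because both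
      -- sides are bounded functionals of the chain.
      have h : derivFunctional (n := n) x (Function.update v i (a + b)) =
          derivFunctional x (Function.update v i a) + derivFunctional x (Function.update v i b) := by
        refine (isBddFunctional_derivFunctional x _).ext
          ((isBddFunctional_derivFunctional x _).add (isBddFunctional_derivFunctional x _))
          fun s => ?_
        simp only [LinearMap.add_apply, derivFunctional_pureTensor, prod_srcDeriv,
          MultilinearMap.map_update_add, mul_add]
      exact LinearMap.congr_fun h c)
    (fun v i r a => by
      have h : derivFunctional (n := n) x (Function.update v i (r • a)) =
          r • derivFunctional x (Function.update v i a) := by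
        refine (isBddFunctional_derivFunctional x _).ext
          ((isBddFunctional_derivFunctional x _).smul r) fun s => ?_
        simp only [LinearMap.smul_apply, derivFunctional_pureTensor, prod_srcDeriv,
          MultilinearMap.map_update_smul, smul_eq_mul]
        ring
      exact LinearMap.congr_fun h c)

lemma derivMultilinear_apply (x : arrowOpens U) (c : Chains n m k U)
    (v : Fin k → TangentSpace (𝓡 m) x.1.2) :
    derivMultilinear x c v = derivFunctional x v c := rfl

/-- The family of alternating forms `f₀ df₁ ∧ ⋯ ∧ dfₖ`, extended to completed tensors. -/
def formFamily (c : Chains n m k U) : FormFamily m (arrowOpens (G := G) U) k :=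
  fun x => MultilinearMap.alternatization (derivMultilinear x c)

lemma formFamily_apply (c : Chains n m k U) (x : arrowOpens U)
    (v : Fin k → TangentSpace (𝓡 m) x.1.2) :
    formFamily c x v = ∑ σ : Equiv.Perm (Fin k),
      ((Equiv.Perm.sign σ : ℤ) : ℝ) * derivFunctional x (fun j => v (σ j)) c := by
  rw [formFamily, MultilinearMap.alternatization_apply]
  refine Finset.sum_congr rfl fun σ _ => ?_
  rw [MultilinearMap.domDomCongr_apply, derivMultilinear_apply, Units.smul_def, zsmul_eq_mul]

/-- The functional `c ↦ formFamily c x v`. -/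
def formFunctional (x : arrowOpens U) (v : Fin k → TangentSpace (𝓡 m) x.1.2) :
    Chains n m k U →ₗ[ℝ] ℝ :=
  ∑ σ : Equiv.Perm (Fin k), ((Equiv.Perm.sign σ : ℤ) : ℝ) • derivFunctional x fun j => v (σ j)

lemma formFunctional_apply (x : arrowOpens U) (v : Fin k → TangentSpace (𝓡 m) x.1.2)
    (c : Chains n m k U) : formFunctional x v c = formFamily c x v := by
  rw [formFamily_apply]
  simp [formFunctional]

lemma isBddFunctional_formFunctional (x : arrowOpens U)
    (v : Fin k → TangentSpace (𝓡 m) x.1.2) :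
    IsBddFunctional (formFunctional (n := n) x v) :=
  IsBddFunctional.sum _ fun _ => (isBddFunctional_derivFunctional _ _).smul _

/-- The value of `f₀ df₁ ∧ ⋯ ∧ dfₖ` at `x` on tangent vectors `v`. -/
def pureFormValue (s : ConvAlg n m U × (Fin k → BaseAlg m U)) (x : arrowOpens U)
    (v : Fin k → TangentSpace (𝓡 m) x.1.2) : ℝ :=
  s.1 x * ∑ σ : Equiv.Perm (Fin k), ((Equiv.Perm.sign σ : ℤ) : ℝ) *
    ∏ j, srcDeriv (n := n) x (v (σ j)) (s.2 j)

lemma formFamily_pureTensor (s : ConvAlg n m U × (Fin k → BaseAlg m U)) (x : arrowOpens U)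
    (v : Fin k → TangentSpace (𝓡 m) x.1.2) :
    formFamily (pureTensor s) x v = pureFormValue s x v := by
  rw [formFamily_apply, pureFormValue, Finset.mul_sum]
  refine Finset.sum_congr rfl fun σ _ => ?_
  rw [derivFunctional_pureTensor]
  ring

lemma pureFormValue_eq (s : ConvAlg n m U × (Fin k → BaseAlg m U)) (x : arrowOpens U)
    (v : Fin k → TangentSpace (𝓡 m) x.1.2) :
    pureFormValue s x v =
      (s.1 x • wedgeCovectors fun i => dRel m (pull (srcMap n m U) (s.2 i)) x) v := by
  rw [AlternatingMap.smul_apply, wedgeCovectors_apply, Matrix.det_apply, pureFormValue,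
    smul_eq_mul]
  congr 1
  refine Finset.sum_congr rfl fun σ _ => ?_
  rw [Units.smul_def, zsmul_eq_mul]
  rfl

/-- Each permutation contributes an absolutely convergent series, so the finite alternating sum may
be moved inside the series over pure tensors. -/
lemma formFamily_mk (c : BddL1 (ConvAlg n m U × (Fin k → BaseAlg m U))) (x : arrowOpens U)
    (v : Fin k → TangentSpace (𝓡 m) x.1.2) :
    formFamily (Submodule.Quotient.mk c) x v = ∑' s, c.1 s * pureFormValue s x v := by
  have h : ∀ σ : Equiv.Perm (Fin k), Summable fun s : ConvAlg n m U × (Fin k → BaseAlg m U) =>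
      ((Equiv.Perm.sign σ : ℤ) : ℝ) *
        (c.1 s * (evalAt x s.1 * ∏ j, srcDeriv (n := n) x (v (σ j)) (s.2 j))) := fun σ =>
    (summable_mul_of_bddReal (bddReal_prodFunctional (bddReal_evalAt x)
      fun j => bddReal_srcDeriv (n := n) x (v (σ j))) c).mul_left _
  rw [formFamily_apply]
  simp only [derivFunctional, prodFunctional_mk, ← tsum_mul_left]
  rw [← Summable.tsum_finsetSum fun σ _ => h σ]
  refine tsum_congr fun s => ?_
  rw [pureFormValue, Finset.mul_sum, Finset.mul_sum]
  refine Finset.sum_congr rfl fun σ _ => ?_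
  rw [evalAt_apply]
  ring

/-- The coefficient of `f₀ df₁ ∧ ⋯ ∧ dfₖ` in the chart centred at `x₀`. -/
def pureCoeff (s : ConvAlg n m U × (Fin k → BaseAlg m U)) (x₀ : arrowOpens (G := G) U)
    (v : Fin k → EuclideanSpace ℝ (Fin m))
    (y : EuclideanSpace ℝ (Fin n) × EuclideanSpace ℝ (Fin m)) : ℝ :=
  (s.1 ∘ (extChartAt ((𝓡 n).prod (𝓡 m)) x₀).symm) y *
    ∑ σ : Equiv.Perm (Fin k), ((Equiv.Perm.sign σ : ℤ) : ℝ) * ∏ j, fderiv ℝ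
      (pull (srcMap n m U) (s.2 j) ∘ (extChartAt ((𝓡 n).prod (𝓡 m)) x₀).symm) y (0, v (σ j))

lemma formCoeff_formFamily_mk (c : BddL1 (ConvAlg n m U × (Fin k → BaseAlg m U)))
    (x₀ : arrowOpens (G := G) U) (v : Fin k → EuclideanSpace ℝ (Fin m))
    {y : EuclideanSpace ℝ (Fin n) × EuclideanSpace ℝ (Fin m)}
    (hy : y ∈ (extChartAt ((𝓡 n).prod (𝓡 m)) x₀).target) :
    (formCoeff (formFamily (Submodule.Quotient.mk c)) x₀ v ∘
      (extChartAt ((𝓡 n).prod (𝓡 m)) x₀).symm) y = ∑' s, c.1 s * pureCoeff s x₀ v y := by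
  rw [Function.comp_apply, formCoeff, formFamily_mk]
  refine tsum_congr fun s => ?_
  congr 1
  rw [pureFormValue, pureCoeff]
  congr 1
  refine Finset.sum_congr rfl fun σ _ => ?_
  congr 1
  refine Finset.prod_congr rfl fun j _ => ?_
  rw [srcDeriv_apply, dRel_trivialization _ x₀ _ ((extChartAt ((𝓡 n).prod (𝓡 m)) x₀).map_target hy),
    (extChartAt ((𝓡 n).prod (𝓡 m)) x₀).right_inv hy]

/-- The coefficient is a polynomial in the functions and their first derivatives, and smooth
families are closed under these operations. -/
lemma smoothFamily_pureCoeff {D : Set (ConvAlg n m U × (Fin k → BaseAlg m U))}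
    (hD : Bornology.IsBounded D) (x₀ : arrowOpens (G := G) U)
    (v : Fin k → EuclideanSpace ℝ (Fin m)) :
    SmoothFamily (fun s : D => pureCoeff s.1 x₀ v) (extChartAt ((𝓡 n).prod (𝓡 m)) x₀ x₀) := by
  refine SmoothFamily.mul (smoothFamily_chart (f := fun s : D => s.1.1) ?_ x₀)
    (SmoothFamily.sum _ fun σ => (smoothFamily_const _).mul (SmoothFamily.prod _ fun j =>
      (smoothFamily_chart (f := fun s : D => pull (srcMap n m U) (s.1.2 j)) ?_ x₀).fderiv_apply _))
  · exact hD.image_fst.subset (by rintro _ ⟨s, rfl⟩; exact mem_image_of_mem _ s.2)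
  · refine ((bddMap_pull (srcMap n m U)).comp (bddMap_snd_eval j) D hD).subset ?_
    rintro _ ⟨s, rfl⟩
    exact ⟨s.1, s.2, rfl⟩

/-- Uniform bounds for the coefficients of the forms defined by bounded sets of tensors. -/
lemma formCoeff_bounded {D : Set (ConvAlg n m U × (Fin k → BaseAlg m U))}
    (hD : Bornology.IsBounded D) (x₀ : arrowOpens (G := G) U)
    (v : Fin k → EuclideanSpace ℝ (Fin m)) (r : ℕ) :
    ∃ C : ℝ, ∀ᶠ y in 𝓝 (extChartAt ((𝓡 n).prod (𝓡 m)) x₀ x₀),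
      ∀ c : BddL1 (ConvAlg n m U × (Fin k → BaseAlg m U)), Function.support c.1 ⊆ D →
        ContDiffAt ℝ r (formCoeff (formFamily (Submodule.Quotient.mk c)) x₀ v ∘
          (extChartAt ((𝓡 n).prod (𝓡 m)) x₀).symm) y ∧
        ‖iteratedFDeriv ℝ r (formCoeff (formFamily (Submodule.Quotient.mk c)) x₀ v ∘
          (extChartAt ((𝓡 n).prod (𝓡 m)) x₀).symm) y‖ ≤ (∑' s, |c.1 s|) * C := by
  obtain ⟨C, hC⟩ := (smoothFamily_pureCoeff hD x₀ v).tsum_bounded r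
  refine ⟨C, ?_⟩
  filter_upwards [hC, extChartAt_target_mem_nhds (I := (𝓡 n).prod (𝓡 m)) x₀] with y hy hyt c hc
  -- Terms outside `D` vanish, so the series runs over the bounded set `D`, on which the
  -- coefficients form a smooth family.
  have heq : (formCoeff (formFamily (Submodule.Quotient.mk c)) x₀ v ∘
      (extChartAt ((𝓡 n).prod (𝓡 m)) x₀).symm) =ᶠ[𝓝 y]
      fun y => ∑' s : D, c.1 s.1 * pureCoeff s.1 x₀ v y := by
    filter_upwards [(isOpen_extChartAt_target (I := (𝓡 n).prod (𝓡 m)) x₀).mem_nhds hyt] with z hz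
    rw [formCoeff_formFamily_mk c x₀ v hz]
    exact (tsum_subtype_eq_of_support_subset fun s hs =>
      hc fun h0 => hs (by rw [h0, zero_mul])).symm
  have habs : ∑' s : D, |c.1 s.1| = ∑' s, |c.1 s| :=
    tsum_subtype_eq_of_support_subset (f := fun s => |c.1 s|) fun s hs =>
      hc fun h0 => hs (by simp [h0])
  obtain ⟨h1, h2⟩ := hy (fun s => c.1 s.1) (c.2.1.comp_injective Subtype.val_injective)
  refine ⟨h1.congr_of_eventuallyEq heq, ?_⟩
  rw [(heq.iteratedFDeriv ℝ r).self_of_nhds, ← habs]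
  exact h2

/-- The neighbourhood with uniform bounds shrinks with the order `r`. This is harmless: being smooth
at `x₀` only means being of class `C^r` there for each finite `r`. -/
lemma formFamily_mem_relForm (c : Chains n m k U) :
    formFamily c ∈ RelForm n m (arrowOpens (G := G) U) k := by
  intro x₀ v
  obtain ⟨c, rfl⟩ := Submodule.Quotient.mk_surjective _ c
  rw [contMDiffAt_iff_source, ((𝓡 n).prod (𝓡 m)).range_eq_univ, contMDiffWithinAt_univ,
    contMDiffAt_iff_contDiffAt, contDiffAt_infty]
  intro r
  obtain ⟨C, hC⟩ := formCoeff_bounded c.2.2 x₀ v r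
  exact (hC.self_of_nhds c Subset.rfl).1

variable (n m k U) in
/-- The map `f₀ ⊗ f₁ ⊗ ⋯ ⊗ fₖ ↦ f₀ d(s^* f₁) ∧ ⋯ ∧ d(s^* fₖ)`. -/
def formMap : Chains n m k U →ₗ[ℝ] RelForm n m (arrowOpens (G := G) U) k where
  toFun c := ⟨formFamily c, formFamily_mem_relForm c⟩
  map_add' c d := Subtype.ext (funext fun x => AlternatingMap.ext fun v => by
    change formFamily (c + d) x v = formFamily c x v + formFamily d x v
    simp only [← formFunctional_apply, map_add])
  map_smul' r c := Subtype.ext (funext fun x => AlternatingMap.ext fun v => by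
    change formFamily (r • c) x v = r • formFamily c x v
    simp only [← formFunctional_apply, map_smul])

lemma formMap_val (c : Chains n m k U) : (formMap n m k U c).1 = formFamily c := rfl

lemma isFormMap_formMap : IsFormMap n m k U (formMap n m k U) where
  bounded := by
    rintro S ⟨D, C, hD, hS⟩ x₀ v r
    obtain ⟨K, hK⟩ := formCoeff_bounded hD x₀ v r
    refine ⟨C * |K|, hK.mono ?_⟩
    rintro y hy _ ⟨s, hs, rfl⟩
    obtain ⟨c, rfl, hc, hC⟩ := hS s hs
    refine (hy c hc).2.trans ((mul_le_mul_of_nonneg_left (le_abs_self K)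
      (tsum_nonneg fun _ => abs_nonneg _)).trans (mul_le_mul_of_nonneg_right hC (abs_nonneg _)))
  pure f₀ f x := AlternatingMap.ext fun v => by
    rw [formMap_val, formFamily_pureTensor, pureFormValue_eq]

variable (n) in
/-- Evaluation of relative forms. -/
def evalForm {W : Opens (G × M)} (x : W) (v : Fin k → TangentSpace (𝓡 m) x.1.2) :
    RelForm n m W k →ₗ[ℝ] ℝ where
  toFun τ := τ.1 x v
  map_add' _ _ := rfl
  map_smul' _ _ := rfl

/-- The value at `x` is a coefficient at the centre of the chart at `x`, for constant vectors
representing `v`, so the order-zero bound suffices. Through this, boundedness of Ψ forces its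
uniqueness. -/
lemma isBddFunctional_evalForm {Ψ : Chains n m k U →ₗ[ℝ] RelForm n m (arrowOpens (G := G) U) k}
    (hΨ : IsFormMap n m k U Ψ) (x : arrowOpens (G := G) U)
    (v : Fin k → TangentSpace (𝓡 m) x.1.2) : IsBddFunctional (evalForm n x v ∘ₗ Ψ) := by
  intro S hS
  choose w hw using fun i => exists_trivialization_symm x.1.2 (v i)
  obtain ⟨C, hC⟩ := hΨ.bounded S hS x w 0
  refine ⟨C, fun s hs => ?_⟩
  have h := hC.self_of_nhds (Ψ s) (mem_image_of_mem _ hs)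
  rw [norm_iteratedFDeriv_zero, Function.comp_apply, extChartAt_to_inv, formCoeff] at h
  simp only [hw] at h
  exact h

lemma IsFormMap.unique {Ψ Ψ' : Chains n m k U →ₗ[ℝ] RelForm n m (arrowOpens (G := G) U) k}
    (hΨ : IsFormMap n m k U Ψ) (hΨ' : IsFormMap n m k U Ψ') : Ψ = Ψ' := by
  refine LinearMap.ext fun c => Subtype.ext (funext fun x => AlternatingMap.ext fun v => ?_)
  have h := (isBddFunctional_evalForm hΨ x v).ext (isBddFunctional_evalForm hΨ' x v) fun s => by
    change (Ψ (pureTensor s)).1 x v = (Ψ' (pureTensor s)).1 x v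
    rw [hΨ.pure s.1 s.2, hΨ'.pure s.1 s.2]
  exact LinearMap.congr_fun h c

lemma formMap_chainSmul (φ : BaseAlg m U) (c : Chains n m k U) (x : arrowOpens (G := G) U) :
    (formMap n m k U (chainSmul n m k U φ c)).1 x =
      φ (srcMap n m U x) • (formMap n m k U c).1 x := by
  refine AlternatingMap.ext fun v => ?_
  have h := ((isBddFunctional_formFunctional (n := n) x v).comp_tensorMap
    (isTensorMap_mul (pull (srcMap n m U) φ) k)).ext
    ((isBddFunctional_formFunctional x v).smul (φ (srcMap n m U x))) fun s => by
      rw [LinearMap.comp_apply, tensorMap_pureTensor, LinearMap.smul_apply, formFunctional_apply,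
        formFunctional_apply, formFamily_pureTensor, formFamily_pureTensor, pureFormValue,
        pureFormValue, smul_eq_mul, ← mul_assoc]
      rfl
  have h' := LinearMap.congr_fun h c
  rw [LinearMap.smul_apply, LinearMap.comp_apply, formFunctional_apply, formFunctional_apply] at h'
  exact h'

end FormMap

/-! ### Boundaries and cycles at points of the loop space -/

section Cycles

lemma IsBddFunctional.comp_hochschildB {A B : Type u} [CommRing A] [Algebra ℝ A] [CommRing B]
    [Algebra ℝ B] [Bornology A] [Bornology B] [BddMul A] [BddMul B] {s t : B →ₐ[ℝ] A}
    (hs : BddMap s) (ht : BddMap t) {k : ℕ} {l : CompletedTensor A B k →ₗ[ℝ] ℝ}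
    (h : IsBddFunctional l) : IsBddFunctional (l ∘ₗ hochschildB s t hs ht k) := by
  have heq : l ∘ₗ hochschildB s t hs ht k =
      ∑ i : Fin (k + 2), (-1 : ℝ) ^ (i : ℕ) • (l ∘ₗ faceMap s t hs ht k i) := by
    refine LinearMap.ext fun c => ?_
    simp [hochschildB]
  rw [heq]
  exact IsBddFunctional.sum _ fun i => (h.comp_tensorMap _).smul _

variable {n m : ℕ} {G M : Type} [TopologicalSpace G] [ChartedSpace (EuclideanSpace ℝ (Fin n)) G]
  [Group G] [LieGroup (𝓡 n) ∞ G] [TopologicalSpace M] [ChartedSpace (EuclideanSpace ℝ (Fin m)) M]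
  [IsManifold (𝓡 m) ∞ M] [MulAction G M] [ContMDiffSMul (𝓡 n) (𝓡 m) ∞ G M]
  {k : ℕ} {U : Opens (orbitSpace G M)}

lemma srcDeriv_mul (x : arrowOpens U) (v : TangentSpace (𝓡 m) x.1.2) (f g : BaseAlg m U) :
    srcDeriv (n := n) x v (f * g) = f (srcMap n m U x) * srcDeriv (n := n) x v g +
      srcDeriv (n := n) x v f * g (srcMap n m U x) := by
  obtain ⟨w, hw⟩ := exists_srcDeriv_eq (n := n) x v
  simp only [hw, map_mul, pointDeriv_mul, pull_apply]

lemma pull_tgtMap_of_loop {x : arrowOpens U} (hx : x.1.1 • x.1.2 = x.1.2) (f : BaseAlg m U) :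
    pull (tgtMap n m U) f x = f (srcMap n m U x) := by
  rw [pull_apply]
  exact congrArg f (Subtype.ext hx)

/-- At a loop point left and right multiplication have the same effect on the value at `x`, and the
other factors are derivations, so both error terms vanish and the telescoping leaves nothing.
Antisymmetrisation in `v` plays no role. -/
lemma derivFunctional_chainBoundary {x : arrowOpens U} (hx : x.1.1 • x.1.2 = x.1.2)
    (v : Fin k → TangentSpace (𝓡 m) x.1.2) (c : Chains n m (k + 1) U) :
    derivFunctional x v (chainBoundary n m k U c) = 0 := by
  have h := ((isBddFunctional_derivFunctional (n := n) x v).comp_hochschildB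
    (bddMap_pull (srcMap n m U)) (bddMap_pull (tgtMap n m U))).eq_zero fun s => by
      rw [LinearMap.comp_apply, derivFunctional, prodFunctional_hochschildB (ε := fun f =>
        f (srcMap n m U x)) (θ := fun _ _ => 0) (R := fun _ _ _ => 0)]
      · simp
      · intro a f
        simp only [evalAt_apply, ContMDiffMap.coe_mul, Pi.mul_apply, pull_apply]
        ring
      · intro a f
        simp only [evalAt_apply, ContMDiffMap.coe_mul, Pi.mul_apply, pull_tgtMap_of_loop hx]
        ring
      · intro j f g
        rw [srcDeriv_mul, add_zero]
  exact LinearMap.congr_fun h c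

lemma formFamily_chainBoundary {x : arrowOpens U} (hx : x.1.1 • x.1.2 = x.1.2)
    (c : Chains n m (k + 1) U) : formFamily (chainBoundary n m k U c) x = 0 :=
  AlternatingMap.ext fun v => by
    simp [formFamily_apply, derivFunctional_chainBoundary hx]

/-- Exchanging adjacent arguments changes the sign of `derivFunctional` on cycles. -/
lemma derivFunctional_swap {x : arrowOpens U} (hx : x.1.1 • x.1.2 = x.1.2)
    (v : Fin (k + 1) → TangentSpace (𝓡 m) x.1.2) (i : Fin k) {c : Chains n m (k + 1) U}
    (hc : chainBoundary n m k U c = 0) :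
    derivFunctional x (fun j => v (Equiv.swap i.castSucc i.succ j)) c =
      - derivFunctional x v c := by
  obtain ⟨w, hw⟩ := exists_srcDeriv_eq (n := n) x (v i.castSucc)
  obtain ⟨w', hw'⟩ := exists_srcDeriv_eq (n := n) x (v i.succ)
  -- The boundary is tested with a second derivative along the two adjacent vectors in slot `i` and
  -- first derivatives along the remaining vectors elsewhere. The Leibniz error in slot `i` is the
  -- sum over the two orders of the adjacent vectors, so the test yields, up to sign,
  -- `derivFunctional` for `v` plus that for the swapped tuple.
  let β : Fin k → BaseAlg m U →ₗ[ℝ] ℝ := fun j =>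
    if j = i then secondDeriv x w w' ∘ₗ (pull (srcMap n m U)).toLinearMap
    else srcDeriv (n := n) x (v (i.castSucc.succAbove j))
  have hβi : β i = secondDeriv x w w' ∘ₗ (pull (srcMap n m U)).toLinearMap := if_pos rfl
  have hβj : ∀ j ≠ i, β j = srcDeriv (n := n) x (v (i.castSucc.succAbove j)) :=
    fun j hj => if_neg hj
  have hβ : ∀ j, BddReal (β j) := fun j => by
    by_cases hj : j = i
    · rw [hj, hβi]
      exact (bddReal_secondDeriv x w w').comp (bddMap_pull (srcMap n m U))
    · rw [hβj j hj]
      exact bddReal_srcDeriv x _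
  have hprod : ∀ (u : Fin (k + 1) → TangentSpace (𝓡 m) x.1.2) (f : Fin (k + 1) → BaseAlg m U),
      (∏ j, srcDeriv (n := n) x (u j) (f j)) = srcDeriv (n := n) x (u i.castSucc) (f i.castSucc) *
        (srcDeriv (n := n) x (u i.succ) (f i.succ) * ∏ j ∈ Finset.univ.erase i,
          srcDeriv (n := n) x (u (i.castSucc.succAbove j)) (f (i.castSucc.succAbove j))) := by
    intro u f
    rw [Fin.prod_univ_succAbove _ i.castSucc, ← Finset.mul_prod_erase _ _ (Finset.mem_univ i),
      Fin.succAbove_castSucc_self]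
  have hswap : ∀ j ∈ Finset.univ.erase i, Equiv.swap i.castSucc i.succ (i.castSucc.succAbove j) =
      i.castSucc.succAbove j := fun j hj => by
    refine Equiv.swap_apply_of_ne_of_ne (Fin.succAbove_ne _ _) fun h => ?_
    rw [← Fin.succAbove_castSucc_self] at h
    exact Finset.ne_of_mem_erase hj (Fin.succAbove_right_injective h)
  have h : prodFunctional (evalAt x) β (bddReal_evalAt x) hβ ∘ₗ chainBoundary n m k U =
      (-1 : ℝ) ^ ((i : ℕ) + 1) • (derivFunctional x (fun j => v (Equiv.swap i.castSucc i.succ j)) +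
        derivFunctional x v) := by
    refine ((isBddFunctional_prodFunctional _ _).comp_hochschildB _ _).ext
      (((isBddFunctional_derivFunctional x _).add (isBddFunctional_derivFunctional x _)).smul _)
      fun s => ?_
    rw [LinearMap.comp_apply, prodFunctional_hochschildB (ε := fun f =>
      f (srcMap n m U x)) (θ := fun _ _ => 0) (R := fun j f g => if j = i then
        srcDeriv (n := n) x (v i.castSucc) f * srcDeriv (n := n) x (v i.succ) g +
          srcDeriv (n := n) x (v i.succ) f * srcDeriv (n := n) x (v i.castSucc) g else 0)]
    · rw [Finset.sum_eq_single i (fun j _ hj => by simp [hj]) (by simp)]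
      have h1 : ∏ j ∈ Finset.univ.erase i, β j (s.2 (i.castSucc.succAbove j)) =
          ∏ j ∈ Finset.univ.erase i, srcDeriv (n := n) x (v (i.castSucc.succAbove j))
            (s.2 (i.castSucc.succAbove j)) :=
        Finset.prod_congr rfl fun j hj => by rw [hβj j (Finset.ne_of_mem_erase hj)]
      have h2 : ∏ j ∈ Finset.univ.erase i, srcDeriv (n := n) x
            (v (Equiv.swap i.castSucc i.succ (i.castSucc.succAbove j)))
            (s.2 (i.castSucc.succAbove j)) =
          ∏ j ∈ Finset.univ.erase i, srcDeriv (n := n) x (v (i.castSucc.succAbove j))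
            (s.2 (i.castSucc.succAbove j)) :=
        Finset.prod_congr rfl fun j hj => by rw [hswap j hj]
      rw [if_pos rfl, h1, LinearMap.smul_apply, LinearMap.add_apply, derivFunctional_pureTensor,
        derivFunctional_pureTensor, hprod v,
        hprod fun j => v (Equiv.swap i.castSucc i.succ j), h2, Equiv.swap_apply_left,
        Equiv.swap_apply_right, evalAt_apply, smul_eq_mul]
      ring
    · intro a f
      simp only [evalAt_apply, ContMDiffMap.coe_mul, Pi.mul_apply, pull_apply]
      ring
    · intro a f
      simp only [evalAt_apply, ContMDiffMap.coe_mul, Pi.mul_apply, pull_tgtMap_of_loop hx]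
      ring
    · intro j f g
      by_cases hj : j = i
      · subst hj
        rw [if_pos rfl, hβi]
        simp only [LinearMap.comp_apply, AlgHom.toLinearMap_apply, map_mul, secondDeriv_mul,
          pull_apply, hw, hw']
      · rw [if_neg hj, hβj j hj, srcDeriv_mul, add_zero]
  have h' := LinearMap.congr_fun h c
  rw [LinearMap.comp_apply, hc, map_zero, LinearMap.smul_apply, LinearMap.add_apply,
    smul_eq_mul, eq_comm, mul_eq_zero] at h'
  exact eq_neg_of_add_eq_zero_left (h'.resolve_left (pow_ne_zero _ (by norm_num)))

variable (n m) in
/-- The map `h ↦ (h g, p)` for `x = (g, p)`. -/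
def orbitArrow (x : arrowOpens (G := G) U) :
    C^∞⟮𝓡 n, G; (𝓡 n).prod (𝓡 m), arrowOpens (G := G) U⟯ :=
  ⟨fun h => ⟨(h * x.1.1, x.1.2), x.2⟩, (ContMDiff.subtypeVal_comp_iff _ _).1
    ((contMDiff_mul_right (I := 𝓡 n) (a := x.1.1)).prodMk contMDiff_const)⟩

/-- The target of the arrow (hg, p) is hgp = hp because gp = p. Differentiating t^*f in h at the
identity hence differentiates f along the orbit of p. -/
lemma pointDeriv_orbitArrow_tgtMap {x : arrowOpens U} (hx : x.1.1 • x.1.2 = x.1.2)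
    (η : EuclideanSpace ℝ (Fin n)) (f : BaseAlg m U) :
    pointDeriv (I := 𝓡 n) (1 : G) η (pull (orbitArrow n m x) (pull (tgtMap n m U) f)) =
      srcDeriv (n := n) x (mfderiv (𝓡 n) (𝓡 m) (fun g : G => g • x.1.2) (1 : G) η) f := by
  set F : M → ℝ := Function.extend Subtype.val f 0 with hF
  have hsrc : (fun q : M => Function.extend Subtype.val (pull (srcMap n m U) f) 0 (x.1.1, q)) = F := by
    funext q
    by_cases hq : q ∈ baseOpens U
    · have e1 := Subtype.val_injective.extend_apply (pull (srcMap n m U) f) 0 ⟨(x.1.1, q), hq⟩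
      have e2 := Subtype.val_injective.extend_apply f 0 ⟨q, hq⟩
      exact e1.trans e2.symm
    · have e1 : ¬ ∃ a : arrowOpens (G := G) U, a.1 = (x.1.1, q) := fun ⟨a, ha⟩ => hq <| by
        have := a.2
        rw [ha] at this
        exact this
      have e2 : ¬ ∃ a : baseOpens U, a.1 = q := fun ⟨a, ha⟩ => hq (ha ▸ a.2)
      rw [hF, Function.extend_apply' _ _ _ e1, Function.extend_apply' _ _ _ e2]
      rfl
  have htgt : ((pull (orbitArrow n m x) (pull (tgtMap n m U) f) : C^∞⟮𝓡 n, G; 𝓘(ℝ), ℝ⟯) : G → ℝ) =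
      F ∘ fun g : G => g • x.1.2 := by
    funext h
    have e2 := Subtype.val_injective.extend_apply f 0
      (tgtMap n m U (orbitArrow n m x h))
    refine e2.symm.trans (congrArg F ?_)
    change (h * x.1.1) • x.1.2 = h • x.1.2
    rw [mul_smul, hx]
  have hFd : HasMFDerivAt (𝓡 m) 𝓘(ℝ) F ((1 : G) • x.1.2) (mfderiv (𝓡 m) 𝓘(ℝ) F x.1.2) := by
    rw [one_smul]
    exact ((contMDiffAt_extend f (srcMap n m U x)).mdifferentiableAt (by simp)).hasMFDerivAt
  have hGd : HasMFDerivAt (𝓡 n) (𝓡 m) (fun g : G => g • x.1.2) (1 : G)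
      (mfderiv (𝓡 n) (𝓡 m) (fun g : G => g • x.1.2) (1 : G)) := by
    have h1 : ContMDiff (𝓡 n) (𝓡 m) ∞ (fun g : G => g • x.1.2) :=
      (ContMDiffSMul.contMDiff_smul (I := 𝓡 n) (I' := 𝓡 m) (n := ∞)).comp
        (contMDiff_id.prodMk contMDiff_const)
    exact (h1.contMDiffAt.mdifferentiableAt (by simp)).hasMFDerivAt
  have hs : ∀ w : TangentSpace (𝓡 m) x.1.2, srcDeriv (n := n) x w f =
      (mfderiv (𝓡 m) 𝓘(ℝ) F x.1.2 : EuclideanSpace ℝ (Fin m) →L[ℝ] ℝ) w := fun w => by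
    rw [srcDeriv_apply, dRel, hsrc]
    rfl
  rw [pointDeriv_eq_mfderiv, htgt, (hFd.comp (1 : G) hGd).mfderiv]
  exact (hs _).symm

/-- `derivFunctional` vanishes on cycles if the last argument is tangent to the orbit. -/
lemma derivFunctional_orbit_last {x : arrowOpens U} (hx : x.1.1 • x.1.2 = x.1.2)
    (v : Fin (k + 1) → TangentSpace (𝓡 m) x.1.2)
    (hv : v (Fin.last k) ∈ orbitTangent n m (G := G) x.1.2) {c : Chains n m (k + 1) U}
    (hc : chainBoundary n m k U c = 0) : derivFunctional x v c = 0 := by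
  obtain ⟨(η : EuclideanSpace ℝ (Fin n)), hη⟩ := hv
  -- This derivation at `x` moves only the group coordinate. It kills pull-backs along the source,
  -- so the first face has no error, and it sends pull-backs along the target to the derivative in
  -- the orbit direction, so the last face has the error `θ`, which supplies the missing last
  -- factor.
  let α : ConvAlg n m U →ₗ[ℝ] ℝ :=
    pointDeriv (I := 𝓡 n) (1 : G) η ∘ₗ (pull (orbitArrow n m x)).toLinearMap
  have hα : BddReal α := (bddReal_pointDeriv (I := 𝓡 n) (1 : G) η).comp
    (bddMap_pull (orbitArrow n m x))
  have hαmul : ∀ a a', α (a * a') = a x * α a' + α a * a' x := fun a a' => by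
    have h1 : orbitArrow n m x 1 = x := Subtype.ext (Prod.ext (one_mul _) rfl)
    simp only [α, LinearMap.comp_apply, AlgHom.toLinearMap_apply, map_mul, pointDeriv_mul,
      pull_apply, h1]
  have hαs : ∀ f, α (pull (srcMap n m U) f) = 0 := fun f => by
    have h1 : pull (orbitArrow n m x) (pull (srcMap n m U) f) =
        f (srcMap n m U x) • (1 : C^∞⟮𝓡 n, G; 𝓘(ℝ), ℝ⟯) := by
      ext h
      simp only [pull_apply, ContMDiffMap.coe_smul, ContMDiffMap.coe_one, Pi.smul_apply,
        Pi.one_apply, smul_eq_mul, mul_one]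
      rfl
    have h2 : pointDeriv (I := 𝓡 n) (1 : G) η (1 : C^∞⟮𝓡 n, G; 𝓘(ℝ), ℝ⟯) = 0 := by
      have := pointDeriv_mul (I := 𝓡 n) (1 : G) η 1 1
      simpa using this
    simp only [α, LinearMap.comp_apply, AlgHom.toLinearMap_apply, h1, map_smul, h2, smul_zero]
  have hαt : ∀ f, α (pull (tgtMap n m U) f) = srcDeriv (n := n) x (v (Fin.last k)) f := fun f => by
    rw [← hη]
    exact pointDeriv_orbitArrow_tgtMap hx η f
  have h : prodFunctional α (fun j => srcDeriv (n := n) x (v j.castSucc)) hα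
      (fun j => bddReal_srcDeriv x _) ∘ₗ chainBoundary n m k U =
      (-1 : ℝ) ^ (k + 1) • derivFunctional x v := by
    refine ((isBddFunctional_prodFunctional _ _).comp_hochschildB _ _).ext
      ((isBddFunctional_derivFunctional x _).smul _) fun s => ?_
    rw [LinearMap.comp_apply, prodFunctional_hochschildB (ε := fun f =>
      f (srcMap n m U x)) (θ := fun a f => a x * srcDeriv (n := n) x (v (Fin.last k)) f)
      (R := fun _ _ _ => 0)]
    · rw [LinearMap.smul_apply, derivFunctional_pureTensor, Fin.prod_univ_castSucc]
      simp only [zero_mul, mul_zero, Finset.sum_const_zero, smul_eq_mul]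
      ring
    · intro a f
      rw [hαmul, hαs, pull_apply]
      ring
    · intro a f
      rw [hαmul, hαt, pull_tgtMap_of_loop hx]
      ring
    · intro j f g
      rw [srcDeriv_mul, add_zero]
  have h' := LinearMap.congr_fun h c
  rw [LinearMap.comp_apply, hc, map_zero, LinearMap.smul_apply, smul_eq_mul, eq_comm,
    mul_eq_zero] at h'
  exact h'.resolve_left (pow_ne_zero _ (by norm_num))

/-- An exchange with the next slot moves the orbit vector one place to the right at the cost of a
sign; hence the induction descends from the last index. -/
lemma derivFunctional_orbit {x : arrowOpens U} (hx : x.1.1 • x.1.2 = x.1.2)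
    {c : Chains n m (k + 1) U} (hc : chainBoundary n m k U c = 0) (i : Fin (k + 1)) :
    ∀ v : Fin (k + 1) → TangentSpace (𝓡 m) x.1.2,
      v i ∈ orbitTangent n m (G := G) x.1.2 → derivFunctional x v c = 0 := by
  induction i using Fin.reverseInduction with
  | last => exact fun v hv => derivFunctional_orbit_last hx v hv hc
  | cast i ih =>
    intro v hv
    rw [← neg_eq_zero, ← derivFunctional_swap hx v i hc]
    refine ih _ ?_
    simp only [Equiv.swap_apply_right]
    exact hv

/-- The form defined by a cycle is horizontal at the points of the loop space. -/
lemma formFamily_orbit {x : arrowOpens U} (hx : x.1.1 • x.1.2 = x.1.2)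
    {c : Chains n m (k + 1) U} (hc : chainBoundary n m k U c = 0)
    (v : Fin (k + 1) → TangentSpace (𝓡 m) x.1.2)
    (hv : ∃ i, v i ∈ orbitTangent n m (G := G) x.1.2) : formFamily c x v = 0 := by
  obtain ⟨i, hi⟩ := hv
  rw [formFamily_apply]
  refine Finset.sum_eq_zero fun σ _ => ?_
  rw [derivFunctional_orbit hx hc (σ.symm i) (fun j => v (σ j)) (by simpa using hi), mul_zero]

end Cycles

/-! ### Coordinate frames and the vanishing ideal -/

section LocalFrames

variable {n m : ℕ} {G M : Type} [TopologicalSpace G] [ChartedSpace (EuclideanSpace ℝ (Fin n)) G]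
  [TopologicalSpace M] [ChartedSpace (EuclideanSpace ℝ (Fin m)) M] [IsManifold (𝓡 n) ∞ G]
  [IsManifold (𝓡 m) ∞ M] {k : ℕ} {W : Opens (G × M)}

lemma mem_chartAt_source_of_prod {x₀ x : W}
    (hx : x ∈ (extChartAt ((𝓡 n).prod (𝓡 m)) x₀).source) :
    x.1.2 ∈ (chartAt (EuclideanSpace ℝ (Fin m)) x₀.1.2).source := by
  have h := mem_extChartAt_source_of_opens hx
  rw [extChartAt_prod] at h
  have h2 : x.1.2 ∈ (extChartAt (𝓡 m) x₀.1.2).source := h.2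
  rwa [extChartAt_source] at h2

/-- One-member families make the closure properties of `SmoothFamily` available for the smoothness
of a single form. -/
lemma contMDiffAt_of_smoothFamily {g : W → ℝ} {x₀ : W}
    {h : EuclideanSpace ℝ (Fin n) × EuclideanSpace ℝ (Fin m) → ℝ}
    (hh : SmoothFamily (fun _ : Unit => h) (extChartAt ((𝓡 n).prod (𝓡 m)) x₀ x₀))
    (heq : ∀ y ∈ (extChartAt ((𝓡 n).prod (𝓡 m)) x₀).target,
      g ((extChartAt ((𝓡 n).prod (𝓡 m)) x₀).symm y) = h y) :
    ContMDiffAt ((𝓡 n).prod (𝓡 m)) 𝓘(ℝ) ∞ g x₀ := by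
  rw [contMDiffAt_iff_source, ((𝓡 n).prod (𝓡 m)).range_eq_univ, contMDiffWithinAt_univ,
    contMDiffAt_iff_contDiffAt]
  exact (hh.contDiffAt.self_of_nhds ()).congr_of_eventuallyEq
    (Filter.eventuallyEq_of_mem (extChartAt_target_mem_nhds x₀) heq)

/-- The relative form `df₀ ∧ ⋯ ∧ dfₖ₋₁`. -/
def wedgeForm (f : Fin k → SmoothFun n m W) : RelForm n m W k :=
  ⟨fun x => wedgeCovectors fun j => dRel m (f j) x, fun x₀ v => by
    have hf : ∀ j, SmoothFamily (fun _ : Unit => f j ∘ (extChartAt ((𝓡 n).prod (𝓡 m)) x₀).symm)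
        (extChartAt ((𝓡 n).prod (𝓡 m)) x₀ x₀) := fun j =>
      smoothFamily_chart (f := fun _ : Unit => f j) (by
        rw [Set.range_const]; exact Bornology.isBounded_singleton) x₀
    refine contMDiffAt_of_smoothFamily (SmoothFamily.sum Finset.univ
      fun σ : Equiv.Perm (Fin k) => (smoothFamily_const ((Equiv.Perm.sign σ : ℤ) : ℝ)).mul
        (SmoothFamily.prod Finset.univ fun j => (hf j).fderiv_apply (0, v (σ j)))) fun y hy => ?_
    change wedgeCovectors (fun j => dRel m (f j) ((extChartAt ((𝓡 n).prod (𝓡 m)) x₀).symm y)) _ = _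
    rw [wedgeCovectors_apply, Matrix.det_apply]
    refine Finset.sum_congr rfl fun σ _ => ?_
    rw [Units.smul_def, zsmul_eq_mul]
    congr 1
    refine Finset.prod_congr rfl fun j _ => ?_
    rw [Matrix.of_apply, dRel_trivialization _ x₀ _
      ((extChartAt ((𝓡 n).prod (𝓡 m)) x₀).map_target hy),
      (extChartAt ((𝓡 n).prod (𝓡 m)) x₀).right_inv hy]⟩

/-- The product of a relative form with a smooth function. -/
def funMulForm (f : SmoothFun n m W) (τ : RelForm n m W k) : RelForm n m W k :=
  ⟨fun x => f x • τ.1 x, fun x₀ v => f.contMDiff.contMDiffAt.mul (τ.2 x₀ v)⟩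

/-- The coordinate functions along `M` in the chart centred at `x₀`. -/
def coordFun (x₀ : W) (hW : ∀ x : W, x ∈ (extChartAt ((𝓡 n).prod (𝓡 m)) x₀).source) (i : Fin m) :
    SmoothFun n m W :=
  ⟨fun x => (extChartAt ((𝓡 n).prod (𝓡 m)) x₀ x).2 i, fun x => by
    have h1 := contMDiffAt_extChartAt' (I := (𝓡 n).prod (𝓡 m)) (n := ∞) (x := x₀) (x' := x)
      (by simpa [extChartAt_source] using hW x)
    exact (((EuclideanSpace.proj i : EuclideanSpace ℝ (Fin m) →L[ℝ] ℝ).contDiff.comp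
      contDiff_snd).contMDiff.contMDiffAt).comp x h1⟩

lemma dRel_coordFun (x₀ : W) (hW : ∀ x : W, x ∈ (extChartAt ((𝓡 n).prod (𝓡 m)) x₀).source)
    (i : Fin m) (x : W) (w : EuclideanSpace ℝ (Fin m)) :
    dRel m (coordFun x₀ hW i) x ((trivializationAt (EuclideanSpace ℝ (Fin m))
      (TangentSpace (𝓡 m) : M → Type _) x₀.1.2).symm x.1.2 w) = w i := by
  rw [dRel_trivialization _ x₀ x (hW x)]
  have heq : coordFun x₀ hW i ∘ (extChartAt ((𝓡 n).prod (𝓡 m)) x₀).symm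
      =ᶠ[𝓝 (extChartAt ((𝓡 n).prod (𝓡 m)) x₀ x)]
      ((EuclideanSpace.proj i : EuclideanSpace ℝ (Fin m) →L[ℝ] ℝ).comp
        (ContinuousLinearMap.snd ℝ (EuclideanSpace ℝ (Fin n)) (EuclideanSpace ℝ (Fin m)))) := by
    filter_upwards [(isOpen_extChartAt_target x₀).mem_nhds
      ((extChartAt ((𝓡 n).prod (𝓡 m)) x₀).map_source (hW x))] with z hz
    have h := (extChartAt ((𝓡 n).prod (𝓡 m)) x₀).right_inv hz
    change (extChartAt ((𝓡 n).prod (𝓡 m)) x₀ ((extChartAt ((𝓡 n).prod (𝓡 m)) x₀).symm z)).2 i = z.2 i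
    rw [h]
  rw [heq.fderiv_eq, ContinuousLinearMap.fderiv]
  rfl

/-- The `i`-th standard basis vector. -/
def stdVec (i : Fin m) : EuclideanSpace ℝ (Fin m) := EuclideanSpace.basisFun (Fin m) ℝ i

/-- The sum runs over all index tuples rather than increasing ones, so that multilinearity alone is
used. -/
lemma formCoeff_expand (τ : FormFamily m W k) (x₀ x : W)
    (hx : x.1.2 ∈ (chartAt (EuclideanSpace ℝ (Fin m)) x₀.1.2).source)
    (w : Fin k → EuclideanSpace ℝ (Fin m)) : formCoeff τ x₀ w x =
      ∑ J : Fin k → Fin m, (∏ i, w i (J i)) * formCoeff τ x₀ (fun i => stdVec (J i)) x := by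
  let L := (trivializationAt (EuclideanSpace ℝ (Fin m)) (TangentSpace (𝓡 m) : M → Type _)
    x₀.1.2).symmL ℝ x.1.2
  have hc : ∀ u : Fin k → EuclideanSpace ℝ (Fin m), formCoeff τ x₀ u x =
      (τ x).toMultilinearMap.compLinearMap (fun _ => L.toLinearMap) u := fun u => by
    refine congrArg (τ x) (funext fun i => ?_)
    exact (Bundle.Trivialization.symmL_apply (R := ℝ) _ hx _).symm
  simp only [hc]
  have hw : w = fun i => ∑ j, w i j • stdVec j := funext fun i => by
    have := (EuclideanSpace.basisFun (Fin m) ℝ).sum_repr (w i)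
    simpa [stdVec] using this.symm
  conv_lhs => rw [hw]
  rw [MultilinearMap.map_sum]
  refine Finset.sum_congr rfl fun J _ => ?_
  rw [MultilinearMap.map_smul_univ, smul_eq_mul]

/-- The coefficients of a relative form in a chart are smooth. -/
lemma contMDiff_formCoeff (τ : RelForm n m W k) (x₀ : W)
    (hW : ∀ x : W, x ∈ (extChartAt ((𝓡 n).prod (𝓡 m)) x₀).source)
    (v : Fin k → EuclideanSpace ℝ (Fin m)) :
    ContMDiff ((𝓡 n).prod (𝓡 m)) 𝓘(ℝ) ∞ (formCoeff τ.1 x₀ v) := by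
  intro x₁
  let e := trivializationAt (EuclideanSpace ℝ (Fin m)) (TangentSpace (𝓡 m) : M → Type _) x₀.1.2
  let e' := trivializationAt (EuclideanSpace ℝ (Fin m)) (TangentSpace (𝓡 m) : M → Type _) x₁.1.2
  have hsnd : ContMDiff ((𝓡 n).prod (𝓡 m)) (𝓡 m) ∞ fun x : W => x.1.2 :=
    contMDiff_snd.comp contMDiff_subtype_val
  have hev : ∀ᶠ x : W in 𝓝 x₁, x.1.2 ∈ (chartAt (EuclideanSpace ℝ (Fin m)) x₁.1.2).source :=
    hsnd.continuous.continuousAt.eventually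
      ((chartAt (EuclideanSpace ℝ (Fin m)) x₁.1.2).open_source.mem_nhds (mem_chart_source _ _))
  -- By definition, coefficients are known to be smooth only at the centre of their own
  -- trivialization. Near `x₁` the coefficients for `x₀` are polynomials in the transition functions
  -- and the coefficients for `x₁`.
  have heq : formCoeff τ.1 x₀ v =ᶠ[𝓝 x₁] fun x => ∑ J : Fin k → Fin m,
      (∏ i, (e.coordChange e' x.1.2 (v i)) (J i)) * formCoeff τ.1 x₁ (fun i => stdVec (J i)) x := by
    filter_upwards [hev] with x hx
    rw [← formCoeff_expand τ.1 x₁ x hx]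
    refine congrArg (τ.1 x) (funext fun i => ?_)
    have hx0 : x.1.2 ∈ e.baseSet := mem_chartAt_source_of_prod (hW x)
    have h1 := e.mk_symm hx0 (v i)
    have h2 := e'.symm_apply_apply_mk (show x.1.2 ∈ e'.baseSet from hx) (e.symm x.1.2 (v i))
    rw [h1] at h2
    exact h2.symm
  have hco : ∀ i j, ContMDiffAt ((𝓡 n).prod (𝓡 m)) 𝓘(ℝ) ∞
      (fun x : W => (e.coordChange e' x.1.2 (v i)) j) x₁ := fun i j => by
    have h1 : ContMDiffAt ((𝓡 n).prod (𝓡 m)) 𝓘(ℝ, EuclideanSpace ℝ (Fin m)) ∞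
        (fun x : W => e.coordChange e' x.1.2 (v i)) x₁ :=
      ContMDiffAt.coordChange hsnd.contMDiffAt contMDiffAt_const
        (mem_chartAt_source_of_prod (hW x₁)) (mem_chart_source _ _)
    exact ((EuclideanSpace.proj j : EuclideanSpace ℝ (Fin m) →L[ℝ]
      ℝ).contDiff.contMDiff.contMDiffAt).comp x₁ h1
  refine ContMDiffAt.congr_of_eventuallyEq ?_ heq
  refine contMDiffAt_finsetSum fun J _ => ?_
  exact (contMDiffAt_finsetProd fun i _ => hco i (J i)).mul (τ.2 x₁ _)

/-- Summed over all `J`, every permutation in the determinant of coordinate differentials reproduces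
`τ` once, as its sign cancels the one from permuting the arguments of `τ`. This accounts for the
factor `k!`. -/
lemma sum_formCoeff_wedge (τ : RelForm n m W k) (x₀ : W)
    (hW : ∀ x : W, x ∈ (extChartAt ((𝓡 n).prod (𝓡 m)) x₀).source) :
    (k.factorial : ℝ) • τ = ∑ J : Fin k → Fin m,
      funMulForm ⟨_, contMDiff_formCoeff τ x₀ hW fun i => stdVec (J i)⟩
        (wedgeForm fun i => coordFun x₀ hW (J i)) := by
  refine Subtype.ext (funext fun x => AlternatingMap.ext fun v => ?_)
  change evalForm n x v ((k.factorial : ℝ) • τ) = evalForm n x v (∑ J : Fin k → Fin m, _)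
  have hx := mem_chartAt_source_of_prod (hW x)
  let e := trivializationAt (EuclideanSpace ℝ (Fin m)) (TangentSpace (𝓡 m) : M → Type _) x₀.1.2
  have hb : x.1.2 ∈ e.baseSet := hx
  have hsurj : ∀ i, ∃ w, e.symm x.1.2 w = v i := fun i => ⟨e.continuousLinearMapAt ℝ x.1.2 (v i), by
    have h := Bundle.Trivialization.symmL_continuousLinearMapAt (R := ℝ) e hb (v i)
    rwa [Bundle.Trivialization.symmL_apply _ hb] at h⟩
  choose w hw using hsurj
  obtain rfl : (fun i => e.symm x.1.2 (w i)) = v := funext hw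
  rw [map_smul, map_sum]
  have hterm : ∀ J : Fin k → Fin m, evalForm n x (fun i => e.symm x.1.2 (w i))
      (funMulForm ⟨_, contMDiff_formCoeff τ x₀ hW fun i => stdVec (J i)⟩
        (wedgeForm fun i => coordFun x₀ hW (J i))) =
      ∑ σ : Equiv.Perm (Fin k), ((Equiv.Perm.sign σ : ℤ) : ℝ) *
        ((∏ i, w (σ i) (J i)) * formCoeff τ.1 x₀ (fun i => stdVec (J i)) x) := fun J => by
    change formCoeff τ.1 x₀ (fun i => stdVec (J i)) x * wedgeCovectors
      (fun i => dRel m (coordFun x₀ hW (J i)) x) (fun i => e.symm x.1.2 (w i)) = _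
    rw [wedgeCovectors_apply, Matrix.det_apply, Finset.mul_sum]
    refine Finset.sum_congr rfl fun σ _ => ?_
    rw [Units.smul_def, zsmul_eq_mul]
    have : ∀ i, Matrix.of (fun i j => dRel m (coordFun x₀ hW (J j)) x (e.symm x.1.2 (w i))) (σ i) i =
        w (σ i) (J i) := fun i => dRel_coordFun x₀ hW (J i) x (w (σ i))
    simp only [this]
    ring
  simp only [hterm]
  rw [Finset.sum_comm]
  have hsum : ∀ σ : Equiv.Perm (Fin k), ∑ J : Fin k → Fin m, ((Equiv.Perm.sign σ : ℤ) : ℝ) *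
      ((∏ i, w (σ i) (J i)) * formCoeff τ.1 x₀ (fun i => stdVec (J i)) x) =
      evalForm n x (fun i => e.symm x.1.2 (w i)) τ := fun σ => by
    rw [← Finset.mul_sum, ← formCoeff_expand τ.1 x₀ x hx fun i => w (σ i)]
    have h1 : formCoeff τ.1 x₀ (fun i => w (σ i)) x =
        Equiv.Perm.sign σ • τ.1 x (fun i => e.symm x.1.2 (w i)) :=
      (τ.1 x).map_perm (fun i => e.symm x.1.2 (w i)) σ
    rw [h1, Units.smul_def, zsmul_eq_mul, ← mul_assoc, ← Int.cast_mul]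
    simp [evalForm]
  simp only [hsum, Finset.sum_const, Finset.card_univ, Fintype.card_perm, Fintype.card_fin]
  rw [nsmul_eq_mul, smul_eq_mul]

/-- The part of `W` in the chart centred at `x₀`. -/
def chartOpens (x₀ : W) : Opens (G × M) :=
  W ⊓ ⟨(chartAt (ModelProd (EuclideanSpace ℝ (Fin n)) (EuclideanSpace ℝ (Fin m))) x₀.1).source,
    (chartAt _ x₀.1).open_source⟩

variable [Group G] [MulAction G M]

/-- The coefficients in the coordinate frame vanish on the loop space, so `τ` is a sum of multiples
of functions in the ideal; the differentials of such functions are not needed. -/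
lemma mem_relIdeal_of_chart (τ : RelForm n m W k) (x₀ : W)
    (hW : ∀ x : W, x ∈ (extChartAt ((𝓡 n).prod (𝓡 m)) x₀).source)
    (hτ : ∀ x : W, x.1.1 • x.1.2 = x.1.2 → τ.1 x = 0) : τ ∈ relIdeal n m W k := by
  have hk : (k.factorial : ℝ) ≠ 0 := Nat.cast_ne_zero.2 k.factorial_ne_zero
  rw [← inv_smul_smul₀ hk τ, sum_formCoeff_wedge τ x₀ hW]
  refine Submodule.smul_mem _ _ (Submodule.sum_mem _ fun J _ => Submodule.subset_span (Or.inl ?_))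
  refine ⟨_, fun x hx => ?_, _, fun x => rfl⟩
  change τ.1 x _ = 0
  rw [hτ x hx, AlternatingMap.zero_apply]

/-- A relative form which vanishes at the points of the loop space lies locally in
`J Ω^k + d_rel J ∧ Ω^(k-1)`. -/
lemma exists_formRes_mem_relIdeal (τ : RelForm n m W k)
    (hτ : ∀ x : W, x.1.1 • x.1.2 = x.1.2 → τ.1 x = 0) (x₀ : W) :
    ∃ (W' : Opens (G × M)) (h : W' ≤ W), x₀.1 ∈ W' ∧ formRes n m k h τ ∈ relIdeal n m W' k := by
  have hx₀ : x₀.1 ∈ chartOpens (n := n) (m := m) x₀ := ⟨x₀.2, mem_chart_source _ _⟩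
  refine ⟨chartOpens (n := n) (m := m) x₀, inf_le_left, hx₀,
    mem_relIdeal_of_chart _ ⟨x₀.1, hx₀⟩ (fun x => ?_) fun x hx => hτ ⟨x.1, _⟩ hx⟩
  rw [extChartAt_source, Opens.chartAt_eq]
  simpa using x.2.2

end LocalFrames

/-! ### Classes of relative forms on the loop space -/

section FormClasses

variable (n m : ℕ) (G M : Type) [TopologicalSpace G] [ChartedSpace (EuclideanSpace ℝ (Fin n)) G]
  [TopologicalSpace M] [ChartedSpace (EuclideanSpace ℝ (Fin m)) M] [IsManifold (𝓡 m) ∞ M]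
  [Group G] [MulAction G M]

/-- The passage to classes on the loop space as a morphism of presheaves on `G × M`. -/
def classHom (k : ℕ) : relPresheaf n m G M k ⟶
    (Opens.map (loopIncl G M)).op ⋙ (loopForms n m G M k).obj :=
  toSheafify (Opens.grothendieckTopology (TopCat.of (G × M))) (relPresheaf n m G M k) ≫
    ((TopCat.Sheaf.pullbackPushforwardAdjunction (ModuleCat.{0} ℝ) (loopIncl G M)).unit.app
      (quotientSheaf n m G M k)).hom

variable {n m G M} {k : ℕ}

/-- The class of a relative form, as a linear map. -/
def formClassLinear (W : Opens (G × M)) : RelForm n m W k →ₗ[ℝ]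
    (loopForms n m G M k).obj.obj (op ((Opens.map (loopIncl G M)).obj W)) :=
  ((classHom n m G M k).app (op W)).hom ∘ₗ (relIdeal n m W k).mkQ

lemma formClass_eq_zero {W : Opens (G × M)} {τ : RelForm n m W k} (h : τ ∈ relIdeal n m W k) :
    formClass n m k W τ = 0 := by
  have h0 : (relIdeal n m W k).mkQ τ = 0 := (Submodule.Quotient.mk_eq_zero _).2 h
  exact (congrArg (fun z => (classHom n m G M k).app (op W) z) h0).trans
    (map_zero ((classHom n m G M k).app (op W)).hom)

lemma map_formClass {W W' : Opens (G × M)} (h : W ≤ W') (τ : RelForm n m W' k)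
    (f : (Opens.map (loopIncl G M)).obj W ⟶ (Opens.map (loopIncl G M)).obj W') :
    (loopForms n m G M k).obj.map f.op (formClass n m k W' τ) =
      formClass n m k W (formRes n m k h τ) := by
  have hnat := (classHom n m G M k).naturality (homOfLE h : W ⟶ W').op
  have h2 := ConcreteCategory.congr_hom hnat (Submodule.Quotient.mk τ)
  exact h2.symm

variable [IsManifold (𝓡 n) ∞ G]

/-- The class of a relative form which vanishes at the points of the loop space is zero. -/
lemma formClass_eq_zero_of_vanishing {W : Opens (G × M)} {τ : RelForm n m W k}
    (hτ : ∀ x : W, x.1.1 • x.1.2 = x.1.2 → τ.1 x = 0) : formClass n m k W τ = 0 := by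
  choose V hV hmem hideal using exists_formRes_mem_relIdeal τ hτ
  -- Membership in the ideal is available only on chart neighbourhoods; these cover, and the classes
  -- live in a sheaf.
  refine TopCat.Sheaf.eq_of_locally_eq' (loopForms n m G M k)
    (fun x : W => (Opens.map (loopIncl G M)).obj (V x)) ((Opens.map (loopIncl G M)).obj W)
    (fun x => (Opens.map (loopIncl G M)).map (homOfLE (hV x))) (fun y hy => ?_) _ _ fun x => ?_
  · exact Opens.mem_iSup.2 ⟨⟨y.1, hy⟩, hmem ⟨y.1, hy⟩⟩
  · rw [map_zero]
    exact (map_formClass (hV x) τ _).trans (formClass_eq_zero (hideal x))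

end FormClasses

/-! ### The morphism of sheaf complexes -/

section Sheafification

variable (n m : ℕ) (G M : Type) [TopologicalSpace G] [ChartedSpace (EuclideanSpace ℝ (Fin n)) G]
  [Group G] [LieGroup (𝓡 n) ∞ G] [TopologicalSpace M] [ChartedSpace (EuclideanSpace ℝ (Fin m)) M]
  [IsManifold (𝓡 m) ∞ M] [MulAction G M] [ContMDiffSMul (𝓡 n) (𝓡 m) ∞ G M]

/-- For fixed `x` and `v` both sides are bounded functionals of the chain, and on pure tensors the
claim is the locality of `dRel`. -/
lemma formMap_chainRes (k : ℕ) {U V : Opens (orbitSpace G M)} (h : U ≤ V) (c : Chains n m k V) :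
    formMap n m k U (chainRes n m k h c) =
      formRes n m k (arrowOpens_mono h) (formMap n m k V c) := by
  refine Subtype.ext (funext fun x => AlternatingMap.ext fun v => ?_)
  have h1 := ((isBddFunctional_formFunctional (n := n) x v).comp_tensorMap
    (isTensorMap_map (pull (inclMap (I := (𝓡 n).prod (𝓡 m)) (arrowOpens_mono h)))
      (pull (inclMap (I := 𝓡 m) (baseOpens_mono h))) (bddMap_pull _) (bddMap_pull _) k)).ext
    (isBddFunctional_formFunctional (n := n) (U := V) ⟨x.1, h x.2⟩ v) fun s => by
      rw [LinearMap.comp_apply, tensorMap_pureTensor, formFunctional_apply, formFunctional_apply,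
        formFamily_pureTensor, formFamily_pureTensor, pureFormValue, pureFormValue]
      congr 1
      refine Finset.sum_congr rfl fun σ _ => ?_
      congr 1
      refine Finset.prod_congr rfl fun j _ => ?_
      exact LinearMap.congr_fun (dRel_funRes (n := n) m (arrowOpens_mono h)
        (pull (srcMap n m V) (s.2 j)) x) (v (σ j))
  have h2 := LinearMap.congr_fun h1 c
  rw [LinearMap.comp_apply, formFunctional_apply, formFunctional_apply] at h2
  exact h2

/-- The maps `c ↦ [Ψ(c)]` as a morphism of presheaves on the orbit space. -/
def chainToForms (k : ℕ) : chainPresheaf n m G M k ⟶ (pushedForms n m G M k).obj where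
  app U := ModuleCat.ofHom (formClassLinear (n := n) (m := m) (k := k) (arrowOpens U.unop) ∘ₗ
    formMap n m k U.unop)
  naturality U V h := by
    refine ModuleCat.hom_ext (LinearMap.ext fun c => ?_)
    change formClass n m k (arrowOpens V.unop) (formMap n m k V.unop (chainRes n m k h.unop.le c)) =
      (loopForms n m G M k).obj.map ((Opens.map (loopProj G M)).map h.unop).op
        (formClass n m k (arrowOpens U.unop) (formMap n m k U.unop c))
    have h1 := formMap_chainRes n m G M k h.unop.le c
    exact (congrArg (formClass n m k (arrowOpens V.unop)) h1).trans
      (map_formClass (arrowOpens_mono h.unop.le) _ _).symm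

/-- The component in degree `k` of the morphism from the Hochschild sheaf complex to the relative
forms. -/
def sheafComponent (k : ℕ) :
    (chainSheafComplex n m G M).X k ⟶ (formComplex n m G M).X k :=
  ⟨sheafifyLift _ (chainToForms n m G M k) (pushedForms n m G M k).property⟩

lemma sheafComponent_chainSection (k : ℕ) (U : Opens (orbitSpace G M)) (c : Chains n m k U) :
    (sheafComponent n m G M k).hom.app (op U) (chainSection n m k U c) =
      pushedClass n m k U (formMap n m k U c) := by
  have h := toSheafify_sheafifyLift _ (chainToForms n m G M k) (pushedForms n m G M k).property
  exact ConcreteCategory.congr_hom (NatTrans.congr_app h (op U)) c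

/-- This is the universal property of sheafification. It yields both the uniqueness of Φ and the
compatibility with differentials, which then need checking only on chains. -/
lemma chainSheafComplex_hom_ext {k : ℕ} {F : RSheaf (orbitSpace G M)}
    {f g : (chainSheafComplex n m G M).X k ⟶ F}
    (h : ∀ (U : Opens (orbitSpace G M)) (c : Chains n m k U),
      f.hom.app (op U) (chainSection n m k U c) = g.hom.app (op U) (chainSection n m k U c)) :
    f = g := by
  refine ObjectProperty.hom_ext _ ?_
  refine sheafify_hom_ext _ _ _ F.property ?_
  refine NatTrans.ext (funext fun U => ModuleCat.hom_ext (LinearMap.ext fun c => ?_))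
  exact h U.unop c

lemma chainSheafComplex_d (k : ℕ) : (chainSheafComplex n m G M).d (k + 1) k =
    (presheafToSheaf (Opens.grothendieckTopology (orbitSpace G M)) (ModuleCat.{0} ℝ)).map
      (presheafBoundary n m G M k) := by
  change (presheafToSheaf _ _).map (ChainComplex.of.d _ _ (k + 1) k) = _
  rw [ChainComplex.of_d]

lemma d_chainSection (k : ℕ) (U : Opens (orbitSpace G M)) (c : Chains n m (k + 1) U) :
    ((chainSheafComplex n m G M).d (k + 1) k).hom.app (op U) (chainSection n m (k + 1) U c) =
      chainSection n m k U (chainBoundary n m k U c) := by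
  rw [chainSheafComplex_d]
  have h := toSheafify_naturality (Opens.grothendieckTopology (orbitSpace G M))
    (presheafBoundary n m G M k)
  exact (ConcreteCategory.congr_hom (NatTrans.congr_app h (op U)) c).symm

lemma map_chainSection (k : ℕ) {U V : Opens (orbitSpace G M)} (h : U ≤ V) (c : Chains n m k V) :
    ((chainSheafComplex n m G M).X k).obj.map (homOfLE h).op (chainSection n m k V c) =
      chainSection n m k U (chainRes n m k h c) :=
  (ConcreteCategory.congr_hom ((toSheafify (Opens.grothendieckTopology (orbitSpace G M))
    (chainPresheaf n m G M k)).naturality (homOfLE h).op) c).symm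

/-- The chain map condition for a target with zero differential: the form of a boundary vanishes
pointwise on the loop space, which is enough for its class to be zero. -/
lemma pushedClass_chainBoundary (k : ℕ) (U : Opens (orbitSpace G M)) (c : Chains n m (k + 1) U) :
    pushedClass n m k U (formMap n m k U (chainBoundary n m k U c)) = 0 :=
  formClass_eq_zero_of_vanishing fun _ hx => formFamily_chainBoundary hx c

/-- The morphism from the Hochschild sheaf complex to the relative forms. -/
def sheafMorphism : chainSheafComplex n m G M ⟶ formComplex n m G M where
  f k := sheafComponent n m G M k
  comm' i j hij := by
    obtain rfl : j + 1 = i := hij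
    refine chainSheafComplex_hom_ext n m G M fun U c => ?_
    change ((0 : (formComplex n m G M).X (j + 1) ⟶ (formComplex n m G M).X j).hom.app (op U))
        ((sheafComponent n m G M (j + 1)).hom.app (op U) (chainSection n m (j + 1) U c)) =
      (sheafComponent n m G M j).hom.app (op U)
        (((chainSheafComplex n m G M).d (j + 1) j).hom.app (op U) (chainSection n m (j + 1) U c))
    rw [d_chainSection, sheafComponent_chainSection n m G M j, pushedClass_chainBoundary]
    rfl

/-- Sections of the Hochschild sheaf complex are locally defined by chains. -/
lemma exists_chainSection_eq {k : ℕ} {U : Opens (orbitSpace G M)}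
    (c : ((chainSheafComplex n m G M).X k).obj.obj (op U)) {q : orbitSpace G M} (hq : q ∈ U) :
    ∃ (V : Opens (orbitSpace G M)) (h : V ≤ U) (a : Chains n m k V), q ∈ V ∧
      chainSection n m k V a = ((chainSheafComplex n m G M).X k).obj.map (homOfLE h).op c := by
  have hsurj : Presheaf.IsLocallySurjective (Opens.grothendieckTopology (orbitSpace G M))
      (toSheafify (Opens.grothendieckTopology (orbitSpace G M)) (chainPresheaf n m G M k)) :=
    inferInstance
  obtain ⟨V, f, ⟨a, ha⟩, hqV⟩ := hsurj.imageSieve_mem c q hq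
  exact ⟨V, f.le, a, hqV, ha⟩

/-- Chains which define the same section are locally equal. -/
lemma exists_chainRes_eq {k : ℕ} {U : Opens (orbitSpace G M)} {a b : Chains n m k U}
    (hab : chainSection n m k U a = chainSection n m k U b) {q : orbitSpace G M} (hq : q ∈ U) :
    ∃ (V : Opens (orbitSpace G M)) (h : V ≤ U), q ∈ V ∧
      chainRes n m k h a = chainRes n m k h b := by
  have hinj : Presheaf.IsLocallyInjective (Opens.grothendieckTopology (orbitSpace G M))
      (toSheafify (Opens.grothendieckTopology (orbitSpace G M)) (chainPresheaf n m G M k)) :=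
    inferInstance
  obtain ⟨V, f, hf, hqV⟩ := hinj.equalizerSieve_mem (X := op U) a b hab q hq
  exact ⟨V, f.le, hqV, hf⟩

end Sheafification

/-! ### Gluing relative forms -/

section Gluing

variable {n m k : ℕ} {G M : Type} [TopologicalSpace G] [ChartedSpace (EuclideanSpace ℝ (Fin n)) G]
  [TopologicalSpace M] [ChartedSpace (EuclideanSpace ℝ (Fin m)) M] [IsManifold (𝓡 m) ∞ M]

/-- Relative forms which agree on overlaps can be glued. -/
lemma exists_glued_relForm {W : Opens (G × M)} (V : W → Opens (G × M)) (hV : ∀ x, V x ≤ W)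
    (hmem : ∀ x, x.1 ∈ V x) (σ : ∀ x, RelForm n m (V x) k)
    (hσ : ∀ (x y : W) (z : G × M) (hx : z ∈ V x) (hy : z ∈ V y),
      (σ x).1 ⟨z, hx⟩ = (σ y).1 ⟨z, hy⟩) :
    ∃ τ : RelForm n m W k, ∀ x, formRes n m k (hV x) τ = σ x := by
  -- At `x` the piece attached to `x` itself is used; by the agreement on overlaps this equals `σ
  -- x₀` on all of `V x₀`.
  let τ : FormFamily m W k := fun x => (σ x).1 ⟨x.1, hmem x⟩
  have hτ : ∀ (x₀ : W) (y : V x₀), τ ⟨y.1, hV x₀ y.2⟩ = (σ x₀).1 y := fun x₀ y =>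
    hσ ⟨y.1, hV x₀ y.2⟩ x₀ y.1 _ y.2
  refine ⟨⟨τ, fun x₀ v => ?_⟩, fun x₀ => Subtype.ext (funext fun y => hτ x₀ y)⟩
  -- Smoothness at `x₀` is local: extending the coefficient by zero to `G × M` transfers it from `V
  -- x₀` to `W`.
  have h1 : (fun x : W => Function.extend Subtype.val (formCoeff τ x₀ v) 0 x.1) =
      formCoeff τ x₀ v := funext fun x => Subtype.val_injective.extend_apply _ _ x
  have h2 : (fun y : V x₀ => Function.extend Subtype.val (formCoeff τ x₀ v) 0 y.1) =
      formCoeff (σ x₀).1 ⟨x₀.1, hmem x₀⟩ v := funext fun y =>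
    (Subtype.val_injective.extend_apply _ _ (⟨y.1, hV x₀ y.2⟩ : W)).trans
      (by rw [formCoeff, hτ]; rfl)
  rw [← h1]
  refine contMDiffAt_subtype_iff.2 ?_
  refine (contMDiffAt_subtype_iff (U := V x₀) (x := ⟨x₀.1, hmem x₀⟩)).1 ?_
  rw [h2]
  exact (σ x₀).2 ⟨x₀.1, hmem x₀⟩ v

end Gluing

/-! ### Cycles give horizontal forms -/

section Horizontality

variable (n m : ℕ) (G M : Type) [TopologicalSpace G] [ChartedSpace (EuclideanSpace ℝ (Fin n)) G]
  [Group G] [LieGroup (𝓡 n) ∞ G] [TopologicalSpace M] [ChartedSpace (EuclideanSpace ℝ (Fin m)) M]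
  [IsManifold (𝓡 m) ∞ M] [MulAction G M] [ContMDiffSMul (𝓡 n) (𝓡 m) ∞ G M]

variable {n m G M}

/-- Chains representing the same section become equal on a neighbourhood of the orbit of `z`, and Ψ
commutes with restriction. Already before passing to classes, the form is thus determined by the
section, so local forms glue without choices. -/
lemma formMap_eq_of_chainSection_eq {k : ℕ} {V V' : Opens (orbitSpace G M)}
    {a : Chains n m k V} {a' : Chains n m k V'} {F : Opens (orbitSpace G M)} (h : V ≤ F)
    (h' : V' ≤ F) (c : ((chainSheafComplex n m G M).X k).obj.obj (op F))
    (ha : chainSection n m k V a = ((chainSheafComplex n m G M).X k).obj.map (homOfLE h).op c)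
    (ha' : chainSection n m k V' a' = ((chainSheafComplex n m G M).X k).obj.map (homOfLE h').op c)
    (z : G × M) (hz : z ∈ arrowOpens V) (hz' : z ∈ arrowOpens V') :
    (formMap n m k V a).1 ⟨z, hz⟩ = (formMap n m k V' a').1 ⟨z, hz'⟩ := by
  have hcomp : ∀ {A : Opens (orbitSpace G M)} (hA : A ≤ F) (hB : V ⊓ V' ≤ A),
      ((chainSheafComplex n m G M).X k).obj.map (homOfLE hB).op
        (((chainSheafComplex n m G M).X k).obj.map (homOfLE hA).op c) =
      ((chainSheafComplex n m G M).X k).obj.map (homOfLE (hB.trans hA)).op c := fun hA hB =>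
    (ConcreteCategory.congr_hom (((chainSheafComplex n m G M).X k).obj.map_comp
      (homOfLE hA).op (homOfLE hB).op) c).symm
  have h1 : chainSection n m k (V ⊓ V') (chainRes n m k inf_le_left a) =
      chainSection n m k (V ⊓ V') (chainRes n m k inf_le_right a') := by
    rw [← map_chainSection, ← map_chainSection, ha, ha', hcomp, hcomp]
  obtain ⟨A, hA, hzA, hres⟩ := exists_chainRes_eq n m G M h1
    (q := orbitProj G M z.2) ⟨hz, hz'⟩
  rw [chainRes_chainRes, chainRes_chainRes] at hres
  have h2 := congrArg (fun b => (formMap n m k A b).1 ⟨z, hzA⟩) hres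
  simp only [formMap_chainRes] at h2
  exact h2

/-- Cycles are locally defined by cycles, whose forms vanish on vectors tangent to the orbits. -/
lemma exists_horizontal_chain {k : ℕ} {U : Opens (orbitSpace G M)}
    (c : ((chainSheafComplex n m G M).X k).obj.obj (op U))
    (hc : ∀ j, ((chainSheafComplex n m G M).d k j).hom.app (op U) c = 0)
    {q : orbitSpace G M} (hq : q ∈ U) :
    ∃ (V : Opens (orbitSpace G M)) (h : V ≤ U) (a : Chains n m k V), q ∈ V ∧
      chainSection n m k V a = ((chainSheafComplex n m G M).X k).obj.map (homOfLE h).op c ∧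
      ∀ x : arrowOpens V, x.1.1 • x.1.2 = x.1.2 → ∀ v : Fin k → TangentSpace (𝓡 m) x.1.2,
        (∃ i, v i ∈ orbitTangent n m (G := G) x.1.2) → (formMap n m k V a).1 x v = 0 := by
  obtain ⟨V, hV, a, hqV, ha⟩ := exists_chainSection_eq n m G M c hq
  cases k with
  -- A form of degree zero has no arguments, so the condition is empty.
  | zero => exact ⟨V, hV, a, hqV, ha, fun _ _ _ ⟨i, _⟩ => i.elim0⟩
  | succ k =>
    -- The local chain `a` need not be a cycle: only the section defined by its boundary vanishes.
    -- Restriction to a smaller neighbourhood of the orbit makes the boundary itself zero.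
    have h1 : chainSection n m k V (chainBoundary n m k V a) = chainSection n m k V 0 := by
      rw [← d_chainSection, ha]
      refine (ConcreteCategory.congr_hom (((chainSheafComplex n m G M).d (k + 1) k).hom.naturality
        (homOfLE hV).op) c).trans ?_
      refine (congrArg (fun z => ((chainSheafComplex n m G M).X k).obj.map (homOfLE hV).op z)
        (hc k)).trans ?_
      exact (map_zero (((chainSheafComplex n m G M).X k).obj.map (homOfLE hV).op).hom).trans
        (map_zero ((toSheafify (Opens.grothendieckTopology (orbitSpace G M))
          (chainPresheaf n m G M k)).app (op V)).hom).symm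
    obtain ⟨A, hA, hqA, hres⟩ := exists_chainRes_eq n m G M h1 hqV
    refine ⟨A, hA.trans hV, chainRes n m (k + 1) hA a, hqA, ?_, fun x hx v hv => ?_⟩
    · rw [← map_chainSection, ha]
      exact (ConcreteCategory.congr_hom (((chainSheafComplex n m G M).X (k + 1)).obj.map_comp
        (homOfLE hV).op (homOfLE hA).op) c).symm
    · refine formFamily_orbit hx ?_ v hv
      rw [chainBoundary_chainRes, hres, map_zero]

/-- Cycles are mapped to horizontal relative forms. -/
lemma isHorizontalSection_sheafComponent {k : ℕ} {U : Opens (orbitSpace G M)}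
    (c : ((chainSheafComplex n m G M).X k).obj.obj (op U))
    (hc : ∀ j, ((chainSheafComplex n m G M).d k j).hom.app (op U) c = 0) :
    IsHorizontalSection n m k U ((sheafComponent n m G M k).hom.app (op U) c) := by
  choose V hV a hmem ha hhor using fun x : arrowOpens (G := G) U =>
    exists_horizontal_chain c hc (q := orbitProj G M x.1.2) x.2
  -- The forms of the local chains agree at every common arrow, on or off the loop space, so they
  -- define one form on all arrows over `U`.
  obtain ⟨τ, hτ⟩ := exists_glued_relForm (W := arrowOpens (G := G) U)
    (fun x => arrowOpens (V x)) (fun x => arrowOpens_mono (hV x)) hmem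
    (fun x => formMap n m k (V x) (a x)) fun x y z hx hy =>
      formMap_eq_of_chainSection_eq (hV x) (hV y) c (ha x) (ha y) z hx hy
  refine ⟨arrowOpens U, rfl, τ, ?_, fun x hx v hv => ?_⟩
  · refine (ConcreteCategory.congr_hom ((loopForms n m G M k).obj.map_id _) _).trans ?_
    -- The class of `τ` and the image of `c` agree over each `V x`, where both are the class of the
    -- form of the chain `a x`.
    refine TopCat.Sheaf.eq_of_locally_eq' (loopForms n m G M k)
      (fun x : arrowOpens (G := G) U => (Opens.map (loopIncl G M)).obj (arrowOpens (V x)))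
      ((Opens.map (loopIncl G M)).obj (arrowOpens U))
      (fun x => (Opens.map (loopIncl G M)).map (homOfLE (arrowOpens_mono (hV x))))
      (fun y hy => Opens.mem_iSup.2 ⟨⟨y.1, hy⟩, hmem ⟨y.1, hy⟩⟩) _ _ fun x => ?_
    refine (map_formClass (arrowOpens_mono (hV x)) τ _).trans ?_
    rw [hτ]
    refine (sheafComponent_chainSection n m G M k (V x) (a x)).symm.trans ?_
    rw [ha]
    exact ConcreteCategory.congr_hom ((sheafComponent n m G M k).hom.naturality
      (homOfLE (hV x)).op) c
  · have h := congrArg (fun σ : RelForm n m (arrowOpens (V x)) k => σ.1 ⟨x.1, hmem x⟩) (hτ x)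
    have h' : τ.1 x = (formMap n m k (V x) (a x)).1 ⟨x.1, hmem x⟩ := h
    rw [h']
    exact hhor x ⟨x.1, hmem x⟩ hx v hv

end Horizontality

end

end LoopForms

open LoopForms in
theorem mainTheorem11 (n m : ℕ) (G M : Type)
    [TopologicalSpace G] [ChartedSpace (EuclideanSpace ℝ (Fin n)) G] [Group G]
    [LieGroup (𝓡 n) ∞ G] [CompactSpace G] [T2Space G]
    [TopologicalSpace M] [ChartedSpace (EuclideanSpace ℝ (Fin m)) M] [IsManifold (𝓡 m) ∞ M]
    [T2Space M] [SecondCountableTopology M]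
    [MulAction G M] [ContMDiffSMul (𝓡 n) (𝓡 m) ∞ G M] :
    ∃ Ψ : ∀ (k : ℕ) (U : Opens (orbitSpace G M)),
        Chains n m k U →ₗ[ℝ] RelForm n m (arrowOpens U) k,
      (∀ k U, IsFormMap n m k U (Ψ k U) ∧
        (∀ Ψ', IsFormMap n m k U Ψ' → Ψ' = Ψ k U) ∧
        ∀ φ ∈ InvariantFun n m U, ∀ (c : Chains n m k U) (x : arrowOpens U),
          (Ψ k U (chainSmul n m k U φ c)).1 x = φ (srcMap n m U x) • (Ψ k U c).1 x) ∧
      ∃ Φ : chainSheafComplex n m G M ⟶ formComplex n m G M,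
        (∀ (k : ℕ) (U : Opens (orbitSpace G M)) (c : Chains n m k U),
          (Φ.f k).hom.app (op U) (chainSection n m k U c) = pushedClass n m k U (Ψ k U c)) ∧
        (∀ Φ' : chainSheafComplex n m G M ⟶ formComplex n m G M,
          (∀ (k : ℕ) (U : Opens (orbitSpace G M)) (c : Chains n m k U),
            (Φ'.f k).hom.app (op U) (chainSection n m k U c) = pushedClass n m k U (Ψ k U c)) →
          Φ' = Φ) ∧
        ∀ (k : ℕ) (U : Opens (orbitSpace G M))
          (c : ((chainSheafComplex n m G M).X k).obj.obj (op U)),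
          (∀ j, ((chainSheafComplex n m G M).d k j).hom.app (op U) c = 0) →
          IsHorizontalSection n m k U ((Φ.f k).hom.app (op U) c) :=
  ⟨fun k U => formMap n m k U,
    fun _ _ => ⟨isFormMap_formMap, fun _ h => h.unique isFormMap_formMap,
      fun φ _ c x => formMap_chainSmul φ c x⟩,
    sheafMorphism n m G M, sheafComponent_chainSection n m G M,
    fun _ h => HomologicalComplex.hom_ext _ _ fun k => chainSheafComplex_hom_ext n m G M fun U c =>
      (h k U c).trans (sheafComponent_chainSection n m G M k U c).symm,
    fun _ _ c hc => isHorizontalSection_sheafComponent c hc⟩
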